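/- Let $(M,\sigma,\mu)$ be a $\sigma$-finite measure space and let $(T_t)_{t\ge 0}$ be a semigroup of positive, weak*-continuous (linear) contractions on the complex space $L^\infty(M)$, with $T_0=\mathrm{id}$ and $\langle T_tf,g\rangle\to\langle f,g\rangle$ as $t\to0+$ for all $f\in L^\infty(M)$, $g\in L^1(M)$, where $\langle f,g\rangle=\int f g^*\,d\mu$; write $T_t=e^{-tL}$, where $L$ is the negative generator. For $0<\alpha<1$, $t>0$ let $\phi_{t,\alpha}$ be the nonnegative function on $(0,\infty)$ with $\int_0^\infty e^{-\lambda v}\phi_{t,\alpha}(v)\,dv=e^{-t\lambda^\alpha}$ for all $\lambda>0$, and let $T_{t,\alpha}=e^{-tL^\alpha}$ be defined by the weak* integral $T_{t,\alpha}f=\int_0^\infty T_vf\,\phi_{t,\alpha}(v)\,dv$; let $T_{t,1}=T_t$. For $f\in L^\infty(M)$ and $0<\alpha\le 1$ put $$\|f\|_{bmo(L^\alpha)}=\sup_{t>0}\big\|T_{t,\alpha}|f|^2-|T_{t,\alpha}f|^2\big\|_{L^\infty}^{1/2},\qquad \|f\|_{BMO(L^\alpha)}=\sup_{t>0}\big\|T_{t,\alpha}|f-T_{t,\alpha}f|^2\big\|_{L^\infty}^{1/2}.$$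 (i) There is an absolute constant $c>0$ such that, for all such $(M,\sigma,\mu)$ and $(T_t)$, all $0<\beta<\alpha\le 1$ and all $f\in L^\infty(M)$, $$\|f\|_{BMO(L^\beta)}\le\frac{c\,\alpha}{\beta}\,\|f\|_{BMO(L^\alpha)}.$$ (ii) For all such $(M,\sigma,\mu)$ and $(T_t)$, all $0<\beta<1$ and all $f\in L^\infty(M)$, $$\|f\|_{BMO(L^\beta)}\le\frac{4}{1-\beta}\,\|f\|_{bmo(L^\beta)}.$$ Assume in addition that the semigroup satisfies the criterion $\Gamma^2\ge0$, that is, $$T_t|T_uf|^2-|T_tT_uf|^2\le T_u\big(T_t|f|^2-|T_tf|^2\big)\qquad\text{for all } t,u>0,\ f\in L^\infty(M).$$ (iii) For all $0<\alpha,\beta<1$, $$\|f\|_{BMO(L^\alpha)}\simeq\|f\|_{bmo(L^\alpha)}\simeq\|f\|_{bmo(L^\beta)}\simeq\|f\|_{BMO(L^\beta)}\qquad(f\in L^\infty(M)),$$ with constants depending only on $\alpha$ and $\beta$. (iv) There are absolute constants $c_1,c_2>0$ such that, for all such $(M,\sigma,\mu)$ and $(T_t)$, all $\frac12<\alpha<1$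 and all $f\in L^\infty(M)$, $$c_1(1-\alpha)^2\,\|f\|_{BMO(L^\alpha)}\le\|f\|_{BMO(\sqrt L)}\le c_2\,\|f\|_{BMO(L^\alpha)},\qquad BMO(\sqrt L)=BMO(L^{1/2}).$$ -/

import Mathlib

open MeasureTheory Set Filter
open scoped ENNReal Topology

universe u

noncomputable section

namespace SemigroupBMO

variable {M : Type u} [MeasurableSpace M] {μ : Measure M}

/-- `h ≥ 0` for a complex function class `h ∈ L^∞(M)`: it is real and nonnegative a.e. -/
def IsNonneg (h : Lp ℂ ∞ μ) : Prop :=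
  ∀ᵐ x ∂μ, 0 ≤ (h x).re ∧ (h x).im = 0

theorem memLp_absSq (f : Lp ℂ ∞ μ) :
    MemLp (fun x => ((‖f x‖ ^ 2 : ℝ) : ℂ)) ∞ μ := by
  refine memLp_top_of_bound ?_ (lpNorm f ∞ μ ^ 2) ?_
  · exact Complex.continuous_ofReal.comp_aestronglyMeasurable
      ((Lp.aestronglyMeasurable f).norm.pow 2)
  · filter_upwards [ae_le_lpNorm_exponent_top (Lp.memLp f)] with x hx
    rw [Complex.norm_real, Real.norm_of_nonneg (by positivity)]
    gcongr

/-- The function `|f|^2` as an element of `L^∞(M)`. -/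
def absSq (f : Lp ℂ ∞ μ) : Lp ℂ ∞ μ := (memLp_absSq f).toLp _

/-- The duality bracket `⟨f, g⟩ = ∫ f g^* dμ` of `f ∈ L^∞(M)` and `g ∈ L^1(M)`. -/
def pairing (f : Lp ℂ ∞ μ) (g : Lp ℂ 1 μ) : ℂ :=
  ∫ x, f x * (starRingEnd ℂ) (g x) ∂μ

/-- The weak* topology of `L^∞(M)`: the coarsest topology for which all the functionals
`f ↦ ⟨f, g⟩`, `g ∈ L^1(M)`, are continuous. -/
abbrev weakStar (μ : Measure M) : TopologicalSpace (Lp ℂ ∞ μ) :=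
  TopologicalSpace.induced (fun f (g : Lp ℂ 1 μ) => pairing f g) inferInstance

/-- A weak* continuous semigroup `(T_t)_{t ≥ 0}` of positive contractions on `L^∞(M)`.
The index is a real number; only the values at `t ≥ 0` are constrained and used. -/
structure PositiveContractionSemigroup (μ : Measure M) where
  /-- The operators `T_t`. -/
  T : ℝ → Lp ℂ ∞ μ →ₗ[ℂ] Lp ℂ ∞ μ
  positive : ∀ t, 0 ≤ t → ∀ f, IsNonneg f → IsNonneg (T t f)
  contractive : ∀ t, 0 ≤ t → ∀ f, ‖T t f‖ ≤ ‖f‖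
  normal : ∀ t, 0 ≤ t → Continuous[weakStar μ, weakStar μ] (T t)
  zero : ∀ f, T 0 f = f
  add : ∀ s t, 0 ≤ s → 0 ≤ t → ∀ f, T (s + t) f = T s (T t f)
  tendsto_zero : ∀ (f : Lp ℂ ∞ μ) (g : Lp ℂ 1 μ),
    Tendsto (fun t => pairing (T t f) g) (𝓝[>] 0) (𝓝 (pairing f g))

/-- For `s > 0` and `0 < α < 1`, the function `φ_{s,α}` on `(0,∞)` whose Laplace transform is
`z ↦ e^{-s z^α}`, given by the inversion integral
`(1 / 2πi) ∫ e^{zv} e^{-s z^α} dz` along the imaginary axis `z = iy` (principal branch).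
The integral converges absolutely there, since `Re (iy)^α = cos (πα/2) |y|^α`, and it is the same
along every vertical line `Re z = σ` with `σ ≥ 0`; it is real. -/
def stableDensity (s α v : ℝ) : ℝ :=
  ((2 * Real.pi : ℂ)⁻¹ * ∫ y : ℝ,
    Complex.exp (Complex.I * y * v) * Complex.exp (-(s * (Complex.I * y) ^ (α : ℂ)))).re

/-- `h = ∫_0^∞ w(v) F(v) dv` as a weak* integral in `L^∞(M)`. -/
def IsWeakStarIntegral (w : ℝ → ℝ) (F : ℝ → Lp ℂ ∞ μ) (h : Lp ℂ ∞ μ) : Prop :=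
  ∀ g : Lp ℂ 1 μ,
    IntegrableOn (fun v => (w v : ℂ) * pairing (F v) g) (Ioi 0) ∧
      pairing h g = ∫ v in Ioi (0 : ℝ), (w v : ℂ) * pairing (F v) g

open Classical in
/-- The weak* integral `∫_0^∞ w(v) F(v) dv` (it is unique when it exists, `μ` being
sigma-finite). -/
def weakStarIntegral (w : ℝ → ℝ) (F : ℝ → Lp ℂ ∞ μ) : Lp ℂ ∞ μ :=
  if h : ∃ k, IsWeakStarIntegral w F k then h.choose else 0

namespace PositiveContractionSemigroup

variable (S : PositiveContractionSemigroup μ)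

/-- The operators `T_{t,α} = e^{-t L^α}`, where `T_t = e^{-t L}`: for `α = 1` these are the `T_t`,
and for `0 < α < 1` they are the subordinated operators
`T_{t,α} f = ∫_0^∞ φ_{t,α}(v) T_v f dv`. -/
def frac (α t : ℝ) (f : Lp ℂ ∞ μ) : Lp ℂ ∞ μ :=
  if α = 1 then S.T t f else weakStarIntegral (stableDensity t α) (fun v => S.T v f)

/-- `‖f‖_{bmo(L^α)} = sup_{t > 0} ‖ T_{t,α}|f|^2 - |T_{t,α} f|^2 ‖_∞^{1/2}`. -/
def bmo (α : ℝ) (f : Lp ℂ ∞ μ) : ℝ≥0∞ :=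
  ⨆ (t : ℝ) (_ : 0 < t),
    ENNReal.ofReal (Real.sqrt ‖S.frac α t (absSq f) - absSq (S.frac α t f)‖)

/-- `‖f‖_{BMO(L^α)} = sup_{t > 0} ‖ T_{t,α}|f - T_{t,α} f|^2 ‖_∞^{1/2}`. -/
def BMO (α : ℝ) (f : Lp ℂ ∞ μ) : ℝ≥0∞ :=
  ⨆ (t : ℝ) (_ : 0 < t),
    ENNReal.ofReal (Real.sqrt ‖S.frac α t (absSq (f - S.frac α t f))‖)

/-- The criterion `Γ² ≥ 0`:
`T_t|T_u f|^2 - |T_t T_u f|^2 ≤ T_u (T_t|f|^2 - |T_t f|^2)` for all `t, u > 0`, `f ∈ L^∞(M)`. -/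
def GammaTwoNonneg : Prop :=
  ∀ t u : ℝ, 0 < t → 0 < u → ∀ f : Lp ℂ ∞ μ,
    IsNonneg (S.T u (S.T t (absSq f) - absSq (S.T t f)) -
      (S.T t (absSq (S.T u f)) - absSq (S.T t (S.T u f))))

end PositiveContractionSemigroup

end SemigroupBMO

end

/-!
The estimates combine convexity (Jensen and Kadison–Schwarz) for the weak* averages
`P f = ∫ T_v f dν(v)` with precise information about the one-sided stable laws `ν_{t,α}` of density
`φ_{t,α}`, for which `T_{t,α} f = ∫ T_v f dν_{t,α}(v)`.

*Stable laws.* The density `φ_{t,α}` is given by a Fourier integral. Shifting the contour and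
Fourier inversion give its Laplace transform `exp (-t z^α)`, which is completely monotone, whence
`φ_{t,α} ≥ 0` (`ae_stableDensity_nonneg`). For `r ≥ 1` the function
`r^{1/(1-α)} exp (-t z^α) - exp (-r t z^α)` is completely monotone too, whence
`ν_{rt,α} ≤ r^{1/(1-α)} ν_{t,α}` (`stableMeasure_mul_le`). Uniqueness of Laplace transforms yields
the convolution law, scaling, and the composition rule `(L^α)^γ = L^{γα}` (`bind_stableMeasure`).
So `T_{t,α}` is again a semigroup of the same kind (`subord`), and the norms for `L^{γα}` are the
norms of exponent `γ` for that semigroup. That `T_{t,α}` exists as an operator on `L^∞` uses that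
`L^∞` is the dual of `L^1`, and its weak* continuity uses that sequentially normal functionals on
`L^∞` come from `L^1`.

*`BMO(L^γ) ≲ γ⁻¹ BMO(L)`.* If `f` has `BMO(L)` norm at most `N`, then
`T_s |f - T_v f|^2 ≤ N^2 (2 + 4 log⁺(v/s))^2` by a dyadic chain from `s` to `v`
(`op_absSq_sub_le`). Since `f - P f = ∫ (f - T_v f) dν(v)` for `P = T_{t,γ}`, Jensen's inequality
for the forms `⟨T_s |·|^2, g⟩` bounds `P |f - P f|^2` by a squared logarithmic moment of `ν_{t,γ}`,
which is `O(γ⁻²)` (`posLog_moment_stableMeasure`).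

*`BMO ≤ 4/(1-β) bmo`.* Write `P |f - P f|^2 = Γ_P(f - P f) + |P f - P^2 f|^2` with
`Γ_P(f) = P |f|^2 - |P f|^2`. The first term is at most `4 ‖f‖_bmo^2`. For the second, if
`ν ≤ C ν'` then the Kadison–Schwarz inequality for `C P' - P ≥ 0` gives
`|P f - P' f|^2 ≤ (C - 1) Γ_{P'}(f)` (`gam_avg_of_measure_le`); about `1/(1-β)` dilations, each of
which at most doubles the density, lead from `t` to `2t`.

*Under `Γ² ≥ 0`.* The criterion passes to the subordinated semigroups by Jensen's inequality for
`Γ_P`, applied to the two operators in turn. It gives `2 Γ_P(P f) ≤ Γ_{P^2}(f)`, so that the second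
part of `f = (f - P f) + P f` can be absorbed and `bmo ≤ 4 BMO`. Finally `ν_{b,α}` is dominated by
a multiple of some `ν_{t,γα}` (`exists_stableMeasure_le`), which compares the `bmo` norms of `L^α`
and `L^{γα}`.
-/

noncomputable section

namespace SemigroupBMO

/-! ### Complete monotonicity -/

/-- `F` is completely monotone on `(0, ∞)`: it has a sequence of successive negated derivatives,
all of them nonnegative. -/
def CompletelyMonotone (F : ℝ → ℝ) : Prop :=
  ∃ D : ℕ → ℝ → ℝ, (∀ x, 0 < x → D 0 x = F x) ∧
    (∀ n x, 0 < x → HasDerivAt (D n) (-D (n + 1) x) x) ∧ ∀ n x, 0 < x → 0 ≤ D n x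

theorem CompletelyMonotone.nonneg {F : ℝ → ℝ} (h : CompletelyMonotone F) {x : ℝ} (hx : 0 < x) :
    0 ≤ F x := by
  obtain ⟨D, h0, -, h2⟩ := h
  rw [← h0 x hx]; exact h2 0 x hx

theorem CompletelyMonotone.sub_shift {F : ℝ → ℝ} (h : CompletelyMonotone F) :
    CompletelyMonotone (fun x => F x - F (x + 1)) := by
  obtain ⟨D, h0, h1, h2⟩ := h
  refine ⟨fun n x => D n x - D n (x + 1), fun x hx => ?_, fun n x hx => ?_, fun n x hx => ?_⟩
  · simp only [h0 x hx, h0 (x + 1) (by linarith)]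
  · have := (h1 n x hx).sub ((h1 n (x + 1) (by linarith)).comp_add_const x 1)
    exact this.congr_deriv (by ring)
  · have anti : AntitoneOn (D n) (Ioi 0) := by
      refine antitoneOn_of_deriv_nonpos (convex_Ioi 0)
        (fun y hy => (h1 n y hy).continuousAt.continuousWithinAt) ?_ ?_
      · rw [interior_Ioi]
        exact fun y hy => (h1 n y hy).differentiableAt.differentiableWithinAt
      · rw [interior_Ioi]
        intro y hy
        rw [(h1 n y hy).deriv]
        have := h2 (n + 1) y hy
        linarith
    have := anti (show x ∈ Ioi (0 : ℝ) from hx) (show x + 1 ∈ Ioi (0 : ℝ) from by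
      simp only [mem_Ioi]; linarith) (by linarith)
    simp only [sub_nonneg]; exact this

theorem CompletelyMonotone.congr {F G : ℝ → ℝ} (h : CompletelyMonotone F)
    (hFG : ∀ x, 0 < x → F x = G x) : CompletelyMonotone G := by
  obtain ⟨D, h0, h1, h2⟩ := h
  exact ⟨D, fun x hx => (h0 x hx).trans (hFG x hx), h1, h2⟩

/-! ### The derivatives of `exp (-s x ^ β)` -/

section DerivPoly

open Polynomial in
/-- The operator `Q ↦ n Q + β X (Q - Q')`, which turns the polynomial factor of the `n`-th
derivative of `exp (-x ^ β)` into that of the next one. -/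
def derivStep (β : ℝ) (n : ℕ) (Q : ℝ[X]) : ℝ[X] := C (n : ℝ) * Q + C β * (X * (Q - derivative Q))

open Polynomial in
/-- The polynomials obtained from `Q` by iterating `derivStep`. For `Q = 1` these satisfy
`(-d/dx)^n exp (-x ^ β) = x ^ (-n) P_n (x ^ β) exp (-x ^ β)`. -/
def derivPoly (β : ℝ) (Q : ℝ[X]) : ℕ → ℝ[X]
  | 0 => Q
  | n + 1 => derivStep β n (derivPoly β Q n)

open Polynomial

theorem coeff_derivStep_zero (β : ℝ) (n : ℕ) (Q : ℝ[X]) :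
    (derivStep β n Q).coeff 0 = n * Q.coeff 0 := by
  simp [derivStep]

theorem coeff_derivStep_succ (β : ℝ) (n k : ℕ) (Q : ℝ[X]) :
    (derivStep β n Q).coeff (k + 1) = (n - β * (k + 1)) * Q.coeff (k + 1) + β * Q.coeff k := by
  simp only [derivStep, coeff_add, coeff_C_mul, coeff_X_mul, coeff_sub, coeff_derivative]
  ring

theorem coeff_derivPoly_one_eq_zero (β : ℝ) (n k : ℕ) (h : n < k) :
    (derivPoly β 1 n).coeff k = 0 := by
  induction n generalizing k with
  | zero => simp [derivPoly, coeff_one, h.ne']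
  | succ n ih =>
    obtain ⟨k, rfl⟩ : ∃ j, k = j + 1 := ⟨k - 1, by omega⟩
    rw [derivPoly, coeff_derivStep_succ, ih _ (by omega), ih _ (by omega)]
    ring

theorem coeff_derivPoly_one_nonneg {β : ℝ} (h0 : 0 < β) (h1 : β < 1) (n k : ℕ) :
    0 ≤ (derivPoly β 1 n).coeff k := by
  induction n generalizing k with
  | zero => simp only [derivPoly, coeff_one]; split_ifs <;> norm_num
  | succ n ih =>
    rcases k with _ | k
    · rw [derivPoly, coeff_derivStep_zero]
      exact mul_nonneg n.cast_nonneg (ih 0)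
    · rw [derivPoly, coeff_derivStep_succ]
      refine add_nonneg ?_ (mul_nonneg h0.le (ih k))
      rcases le_or_gt (k + 1) n with h | h
      · refine mul_nonneg ?_ (ih _)
        have : ((k : ℝ) + 1) ≤ n := by exact_mod_cast h
        nlinarith
      · rw [coeff_derivPoly_one_eq_zero β n _ h, mul_zero]

/-- The polynomial `K + X`; the polynomials it generates are `K P_n + X P_n - X P_n'`. -/
def startPoly (K : ℝ) : ℝ[X] := C K + X

theorem derivPoly_startPoly (β K : ℝ) (n : ℕ) :
    derivPoly β (startPoly K) n =
      C K * derivPoly β 1 n + X * derivPoly β 1 n - X * derivative (derivPoly β 1 n) := by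
  induction n with
  | zero => simp [derivPoly, startPoly]
  | succ n ih =>
    rw [derivPoly, ih, derivPoly]
    simp only [derivStep, derivative_add, derivative_sub, derivative_mul, derivative_C,
      derivative_X]
    ring

theorem coeff_derivPoly_startPoly_eq_zero (β K : ℝ) (n k : ℕ) (h : n + 1 < k) :
    (derivPoly β (startPoly K) n).coeff k = 0 := by
  induction n generalizing k with
  | zero =>
    have h1 : k ≠ 0 := by omega
    have h2 : 1 ≠ k := by omega
    simp [derivPoly, startPoly, coeff_X, coeff_C, h1, h2]
  | succ n ih =>
    obtain ⟨k, rfl⟩ : ∃ j, k = j + 1 := ⟨k - 1, by omega⟩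
    rw [derivPoly, coeff_derivStep_succ, ih _ (by omega), ih _ (by omega)]
    ring

theorem coeff_derivPoly_startPoly_top (β K : ℝ) (n : ℕ) :
    (derivPoly β (startPoly K) n).coeff (n + 1) = β ^ n := by
  induction n with
  | zero => simp [derivPoly, startPoly]
  | succ n ih =>
    rw [derivPoly, coeff_derivStep_succ, ih, coeff_derivPoly_startPoly_eq_zero _ _ _ _ (by omega)]
    ring

theorem coeff_derivPoly_startPoly_self (β K : ℝ) (n : ℕ) :
    β * (derivPoly β (startPoly K) n).coeff n =
      β ^ n * (β * K + n * (n - 1) / 2 - β * (n * (n + 1) / 2)) := by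
  induction n with
  | zero => simp [derivPoly, startPoly]
  | succ n ih =>
    rw [derivPoly, coeff_derivStep_succ, coeff_derivPoly_startPoly_top, mul_add, ih]
    push_cast
    ring

/-- For `K = 1 / (1 - β)` all the coefficients are nonnegative. The recursion has nonnegative
coefficients except at the index next to the top one, where the value is explicit. -/
theorem coeff_derivPoly_startPoly_nonneg {β : ℝ} (h0 : 0 < β) (h1 : β < 1) (n k : ℕ) :
    0 ≤ (derivPoly β (startPoly (1 / (1 - β))) n).coeff k := by
  have hu : 0 < 1 - β := by linarith
  induction n generalizing k with
  | zero =>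
    simp only [derivPoly, startPoly, coeff_add, coeff_C, coeff_X]
    split_ifs <;> positivity
  | succ n ih =>
    rcases lt_trichotomy k (n + 1) with h | h | h
    · rcases k with _ | k
      · rw [derivPoly, coeff_derivStep_zero]
        exact mul_nonneg n.cast_nonneg (ih 0)
      · rw [derivPoly, coeff_derivStep_succ]
        refine add_nonneg (mul_nonneg ?_ (ih _)) (mul_nonneg h0.le (ih k))
        have : ((k : ℝ) + 1) ≤ n := by exact_mod_cast (by omega : k + 1 ≤ n)
        nlinarith
    · subst h
      have key := coeff_derivPoly_startPoly_self β (1 / (1 - β)) (n + 1)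
      refine nonneg_of_mul_nonneg_right (key ▸ ?_) h0
      refine mul_nonneg (by positivity) ?_
      have hn : (1 : ℝ) ≤ ((n + 1 : ℕ) : ℝ) := by exact_mod_cast Nat.succ_le_succ (Nat.zero_le n)
      generalize ((n + 1 : ℕ) : ℝ) = m at hn
      refine nonneg_of_mul_nonneg_right (b := β * (1 / (1 - β)) + m * (m - 1) / 2
        - β * (m * (m + 1) / 2)) (a := 2 * (1 - β)) ?_ (by linarith)
      have : 2 * (1 - β) * (β * (1 / (1 - β)) + m * (m - 1) / 2 - β * (m * (m + 1) / 2)) =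
          2 * β + (1 - β) * (m * (m - 1)) - (1 - β) * β * (m * (m + 1)) := by
        field_simp
      rw [this]
      nlinarith [sq_nonneg ((1 - β) * m - 1), sq_nonneg β, mul_nonneg (sq_nonneg (1 - β))
        (sub_nonneg.2 hn)]
    · rcases (by omega : k = n + 2 ∨ n + 2 < k) with rfl | h'
      · rw [coeff_derivPoly_startPoly_top]; positivity
      · rw [coeff_derivPoly_startPoly_eq_zero _ _ _ _ (by omega)]

theorem eval_nonneg_of_coeff_nonneg {Q : ℝ[X]} (h : ∀ k, 0 ≤ Q.coeff k) {x : ℝ} (hx : 0 ≤ x) :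
    0 ≤ Q.eval x := by
  rw [eval_eq_sum_range]
  exact Finset.sum_nonneg fun k _ => mul_nonneg (h k) (pow_nonneg hx k)

/-- The functions `x ^ (-n) P_n (s x ^ β) exp (-s x ^ β)`. -/
def expPowDeriv (s β : ℝ) (n : ℕ) (x : ℝ) : ℝ :=
  (x ^ n)⁻¹ * ((derivPoly β 1 n).eval (s * x ^ β) * Real.exp (-(s * x ^ β)))

theorem expPowDeriv_zero (s β x : ℝ) : expPowDeriv s β 0 x = Real.exp (-(s * x ^ β)) := by
  simp [expPowDeriv, derivPoly]

theorem hasDerivAt_expPowDeriv (s β : ℝ) (n : ℕ) {x : ℝ} (hx : 0 < x) :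
    HasDerivAt (expPowDeriv s β n) (-expPowDeriv s β (n + 1) x) x := by
  have hu : HasDerivAt (fun x : ℝ => s * x ^ β) (s * (β * x ^ (β - 1))) x :=
    (Real.hasDerivAt_rpow_const (Or.inl hx.ne')).const_mul s
  have hp : HasDerivAt (fun x : ℝ => (x ^ n)⁻¹) (-(n * x ^ (n - 1)) / (x ^ n) ^ 2) x :=
    (hasDerivAt_pow n x).fun_inv (by positivity)
  have hneg : HasDerivAt (fun x : ℝ => -(s * x ^ β)) (-(s * (β * x ^ (β - 1)))) x := hu.neg
  have hq := (((derivPoly β 1 n).hasDerivAt (s * x ^ β)).comp x hu).mul hneg.exp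
  have := hp.mul hq
  refine this.congr_deriv ?_
  simp only [expPowDeriv, derivPoly, derivStep, Function.comp, eval_add, eval_mul, eval_C, eval_X,
    eval_sub, Pi.mul_apply]
  rw [Real.rpow_sub_one hx.ne']
  have h2 : (x ^ n)⁻¹ ≠ 0 := by positivity
  have h3 : -(n * x ^ (n - 1)) / (x ^ n) ^ 2 = -n * ((x ^ n)⁻¹ * x⁻¹) := by
    rcases n with _ | n
    · simp
    · rw [Nat.add_sub_cancel, pow_succ]
      field_simp
      ring
  rw [h3, pow_succ, mul_inv]
  field_simp
  ring

theorem expPowDeriv_nonneg {s β : ℝ} (hs : 0 < s) (h0 : 0 < β) (h1 : β < 1) (n : ℕ) {x : ℝ}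
    (hx : 0 < x) : 0 ≤ expPowDeriv s β n x :=
  mul_nonneg (by positivity) (mul_nonneg (eval_nonneg_of_coeff_nonneg
    (coeff_derivPoly_one_nonneg h0 h1 n) (by positivity)) (Real.exp_nonneg _))

theorem completelyMonotone_exp_neg_rpow {s β : ℝ} (hs : 0 < s) (h0 : 0 < β) (h1 : β < 1) :
    CompletelyMonotone (fun x => Real.exp (-(s * x ^ β))) :=
  ⟨expPowDeriv s β, fun x _ => expPowDeriv_zero s β x,
    fun n _ hx => hasDerivAt_expPowDeriv s β n hx, fun n _ hx => expPowDeriv_nonneg hs h0 h1 n hx⟩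

/-- `y ^ (-K) P_n (y) exp (-y)` is decreasing in `y`, because `K P_n + y P_n - y P_n'` has
nonnegative coefficients. -/
theorem antitoneOn_rpow_mul_eval_derivPoly {β : ℝ} (h0 : 0 < β) (h1 : β < 1) (n : ℕ) :
    AntitoneOn (fun y : ℝ => y ^ (-(1 / (1 - β))) * ((derivPoly β 1 n).eval y * Real.exp (-y)))
      (Ioi 0) := by
  set K := 1 / (1 - β)
  have hd : ∀ y : ℝ, 0 < y → HasDerivAt
      (fun y : ℝ => y ^ (-K) * ((derivPoly β 1 n).eval y * Real.exp (-y)))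
      (-(y ^ (-K - 1) * ((derivPoly β (startPoly K) n).eval y * Real.exp (-y)))) y := by
    intro y hy
    have := (Real.hasDerivAt_rpow_const (p := -K) (Or.inl hy.ne')).mul
      (((derivPoly β 1 n).hasDerivAt y).mul (hasDerivAt_neg y).exp)
    refine this.congr_deriv ?_
    rw [derivPoly_startPoly, Real.rpow_sub_one hy.ne']
    simp only [eval_add, eval_mul, eval_C, eval_X, eval_sub, Pi.mul_apply]
    field_simp
    ring
  refine antitoneOn_of_deriv_nonpos (convex_Ioi 0)
    (fun y hy => (hd y hy).continuousAt.continuousWithinAt) ?_ ?_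
  · rw [interior_Ioi]
    exact fun y hy => (hd y hy).differentiableAt.differentiableWithinAt
  · rw [interior_Ioi]
    intro y hy
    have hy' : 0 < y := hy
    rw [(hd y hy).deriv, neg_nonpos]
    exact mul_nonneg (by positivity) (mul_nonneg (eval_nonneg_of_coeff_nonneg
      (coeff_derivPoly_startPoly_nonneg h0 h1 n) hy'.le) (Real.exp_nonneg _))

theorem completelyMonotone_rpow_mul_exp_sub_exp {s r β : ℝ} (hs : 0 < s) (hr : 1 ≤ r)
    (h0 : 0 < β) (h1 : β < 1) :
    CompletelyMonotone (fun x => r ^ (1 / (1 - β)) * Real.exp (-(s * x ^ β)) -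
      Real.exp (-(r * s * x ^ β))) := by
  have hr0 : 0 < r := by linarith
  refine ⟨fun n x => r ^ (1 / (1 - β)) * expPowDeriv s β n x - expPowDeriv (r * s) β n x,
    fun x _ => by simp only [expPowDeriv_zero], fun n x hx => ?_, fun n x hx => ?_⟩
  · have := ((hasDerivAt_expPowDeriv s β n hx).const_mul (r ^ (1 / (1 - β)))).sub
      (hasDerivAt_expPowDeriv (r * s) β n hx)
    exact this.congr_deriv (by ring)
  · have hy : 0 < s * x ^ β := by positivity
    have := antitoneOn_rpow_mul_eval_derivPoly h0 h1 n (show s * x ^ β ∈ Ioi (0 : ℝ) from hy)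
      (show r * (s * x ^ β) ∈ Ioi (0 : ℝ) from mul_pos hr0 hy) (by nlinarith)
    simp only at this
    rw [Real.mul_rpow hr0.le hy.le, mul_comm (r ^ _), mul_assoc] at this
    have h3 := le_of_mul_le_mul_left this (by positivity)
    rw [Real.rpow_neg hr0.le, inv_mul_le_iff₀ (by positivity)] at h3
    simp only [expPowDeriv, sub_nonneg, mul_assoc]
    rw [← mul_assoc (r ^ _), mul_comm (r ^ _), mul_assoc]
    exact mul_le_mul_of_nonneg_left h3 (by positivity)

end DerivPoly

/-! ### Functions with completely monotone Laplace transform -/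

theorem integrableOn_exp_neg_mul_of_bounded {ψ : ℝ → ℝ} {C : ℝ} (hm : Measurable ψ)
    (hb : ∀ v, 0 < v → |ψ v| ≤ C) {l : ℝ} (hl : 0 < l) :
    IntegrableOn (fun v => Real.exp (-(l * v)) * ψ v) (Ioi 0) := by
  have h := (integrableOn_exp_mul_Ioi (a := -l) (by linarith) 0).mul_const C
  refine h.mono' (by fun_prop) ?_
  refine (ae_restrict_mem measurableSet_Ioi).mono fun v hv => ?_
  rw [Real.norm_eq_abs, abs_mul, abs_of_pos (Real.exp_pos _), neg_mul]
  exact mul_le_mul_of_nonneg_left (hb v hv) (Real.exp_nonneg _)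

theorem CompletelyMonotone.integral_one_sub_exp_pow {ψ : ℝ → ℝ} {C : ℝ} (hm : Measurable ψ)
    (hb : ∀ v, 0 < v → |ψ v| ≤ C)
    (hF : CompletelyMonotone fun l => ∫ v in Ioi (0 : ℝ), Real.exp (-(l * v)) * ψ v) (m : ℕ) :
    CompletelyMonotone fun l =>
      ∫ v in Ioi (0 : ℝ), Real.exp (-(l * v)) * ((1 - Real.exp (-v)) ^ m * ψ v) := by
  induction m with
  | zero => simpa using hF
  | succ m ih =>
    refine ih.sub_shift.congr fun l hl => ?_
    have hb' : ∀ v, 0 < v → |(1 - Real.exp (-v)) ^ m * ψ v| ≤ C := by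
      intro v hv
      have h1 : Real.exp (-v) ≤ 1 := Real.exp_le_one_iff.2 (by linarith)
      have h2 := Real.exp_pos (-v)
      rw [abs_mul, abs_of_nonneg (pow_nonneg (by linarith) m)]
      have h3 : (1 - Real.exp (-v)) ^ m ≤ 1 := pow_le_one₀ (by linarith) (by linarith)
      calc _ ≤ 1 * |ψ v| := mul_le_mul_of_nonneg_right h3 (abs_nonneg _)
        _ ≤ C := by rw [one_mul]; exact hb v hv
    have hm' : Measurable fun v => (1 - Real.exp (-v)) ^ m * ψ v := by fun_prop
    rw [← integral_sub (integrableOn_exp_neg_mul_of_bounded hm' hb' hl)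
      (integrableOn_exp_neg_mul_of_bounded hm' hb' (by linarith))]
    refine integral_congr_ae (Eventually.of_forall fun v => ?_)
    have : Real.exp (-((l + 1) * v)) = Real.exp (-(l * v)) * Real.exp (-v) := by
      rw [← Real.exp_add]; ring_nf
    simp only [this, pow_succ]
    ring

/-- The point `exp (-v)` of `[0, 1]`, for `v ≥ 0`. -/
def expI (v : ℝ) : unitInterval := projIcc 0 1 zero_le_one (Real.exp (-v))

theorem continuous_expI : Continuous expI :=
  continuous_projIcc.comp (Real.continuous_exp.comp continuous_neg)

theorem coe_expI {v : ℝ} (hv : 0 < v) : (expI v : ℝ) = Real.exp (-v) := by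
  rw [expI, projIcc_of_mem zero_le_one
    ⟨(Real.exp_pos _).le, Real.exp_le_one_iff.2 (by linarith)⟩]

/-- The Bernstein polynomials of `g ≥ 0`, evaluated at `exp (-v)`, are nonnegative combinations
of the functions `exp (-k v) (1 - exp (-v)) ^ m`. -/
theorem CompletelyMonotone.integral_mul_nonneg {ψ : ℝ → ℝ} {C : ℝ} (hm : Measurable ψ)
    (hb : ∀ v, 0 < v → |ψ v| ≤ C)
    (hF : CompletelyMonotone fun l => ∫ v in Ioi (0 : ℝ), Real.exp (-(l * v)) * ψ v)
    (g : C(unitInterval, ℝ)) (hg : ∀ u, 0 ≤ g u) :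
    0 ≤ ∫ v in Ioi (0 : ℝ), g (expI v) * (Real.exp (-v) * ψ v) := by
  have hint : IntegrableOn (fun v => Real.exp (-v) * ψ v) (Ioi 0) := by
    simpa using integrableOn_exp_neg_mul_of_bounded hm hb one_pos
  have hg_int : ∀ h : C(unitInterval, ℝ),
      IntegrableOn (fun v => h (expI v) * (Real.exp (-v) * ψ v)) (Ioi 0) := fun h =>
    Integrable.bdd_mul (c := ‖h‖) hint
      ((h.continuous.comp continuous_expI).aestronglyMeasurable)
      (Eventually.of_forall fun v => h.norm_coe_le_norm _)
  have hn : ∀ n : ℕ, 0 ≤ ∫ v in Ioi (0 : ℝ),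
      bernsteinApproximation n g (expI v) * (Real.exp (-v) * ψ v) := by
    intro n
    have : ∀ v, bernsteinApproximation n g (expI v) * (Real.exp (-v) * ψ v) =
        ∑ k : Fin (n + 1), g (bernstein.z k) *
          (bernstein n k (expI v) * (Real.exp (-v) * ψ v)) := by
      intro v
      rw [bernsteinApproximation.apply, Finset.sum_mul]
      refine Finset.sum_congr rfl fun k _ => ?_
      rw [smul_eq_mul]; ring
    simp_rw [this]
    rw [integral_finsetSum _ fun k _ => (hg_int _).const_mul _]
    refine Finset.sum_nonneg fun k _ => ?_
    rw [integral_const_mul]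
    refine mul_nonneg (hg _) ?_
    have h2 := (hF.integral_one_sub_exp_pow hm hb (n - k)).nonneg
      (show (0 : ℝ) < (k : ℕ) + 1 by positivity)
    have h3 : ∫ v in Ioi (0 : ℝ), bernstein n k (expI v) * (Real.exp (-v) * ψ v) =
        (n.choose k : ℝ) * ∫ v in Ioi (0 : ℝ), Real.exp (-(((k : ℕ) + 1 : ℝ) * v)) *
          ((1 - Real.exp (-v)) ^ (n - k : ℕ) * ψ v) := by
      rw [← integral_const_mul]
      refine setIntegral_congr_fun measurableSet_Ioi fun v hv => ?_
      have h4 : Real.exp (-(((k : ℕ) + 1 : ℝ) * v)) =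
          Real.exp (-v) ^ (k : ℕ) * Real.exp (-v) := by
        rw [← pow_succ, ← Real.exp_nat_mul]; push_cast; ring_nf
      simp only [bernstein_apply, coe_expI hv, h4]
      ring
    rw [h3]
    exact mul_nonneg (Nat.cast_nonneg _) h2
  have hlim := bernsteinApproximation_uniform g
  refine ge_of_tendsto' (tendsto_integral_filter_of_dominated_convergence
    (l := atTop) (fun v => (‖g‖ + 1) * ‖Real.exp (-v) * ψ v‖)
    (Eventually.of_forall fun n => (hg_int _).aestronglyMeasurable) ?_ (hint.norm.const_mul _)
    (Eventually.of_forall fun v => ?_)) hn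
  · have h1 := hlim.norm.eventually_le_const (lt_add_one ‖g‖)
    filter_upwards [h1] with n h1
    refine Eventually.of_forall fun v => ?_
    rw [norm_mul]
    exact mul_le_mul_of_nonneg_right ((ContinuousMap.norm_coe_le_norm _ _).trans h1)
      (norm_nonneg _)
  · exact (((ContinuousEvalConst.continuous_eval_const (expI v)).tendsto g).comp hlim).mul_const _

/-- A bounded continuous function whose Laplace transform is completely monotone is nonnegative
almost everywhere on `(0, ∞)`: test against `exp (-v)` times its negative part. -/
theorem CompletelyMonotone.ae_nonneg {ψ : ℝ → ℝ} {C : ℝ} (hc : Continuous ψ)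
    (hb : ∀ v, |ψ v| ≤ C)
    (hF : CompletelyMonotone fun l => ∫ v in Ioi (0 : ℝ), Real.exp (-(l * v)) * ψ v) :
    ∀ᵐ v ∂volume.restrict (Ioi (0 : ℝ)), 0 ≤ ψ v := by
  have hcont : Continuous fun u : ℝ => u * max 0 (-ψ (-Real.log u)) := by
    refine continuous_iff_continuousAt.2 fun u => ?_
    rcases eq_or_ne u 0 with rfl | hu
    · unfold ContinuousAt
      simp only [zero_mul]
      refine squeeze_zero_norm (a := fun u => |u| * C) (fun u => ?_) ?_
      · rw [norm_mul, Real.norm_eq_abs]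
        refine mul_le_mul_of_nonneg_left ?_ (abs_nonneg _)
        rw [Real.norm_of_nonneg (le_max_left _ _)]
        exact max_le ((abs_nonneg _).trans (hb 0)) ((neg_le_abs _).trans (hb _))
      · have : Continuous fun u : ℝ => |u| * C := by fun_prop
        simpa using this.tendsto 0
    · have := Real.continuousAt_log hu
      exact continuousAt_id.mul (continuousAt_const.max (hc.continuousAt.comp this.neg).neg)
  let g : C(unitInterval, ℝ) :=
    ⟨fun u => (u : ℝ) * max 0 (-ψ (-Real.log u)), hcont.comp continuous_subtype_val⟩
  have h1 := hF.integral_mul_nonneg hc.measurable (fun v _ => hb v) g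
    fun u => mul_nonneg u.2.1 (le_max_left _ _)
  have h2 : ∫ v in Ioi (0 : ℝ), g (expI v) * (Real.exp (-v) * ψ v) =
      -∫ v in Ioi (0 : ℝ), Real.exp (-(2 * v)) * max 0 (-ψ v) ^ 2 := by
    rw [← integral_neg]
    refine setIntegral_congr_fun measurableSet_Ioi fun v hv => ?_
    have h4 : Real.exp (-(2 * v)) = Real.exp (-v) * Real.exp (-v) := by
      rw [← Real.exp_add]; ring_nf
    simp only [g, ContinuousMap.coe_mk, coe_expI hv, Real.log_exp, neg_neg, h4]
    rcases le_total 0 (ψ v) with h | h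
    · rw [max_eq_left (by linarith)]; ring
    · rw [max_eq_right (by linarith)]; ring
  have h3 : IntegrableOn (fun v => Real.exp (-(2 * v)) * max 0 (-ψ v) ^ 2) (Ioi 0) := by
    refine integrableOn_exp_neg_mul_of_bounded (C := C ^ 2) (by fun_prop) (fun v _ => ?_) two_pos
    rw [abs_of_nonneg (by positivity)]
    exact pow_le_pow_left₀ (le_max_left _ _)
      (max_le ((abs_nonneg _).trans (hb 0)) ((neg_le_abs _).trans (hb _))) 2
  have h4 : ∫ v in Ioi (0 : ℝ), Real.exp (-(2 * v)) * max 0 (-ψ v) ^ 2 = 0 :=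
    le_antisymm (by linarith) (integral_nonneg fun v => by positivity)
  rw [integral_eq_zero_iff_of_nonneg (fun v => by positivity) h3] at h4
  filter_upwards [h4] with v hv
  by_contra h
  push Not at h
  have : 0 < Real.exp (-(2 * v)) * max 0 (-ψ v) ^ 2 :=
    mul_pos (Real.exp_pos _) (pow_pos (lt_max_of_lt_right (by linarith)) 2)
  exact this.ne' hv

/-! ### The stable densities -/

/-- The decay constant of `exp (-s z ^ α)` on the closed right half plane. -/
def decayRate (s α : ℝ) : ℝ := s * Real.cos (α * (Real.pi / 2))

theorem decayRate_pos {s α : ℝ} (hs : 0 < s) (h0 : 0 < α) (h1 : α < 1) : 0 < decayRate s α := by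
  have := Real.pi_pos
  exact mul_pos hs (Real.cos_pos_of_mem_Ioo ⟨by nlinarith, by nlinarith⟩)

theorem norm_exp_neg_mul_cpow_le {s α : ℝ} (hs : 0 < s) (h0 : 0 < α) (h1 : α < 1) {z : ℂ}
    (hz : 0 ≤ z.re) :
    ‖Complex.exp (-(s * z ^ (α : ℂ)))‖ ≤ Real.exp (-decayRate s α * |z.im| ^ α) := by
  rw [Complex.norm_exp, Real.exp_le_exp, Complex.neg_re, Complex.re_ofReal_mul,
    Complex.cpow_ofReal_re, neg_mul, neg_le_neg_iff]
  have harg := Complex.abs_arg_le_pi_div_two_iff.2 hz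
  have hpi := Real.pi_pos
  have hcos : Real.cos (α * (Real.pi / 2)) ≤ Real.cos (z.arg * α) := by
    rw [← Real.cos_abs (z.arg * α), abs_mul, abs_of_pos h0, mul_comm _ α]
    refine Real.cos_le_cos_of_nonneg_of_le_pi (by positivity) (by nlinarith) ?_
    exact mul_le_mul_of_nonneg_left harg h0.le
  have hc : 0 ≤ Real.cos (α * (Real.pi / 2)) :=
    Real.cos_nonneg_of_mem_Icc ⟨by nlinarith, by nlinarith⟩
  have him : |z.im| ^ α ≤ ‖z‖ ^ α :=
    Real.rpow_le_rpow (abs_nonneg _) (Complex.abs_im_le_norm z) h0.le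
  rw [decayRate, mul_assoc, mul_comm (Real.cos _)]
  gcongr

theorem integrable_exp_neg_mul_abs_rpow {c α : ℝ} (hc : 0 < c) (h0 : 0 < α) :
    Integrable (fun y : ℝ => Real.exp (-c * |y| ^ α)) := by
  refine Integrable.of_integral_ne_zero ?_
  rw [integral_comp_abs (f := fun y => Real.exp (-c * y ^ α)), integral_exp_neg_mul_rpow h0 hc]
  have : 0 < Real.Gamma (1 / α + 1) := Real.Gamma_pos_of_pos (by positivity)
  positivity

/-- The integrand `exp (z v) exp (-s z ^ α)` of the inversion integral. -/
def inversionIntegrand (s α v : ℝ) (z : ℂ) : ℂ :=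
  Complex.exp (z * v) * Complex.exp (-(s * z ^ (α : ℂ)))

theorem norm_inversionIntegrand_le {s α : ℝ} (hs : 0 < s) (h0 : 0 < α) (h1 : α < 1) (v : ℝ)
    {z : ℂ} (hz : 0 ≤ z.re) :
    ‖inversionIntegrand s α v z‖ ≤
      Real.exp (z.re * v) * Real.exp (-decayRate s α * |z.im| ^ α) := by
  rw [inversionIntegrand, norm_mul]
  refine mul_le_mul (le_of_eq ?_) (norm_exp_neg_mul_cpow_le hs h0 h1 hz) (norm_nonneg _)
    (Real.exp_nonneg _)
  rw [Complex.norm_exp, Complex.re_mul_ofReal]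

theorem continuousAt_inversionIntegrand (s : ℝ) {α : ℝ} (h0 : 0 < α) (v : ℝ) {z : ℂ}
    (hz : 0 ≤ z.re) : ContinuousAt (inversionIntegrand s α v) z := by
  have h := Complex.continuousAt_cpow_const_of_re_pos (z := z) (w := (α : ℂ)) (Or.inl hz)
    (by simpa using h0)
  exact ((continuousAt_id.mul continuousAt_const).cexp).mul ((continuousAt_const.mul h).neg.cexp)

theorem differentiableAt_inversionIntegrand (s α v : ℝ) {z : ℂ} (hz : 0 < z.re) :
    DifferentiableAt ℂ (inversionIntegrand s α v) z := by
  have h : DifferentiableAt ℂ (fun z : ℂ => z ^ (α : ℂ)) z :=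
    differentiableAt_id.cpow_const (Or.inl hz)
  unfold inversionIntegrand
  fun_prop

theorem continuous_inversionIntegrand_line (s : ℝ) {α : ℝ} (h0 : 0 < α) (v : ℝ) {σ : ℝ}
    (hσ : 0 ≤ σ) : Continuous (fun y : ℝ => inversionIntegrand s α v (σ + y * Complex.I)) := by
  refine continuous_iff_continuousAt.2 fun y => ?_
  refine ContinuousAt.comp (g := inversionIntegrand s α v)
    (continuousAt_inversionIntegrand s h0 v (by simpa using hσ)) ?_
  fun_prop

theorem norm_inversionIntegrand_line_le {s α : ℝ} (hs : 0 < s) (h0 : 0 < α) (h1 : α < 1) (v : ℝ)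
    {σ : ℝ} (hσ : 0 ≤ σ) (y : ℝ) :
    ‖inversionIntegrand s α v (σ + y * Complex.I)‖ ≤
      Real.exp (σ * v) * Real.exp (-decayRate s α * |y| ^ α) := by
  simpa using norm_inversionIntegrand_le hs h0 h1 v (z := σ + y * Complex.I) (by simpa using hσ)

theorem integrable_inversionIntegrand_line {s α : ℝ} (hs : 0 < s) (h0 : 0 < α) (h1 : α < 1)
    (v : ℝ) {σ : ℝ} (hσ : 0 ≤ σ) :
    Integrable (fun y : ℝ => inversionIntegrand s α v (σ + y * Complex.I)) :=
  ((integrable_exp_neg_mul_abs_rpow (decayRate_pos hs h0 h1) h0).const_mul _).mono'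
    (continuous_inversionIntegrand_line s h0 v hσ).aestronglyMeasurable
    (Eventually.of_forall fun y => norm_inversionIntegrand_line_le hs h0 h1 v hσ y)

/-- The inversion integral along `Re z = σ` does not depend on `σ ≥ 0`. -/
theorem integral_inversionIntegrand_line {s α : ℝ} (hs : 0 < s) (h0 : 0 < α) (h1 : α < 1)
    (v : ℝ) {σ : ℝ} (hσ : 0 ≤ σ) :
    ∫ y : ℝ, inversionIntegrand s α v (σ + y * Complex.I) =
      ∫ y : ℝ, inversionIntegrand s α v ((0 : ℝ) + y * Complex.I) := by
  set G := inversionIntegrand s α v with hG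
  have rect : ∀ R : ℝ, 0 ≤ R → (∫ x : ℝ in (0 : ℝ)..σ, G (x + ((-R : ℝ) : ℂ) * Complex.I)) -
      (∫ x : ℝ in (0 : ℝ)..σ, G (x + (R : ℂ) * Complex.I)) +
      Complex.I • (∫ y : ℝ in (-R)..R, G (σ + y * Complex.I)) -
      Complex.I • (∫ y : ℝ in (-R)..R, G ((0 : ℝ) + y * Complex.I)) = 0 := by
    intro R hR
    have := Complex.integral_boundary_rect_eq_zero_of_continuousOn_of_differentiableOn G
      (⟨0, -R⟩ : ℂ) (⟨σ, R⟩ : ℂ) ?_ ?_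
    · exact this
    · intro z hz
      rw [Complex.mem_reProdIm] at hz
      simp only [uIcc_of_le hσ] at hz
      exact (continuousAt_inversionIntegrand s h0 v hz.1.1).continuousWithinAt
    · intro z hz
      rw [Complex.mem_reProdIm] at hz
      simp only [min_eq_left hσ] at hz
      exact (differentiableAt_inversionIntegrand s α v hz.1.1).differentiableWithinAt
  have hside : ∀ R : ℝ, 0 ≤ R → ∀ ε : ℝ, |ε| = 1 →
      ‖∫ x : ℝ in (0 : ℝ)..σ, G (x + ((ε * R : ℝ) : ℂ) * Complex.I)‖ ≤
        Real.exp (σ * |v|) * Real.exp (-decayRate s α * R ^ α) * |σ - 0| := by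
    intro R hR ε hε
    refine intervalIntegral.norm_integral_le_of_norm_le_const fun x hx => ?_
    rw [uIoc_of_le hσ] at hx
    refine (norm_inversionIntegrand_line_le hs h0 h1 v hx.1.le (ε * R)).trans ?_
    rw [abs_mul, hε, one_mul, abs_of_nonneg hR]
    refine mul_le_mul_of_nonneg_right (Real.exp_le_exp.2 ?_) (Real.exp_nonneg _)
    exact (mul_le_mul_of_nonneg_left (le_abs_self v) hx.1.le).trans
      (mul_le_mul_of_nonneg_right hx.2 (abs_nonneg v))
  have hbound : Tendsto (fun R : ℝ => Real.exp (σ * |v|) *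
      Real.exp (-decayRate s α * R ^ α) * |σ - 0|) atTop (𝓝 0) := by
    have h2 : Tendsto (fun R : ℝ => -decayRate s α * R ^ α) atTop atBot :=
      (tendsto_rpow_atTop h0).const_mul_atTop_of_neg (by linarith [decayRate_pos hs h0 h1])
    simpa using ((Real.tendsto_exp_atBot.comp h2).const_mul (Real.exp (σ * |v|))).mul_const |σ - 0|
  have hs1 : Tendsto (fun R : ℝ => ∫ x : ℝ in (0 : ℝ)..σ, G (x + ((-R : ℝ) : ℂ) * Complex.I))
      atTop (𝓝 0) := by
    refine squeeze_zero_norm' ?_ hbound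
    filter_upwards [eventually_ge_atTop 0] with R hR
    simpa using hside R hR (-1) (by simp)
  have hs2 : Tendsto (fun R : ℝ => ∫ x : ℝ in (0 : ℝ)..σ, G (x + (R : ℂ) * Complex.I))
      atTop (𝓝 0) := by
    refine squeeze_zero_norm' ?_ hbound
    filter_upwards [eventually_ge_atTop 0] with R hR
    simpa using hside R hR 1 (by simp)
  have hl : ∀ τ : ℝ, 0 ≤ τ → Tendsto (fun R : ℝ => ∫ y : ℝ in (-R)..R, G (τ + y * Complex.I))
      atTop (𝓝 (∫ y : ℝ, G (τ + y * Complex.I))) := fun τ hτ =>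
    intervalIntegral_tendsto_integral (integrable_inversionIntegrand_line hs h0 h1 v hτ)
      tendsto_neg_atTop_atBot tendsto_id
  have hlim := ((hs1.sub hs2).add ((hl σ hσ).const_smul Complex.I)).sub
    ((hl 0 le_rfl).const_smul Complex.I)
  have h00 : (0 : ℂ) - 0 + Complex.I • (∫ y : ℝ, G (σ + y * Complex.I)) -
      Complex.I • (∫ y : ℝ, G ((0 : ℝ) + y * Complex.I)) = 0 := by
    refine tendsto_nhds_unique (hlim.congr' ?_) tendsto_const_nhds
    filter_upwards [eventually_ge_atTop 0] with R hR using rect R hR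
  rw [sub_zero, zero_add, ← smul_sub, smul_eq_zero] at h00
  exact sub_eq_zero.1 (h00.resolve_left Complex.I_ne_zero)

/-- The complex inversion integral; the stable density is its real part. -/
def stableInversion (s α v : ℝ) : ℂ :=
  (2 * Real.pi : ℂ)⁻¹ * ∫ y : ℝ, inversionIntegrand s α v ((0 : ℝ) + y * Complex.I)

theorem stableDensity_eq (s α v : ℝ) : stableDensity s α v = (stableInversion s α v).re := by
  rw [stableDensity, stableInversion]
  congr 3
  ext y
  simp only [inversionIntegrand, Complex.ofReal_zero, zero_add, mul_comm (y : ℂ) Complex.I]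

/-- A bound for the stable densities, uniform in `v`. -/
def stableBound (s α : ℝ) : ℝ :=
  (2 * Real.pi)⁻¹ * ∫ y : ℝ, Real.exp (-decayRate s α * |y| ^ α)

theorem norm_stableInversion_le {s α : ℝ} (hs : 0 < s) (h0 : 0 < α) (h1 : α < 1) (v : ℝ) {σ : ℝ}
    (hσ : 0 ≤ σ) : ‖stableInversion s α v‖ ≤ Real.exp (σ * v) * stableBound s α := by
  rw [stableInversion, ← integral_inversionIntegrand_line hs h0 h1 v hσ, norm_mul, stableBound,
    mul_left_comm]
  refine mul_le_mul (le_of_eq ?_) ?_ (norm_nonneg _) (by positivity)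
  · rw [norm_inv]
    simp [abs_of_pos Real.pi_pos]
  · rw [← integral_const_mul]
    exact norm_integral_le_of_norm_le
      ((integrable_exp_neg_mul_abs_rpow (decayRate_pos hs h0 h1) h0).const_mul _)
      (Eventually.of_forall fun y => norm_inversionIntegrand_line_le hs h0 h1 v hσ y)

theorem stableInversion_eq_zero {s α : ℝ} (hs : 0 < s) (h0 : 0 < α) (h1 : α < 1) {v : ℝ}
    (hv : v < 0) : stableInversion s α v = 0 := by
  have h2 : Tendsto (fun σ : ℝ => Real.exp (σ * v) * stableBound s α) atTop (𝓝 0) := by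
    have : Tendsto (fun σ : ℝ => σ * v) atTop atBot := tendsto_id.atTop_mul_const_of_neg hv
    simpa using (Real.tendsto_exp_atBot.comp this).mul_const (stableBound s α)
  refine norm_le_zero_iff.1 (ge_of_tendsto h2 ?_)
  filter_upwards [eventually_ge_atTop 0] with σ hσ
  exact norm_stableInversion_le hs h0 h1 v hσ

theorem continuous_stableInversion {s α : ℝ} (hs : 0 < s) (h0 : 0 < α) (h1 : α < 1) :
    Continuous (stableInversion s α) := by
  refine continuous_const.mul (continuous_of_dominated
    (bound := fun y => Real.exp (-decayRate s α * |y| ^ α)) (fun v => ?_) (fun v => ?_)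
    (integrable_exp_neg_mul_abs_rpow (decayRate_pos hs h0 h1) h0)
    (Eventually.of_forall fun y => ?_))
  · exact (continuous_inversionIntegrand_line s h0 v le_rfl).aestronglyMeasurable
  · refine Eventually.of_forall fun y => ?_
    simpa using norm_inversionIntegrand_line_le hs h0 h1 v le_rfl y
  · unfold inversionIntegrand
    fun_prop

theorem norm_stableInversion_le_bound {s α : ℝ} (hs : 0 < s) (h0 : 0 < α) (h1 : α < 1) (v : ℝ) :
    ‖stableInversion s α v‖ ≤ stableBound s α := by
  simpa using norm_stableInversion_le hs h0 h1 v le_rfl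

open FourierTransform in
/-- Fourier inversion on the line `Re z = l` computes the Laplace transform. -/
theorem integral_exp_mul_stableInversion {s α l : ℝ} (hs : 0 < s) (h0 : 0 < α) (h1 : α < 1)
    (hl : 0 < l) :
    ∫ v in Ioi (0 : ℝ), (Real.exp (-(l * v)) : ℂ) * stableInversion s α v =
      (Real.exp (-(s * l ^ α)) : ℂ) := by
  let f : ℝ → ℂ := fun x => Complex.exp (-(s * ((l : ℂ) + (2 * Real.pi * x : ℝ) * Complex.I) ^
    (α : ℂ)))
  have hpi := Real.pi_pos
  have hfG : ∀ x, f x = inversionIntegrand s α 0 (l + (2 * Real.pi * x : ℝ) * Complex.I) := by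
    intro x; simp [f, inversionIntegrand]
  have hfi : Integrable f := by
    have := (integrable_inversionIntegrand_line hs h0 h1 0 hl.le).comp_mul_left'
      (show (2 * Real.pi) ≠ 0 by positivity)
    exact this.congr (Eventually.of_forall fun x => (hfG x).symm)
  have hfc : Continuous f := by
    have := (continuous_inversionIntegrand_line s h0 0 hl.le).comp
      (continuous_const_mul (2 * Real.pi))
    exact this.congr fun x => (hfG x).symm
  have hinv : ∀ v : ℝ, 𝓕⁻ f v = (Real.exp (-(l * v)) : ℂ) * stableInversion s α v := by
    intro v
    rw [Real.fourierInv_eq', stableInversion, ← integral_inversionIntegrand_line hs h0 h1 v hl.le]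
    have h2 := Measure.integral_comp_mul_left
      (fun y : ℝ => (Real.exp (-(l * v)) : ℂ) * inversionIntegrand s α v (l + y * Complex.I))
      (2 * Real.pi)
    rw [abs_of_pos (by positivity), integral_const_mul, integral_const_mul] at h2
    rw [mul_left_comm]
    have h3 : ((2 * Real.pi : ℂ))⁻¹ = (((2 * Real.pi)⁻¹ : ℝ) : ℂ) := by push_cast; rfl
    rw [h3, ← Complex.real_smul, ← h2, ← integral_const_mul]
    refine integral_congr_ae (Eventually.of_forall fun x => ?_)
    simp only [f, inversionIntegrand, smul_eq_mul]
    rw [← mul_assoc, Complex.ofReal_exp, ← Complex.exp_add ((-(l * v) : ℝ) : ℂ)]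
    congr 2
    simp only [RCLike.inner_apply, conj_trivial]
    push_cast
    ring
  have hzero : ∀ v, v ∉ Ioi (0 : ℝ) → v ≠ 0 →
      (Real.exp (-(l * v)) : ℂ) * stableInversion s α v = 0 := by
    intro v hv hv0
    rw [stableInversion_eq_zero hs h0 h1 (lt_of_le_of_ne (not_lt.1 hv) hv0), mul_zero]
  have hind : (fun v => (Real.exp (-(l * v)) : ℂ) * stableInversion s α v) =ᵐ[volume]
      (Ioi (0 : ℝ)).indicator fun v => (Real.exp (-(l * v)) : ℂ) * stableInversion s α v := by
    filter_upwards [compl_mem_ae_iff.2 (measure_singleton (0 : ℝ))] with v hv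
    by_cases h : v ∈ Ioi (0 : ℝ)
    · rw [indicator_of_mem h]
    · rw [indicator_of_notMem h, hzero v h hv]
  have hIoi : IntegrableOn (fun v => (Real.exp (-(l * v)) : ℂ) * stableInversion s α v)
      (Ioi 0) := by
    have h := (integrableOn_exp_mul_Ioi (a := -l) (by linarith) 0).mul_const (stableBound s α)
    refine h.mono' ?_ (Eventually.of_forall fun v => ?_)
    · exact ((by fun_prop : Continuous fun v : ℝ => (Real.exp (-(l * v)) : ℂ)).mul
        (continuous_stableInversion hs h0 h1)).aestronglyMeasurable
    · rw [norm_mul, Complex.norm_real, Real.norm_of_nonneg (Real.exp_nonneg _), neg_mul]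
      exact mul_le_mul_of_nonneg_left (norm_stableInversion_le_bound hs h0 h1 v)
        (Real.exp_nonneg _)
  have hii : Integrable (𝓕⁻ f) := by
    rw [show 𝓕⁻ f = _ from funext hinv]
    exact ((integrable_indicator_iff measurableSet_Ioi).2 hIoi).congr hind.symm
  have hii' : Integrable (𝓕 f) := by
    have := hii.comp_neg
    refine this.congr (Eventually.of_forall fun v => ?_)
    simp [Real.fourierInv_eq_fourier_neg]
  have hfin := congrFun (hfc.fourier_fourierInv_eq hfi hii') 0
  rw [Real.fourier_real_eq_integral_exp_smul] at hfin
  simp only [mul_zero, Complex.ofReal_zero, zero_mul, Complex.exp_zero, one_smul, hinv] at hfin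
  rw [← integral_indicator measurableSet_Ioi, ← integral_congr_ae hind, hfin]
  simp only [f, mul_zero, Complex.ofReal_zero, zero_mul, add_zero, Complex.ofReal_exp]
  rw [← Complex.ofReal_cpow hl.le]
  push_cast
  rfl

theorem continuous_stableDensity {s α : ℝ} (hs : 0 < s) (h0 : 0 < α) (h1 : α < 1) :
    Continuous (stableDensity s α) := by
  rw [show stableDensity s α = fun v => (stableInversion s α v).re from
    funext (stableDensity_eq s α)]
  exact Complex.continuous_re.comp (continuous_stableInversion hs h0 h1)

theorem abs_stableDensity_le {s α : ℝ} (hs : 0 < s) (h0 : 0 < α) (h1 : α < 1) (v : ℝ) :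
    |stableDensity s α v| ≤ stableBound s α := by
  rw [stableDensity_eq]
  exact (Complex.abs_re_le_norm _).trans (norm_stableInversion_le_bound hs h0 h1 v)

theorem integrableOn_exp_mul_stableDensity {s α l : ℝ} (hs : 0 < s) (h0 : 0 < α) (h1 : α < 1)
    (hl : 0 < l) : IntegrableOn (fun v => Real.exp (-(l * v)) * stableDensity s α v) (Ioi 0) :=
  integrableOn_exp_neg_mul_of_bounded (continuous_stableDensity hs h0 h1).measurable
    (fun v _ => abs_stableDensity_le hs h0 h1 v) hl

theorem integral_exp_mul_stableDensity {s α l : ℝ} (hs : 0 < s) (h0 : 0 < α) (h1 : α < 1)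
    (hl : 0 < l) :
    ∫ v in Ioi (0 : ℝ), Real.exp (-(l * v)) * stableDensity s α v = Real.exp (-(s * l ^ α)) := by
  have h := congrArg Complex.re (integral_exp_mul_stableInversion hs h0 h1 hl)
  rw [Complex.ofReal_re, ← RCLike.re_eq_complex_re, ← integral_re] at h
  · rw [← h]
    refine integral_congr_ae (Eventually.of_forall fun v => ?_)
    simp only [stableDensity_eq, RCLike.re_eq_complex_re, Complex.re_ofReal_mul]
  · refine Integrable.of_integral_ne_zero ?_
    rw [integral_exp_mul_stableInversion hs h0 h1 hl]
    simp

theorem ae_stableDensity_nonneg {s α : ℝ} (hs : 0 < s) (h0 : 0 < α) (h1 : α < 1) :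
    ∀ᵐ v ∂volume.restrict (Ioi (0 : ℝ)), 0 ≤ stableDensity s α v :=
  CompletelyMonotone.ae_nonneg (continuous_stableDensity hs h0 h1)
    (abs_stableDensity_le hs h0 h1) ((completelyMonotone_exp_neg_rpow hs h0 h1).congr
      fun _ hl => (integral_exp_mul_stableDensity hs h0 h1 hl).symm)

/-- `r ↦ r ^ (-1 / (1 - α)) φ_{r s}` is decreasing: the difference of the two sides has a completely
monotone Laplace transform. -/
theorem ae_stableDensity_mul_le {s r α : ℝ} (hs : 0 < s) (hr : 1 ≤ r) (h0 : 0 < α) (h1 : α < 1) :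
    ∀ᵐ v ∂volume.restrict (Ioi (0 : ℝ)),
      stableDensity (r * s) α v ≤ r ^ (1 / (1 - α)) * stableDensity s α v := by
  have hrs : 0 < r * s := by positivity
  set c := r ^ (1 / (1 - α)) with hc
  have hc0 : 0 ≤ c := by positivity
  have := CompletelyMonotone.ae_nonneg
    (ψ := fun v => c * stableDensity s α v - stableDensity (r * s) α v)
    (C := c * stableBound s α + stableBound (r * s) α)
    ((continuous_const.mul (continuous_stableDensity hs h0 h1)).sub
      (continuous_stableDensity hrs h0 h1)) (fun v => ?_)
    ((completelyMonotone_rpow_mul_exp_sub_exp hs hr h0 h1).congr fun l hl => ?_)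
  · filter_upwards [this] with v hv
    linarith
  · refine (abs_sub _ _).trans (add_le_add ?_ (abs_stableDensity_le hrs h0 h1 v))
    rw [abs_mul, abs_of_nonneg hc0]
    exact mul_le_mul_of_nonneg_left (abs_stableDensity_le hs h0 h1 v) hc0
  · rw [← integral_exp_mul_stableDensity hs h0 h1 hl, ← integral_exp_mul_stableDensity hrs h0 h1 hl,
      ← integral_const_mul, ← integral_sub]
    · refine integral_congr_ae (Eventually.of_forall fun v => ?_)
      simp only
      ring
    · exact (integrableOn_exp_mul_stableDensity hs h0 h1 hl).const_mul _
    · exact integrableOn_exp_mul_stableDensity hrs h0 h1 hl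

/-! ### Uniqueness of Laplace transforms -/

theorem coe_expI_of_nonneg {v : ℝ} (hv : 0 ≤ v) : (expI v : ℝ) = Real.exp (-v) := by
  rw [expI, projIcc_of_mem zero_le_one
    ⟨(Real.exp_pos _).le, Real.exp_le_one_iff.2 (by linarith)⟩]

theorem integrable_exp_neg_mul {ν : Measure ℝ} [IsFiniteMeasure ν] (hν : ∀ᵐ v ∂ν, 0 ≤ v) {l : ℝ}
    (hl : 0 ≤ l) : Integrable (fun v => Real.exp (-(l * v))) ν := by
  refine Integrable.of_bound (C := 1) (by fun_prop) ?_
  filter_upwards [hν] with v hv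
  rw [Real.norm_of_nonneg (Real.exp_nonneg _), Real.exp_le_one_iff]
  have := mul_nonneg hl hv
  linarith

theorem integral_expI_eq_of_laplace {ν ν' : Measure ℝ} [IsFiniteMeasure ν] [IsFiniteMeasure ν']
    (hν : ∀ᵐ v ∂ν, 0 ≤ v) (hν' : ∀ᵐ v ∂ν', 0 ≤ v)
    (h : ∀ l : ℝ, 0 ≤ l → ∫ v, Real.exp (-(l * v)) ∂ν = ∫ v, Real.exp (-(l * v)) ∂ν')
    (g : C(unitInterval, ℝ)) : ∫ v, g (expI v) ∂ν = ∫ v, g (expI v) ∂ν' := by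
  have hint : ∀ (ρ : Measure ℝ) [IsFiniteMeasure ρ] (g : C(unitInterval, ℝ)),
      Integrable (fun v => g (expI v)) ρ := fun ρ _ g =>
    Integrable.of_bound (C := ‖g‖) (g.continuous.comp continuous_expI).aestronglyMeasurable
      (Eventually.of_forall fun v => g.norm_coe_le_norm _)
  have hpoly : ∀ (ρ : Measure ℝ) [IsFiniteMeasure ρ], (∀ᵐ v ∂ρ, 0 ≤ v) → ∀ p : Polynomial ℝ,
      ∫ v, p.eval (expI v : ℝ) ∂ρ =
        ∑ k ∈ Finset.range (p.natDegree + 1), p.coeff k * ∫ v, Real.exp (-((k : ℝ) * v)) ∂ρ := by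
    intro ρ _ hρ p
    have : (fun v => p.eval (expI v : ℝ)) =ᵐ[ρ] fun v =>
        ∑ k ∈ Finset.range (p.natDegree + 1), p.coeff k * Real.exp (-((k : ℝ) * v)) := by
      filter_upwards [hρ] with v hv
      rw [Polynomial.eval_eq_sum_range]
      refine Finset.sum_congr rfl fun k _ => ?_
      rw [coe_expI_of_nonneg hv, ← Real.exp_nat_mul]
      ring_nf
    rw [integral_congr_ae this, integral_finsetSum _ fun k _ =>
      (integrable_exp_neg_mul hρ (Nat.cast_nonneg k)).const_mul _]
    simp_rw [integral_const_mul]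
  have hlim : ∀ (ρ : Measure ℝ) [IsFiniteMeasure ρ],
      Tendsto (fun n => ∫ v, bernsteinApproximation n g (expI v) ∂ρ) atTop
        (𝓝 (∫ v, g (expI v) ∂ρ)) := by
    intro ρ _
    have hl := bernsteinApproximation_uniform g
    refine tendsto_integral_filter_of_dominated_convergence (fun _ => ‖g‖ + 1)
      (Eventually.of_forall fun n => (hint ρ _).aestronglyMeasurable) ?_ (integrable_const _)
      (Eventually.of_forall fun v => ?_)
    · filter_upwards [hl.norm.eventually_le_const (lt_add_one ‖g‖)] with n h1
      exact Eventually.of_forall fun v => (ContinuousMap.norm_coe_le_norm _ _).trans h1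
    · exact ((ContinuousEvalConst.continuous_eval_const (expI v)).tendsto g).comp hl
  refine tendsto_nhds_unique (hlim ν) ((hlim ν').congr fun n => ?_)
  have happ : ∀ v, bernsteinApproximation n g (expI v) = ∑ k : Fin (n + 1),
      g (bernstein.z k) * (bernsteinPolynomial ℝ n k).eval (expI v : ℝ) := by
    intro v
    rw [bernsteinApproximation.apply]
    refine Finset.sum_congr rfl fun k _ => ?_
    rw [smul_eq_mul, mul_comm]
    rfl
  have hi : ∀ (ρ : Measure ℝ) [IsFiniteMeasure ρ] (p : Polynomial ℝ),
      Integrable (fun v => p.eval (expI v : ℝ)) ρ := fun ρ _ p =>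
    hint ρ (p.toContinuousMapOn unitInterval)
  simp_rw [happ]
  rw [integral_finsetSum _ fun k _ => (hi ν' _).const_mul _,
    integral_finsetSum _ fun k _ => (hi ν _).const_mul _]
  refine Finset.sum_congr rfl fun k _ => ?_
  rw [integral_const_mul, integral_const_mul, hpoly ν hν, hpoly ν' hν']
  congr 1
  refine Finset.sum_congr rfl fun j _ => ?_
  rw [h j (Nat.cast_nonneg j)]

/-- A finite measure on `[0, ∞)` is determined by its Laplace transform. -/
theorem eq_of_laplace {ν ν' : Measure ℝ} [IsFiniteMeasure ν] [IsFiniteMeasure ν']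
    (hν : ∀ᵐ v ∂ν, 0 ≤ v) (hν' : ∀ᵐ v ∂ν', 0 ≤ v)
    (h : ∀ l : ℝ, 0 ≤ l → ∫ v, Real.exp (-(l * v)) ∂ν = ∫ v, Real.exp (-(l * v)) ∂ν') :
    ν = ν' := by
  have hme : Measurable expI := continuous_expI.measurable
  have h1 : ν.map expI = ν'.map expI := by
    refine ext_of_forall_integral_eq_of_IsFiniteMeasure fun f => ?_
    rw [integral_map hme.aemeasurable f.continuous.aestronglyMeasurable,
      integral_map hme.aemeasurable f.continuous.aestronglyMeasurable]
    exact integral_expI_eq_of_laplace hν hν' h f.toContinuousMap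
  have hml : Measurable fun u : unitInterval => -Real.log (u : ℝ) := by fun_prop
  have hback : ∀ ρ : Measure ℝ, (∀ᵐ v ∂ρ, 0 ≤ v) →
      (ρ.map expI).map (fun u : unitInterval => -Real.log (u : ℝ)) = ρ := by
    intro ρ hρ
    rw [Measure.map_map hml hme]
    refine (Measure.map_congr ?_).trans Measure.map_id
    filter_upwards [hρ] with v hv
    simp only [Function.comp, coe_expI_of_nonneg hv, Real.log_exp, neg_neg, id]
  rw [← hback ν hν, h1, hback ν' hν']

/-! ### The stable measures -/

open Classical in
/-- The probability measure on `[0, ∞)` with Laplace transform `exp (-s l ^ α)`, for `s ≥ 0` and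
`0 < α ≤ 1`: the measure with density `stableDensity s α` if `s > 0` and `α < 1`. The degenerate
cases are Dirac measures. -/
def stableMeasure (s α : ℝ) : Measure ℝ :=
  if s ≤ 0 then Measure.dirac 0 else if α = 1 then Measure.dirac s else
    (volume.restrict (Ioi 0)).withDensity fun v => ENNReal.ofReal (stableDensity s α v)

theorem stableMeasure_zero (α : ℝ) : stableMeasure 0 α = Measure.dirac 0 := by
  simp [stableMeasure]

theorem stableMeasure_one {s : ℝ} (hs : 0 ≤ s) : stableMeasure s 1 = Measure.dirac s := by
  rcases hs.eq_or_lt with rfl | h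
  · exact stableMeasure_zero 1
  · simp [stableMeasure, h.not_ge]

theorem stableMeasure_eq {s α : ℝ} (hs : 0 < s) (h1 : α < 1) : stableMeasure s α =
    (volume.restrict (Ioi 0)).withDensity fun v => ENNReal.ofReal (stableDensity s α v) := by
  simp [stableMeasure, hs.not_ge, h1.ne]

theorem measurable_stableDensity (α : ℝ) :
    Measurable (fun p : ℝ × ℝ => stableDensity p.1 α p.2) := by
  have h : Measurable fun q : (ℝ × ℝ) × ℝ => Complex.exp (Complex.I * q.2 * q.1.2) *
      Complex.exp (-(q.1.1 * (Complex.I * q.2) ^ (α : ℂ))) := by fun_prop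
  exact Complex.measurable_re.comp
    ((h.stronglyMeasurable.integral_prod_right (ν := volume)).measurable.const_mul _)

theorem measurable_stableMeasure (α : ℝ) : Measurable fun s => stableMeasure s α := by
  refine Measurable.ite measurableSet_Iic measurable_const ?_
  by_cases h : α = 1
  · simp only [h, if_true]
    exact Measure.measurable_dirac
  · simp only [h, if_false]
    refine Measure.measurable_of_measurable_coe _ fun A hA => ?_
    simp_rw [withDensity_apply _ hA]
    exact (measurable_stableDensity α).ennreal_ofReal.lintegral_prod_right'

theorem ae_nonneg_stableMeasure (s α : ℝ) : ∀ᵐ v ∂stableMeasure s α, 0 ≤ v := by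
  have hd : ∀ a : ℝ, 0 ≤ a → ∀ᵐ v ∂Measure.dirac a, 0 ≤ v := fun a ha =>
    (ae_dirac_iff measurableSet_Ici).2 ha
  rw [stableMeasure]
  split_ifs with h1 h2
  · exact hd 0 le_rfl
  · exact hd s (not_le.1 h1).le
  · exact (withDensity_absolutelyContinuous _ _).ae_le
      ((ae_restrict_mem measurableSet_Ioi).mono fun v hv => le_of_lt hv)

section Density
variable {s α : ℝ}

theorem integral_stableMeasure {E : Type*} [NormedAddCommGroup E] [NormedSpace ℝ E] (hs : 0 < s)
    (h0 : 0 < α) (h1 : α < 1) (f : ℝ → E) :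
    ∫ v, f v ∂stableMeasure s α = ∫ v in Ioi (0 : ℝ), stableDensity s α v • f v := by
  rw [stableMeasure_eq hs h1, integral_withDensity_eq_integral_toReal_smul
    (continuous_stableDensity hs h0 h1).measurable.ennreal_ofReal
    (Eventually.of_forall fun _ => ENNReal.ofReal_lt_top)]
  refine integral_congr_ae ?_
  filter_upwards [ae_stableDensity_nonneg hs h0 h1] with v hv
  rw [ENNReal.toReal_ofReal hv]

theorem integrable_stableMeasure_iff (hs : 0 < s) (h0 : 0 < α) (h1 : α < 1) (f : ℝ → ℂ) :
    Integrable f (stableMeasure s α) ↔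
      IntegrableOn (fun v => (stableDensity s α v : ℂ) * f v) (Ioi 0) := by
  rw [stableMeasure_eq hs h1, integrable_withDensity_iff_integrable_smul'
    (continuous_stableDensity hs h0 h1).measurable.ennreal_ofReal
    (Eventually.of_forall fun _ => ENNReal.ofReal_lt_top)]
  refine integrable_congr ?_
  filter_upwards [ae_stableDensity_nonneg hs h0 h1] with v hv
  rw [ENNReal.toReal_ofReal hv, Complex.real_smul]

theorem lintegral_exp_mul_stableMeasure (hs : 0 < s) (h0 : 0 < α) (h1 : α < 1) {l : ℝ}
    (hl : 0 < l) : ∫⁻ v, ENNReal.ofReal (Real.exp (-(l * v))) ∂stableMeasure s α =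
      ENNReal.ofReal (Real.exp (-(s * l ^ α))) := by
  rw [stableMeasure_eq hs h1, lintegral_withDensity_eq_lintegral_mul _
    (continuous_stableDensity hs h0 h1).measurable.ennreal_ofReal (by fun_prop),
    ← integral_exp_mul_stableDensity hs h0 h1 hl,
    ofReal_integral_eq_lintegral_ofReal (integrableOn_exp_mul_stableDensity hs h0 h1 hl)]
  · refine lintegral_congr fun v => ?_
    rw [Pi.mul_apply, ← ENNReal.ofReal_mul' (Real.exp_nonneg _), mul_comm]
  · filter_upwards [ae_stableDensity_nonneg hs h0 h1] with v hv
    exact mul_nonneg (Real.exp_nonneg _) hv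

theorem stableMeasure_univ (hs : 0 < s) (h0 : 0 < α) (h1 : α < 1) :
    stableMeasure s α univ = 1 := by
  have hlim : Tendsto (fun n : ℕ => 1 / ((n : ℝ) + 1)) atTop (𝓝 0) :=
    tendsto_one_div_add_atTop_nhds_zero_nat
  have hcont : ∀ v : ℝ, Continuous fun l : ℝ => ENNReal.ofReal (Real.exp (-(l * v))) := by
    intro v
    exact ENNReal.continuous_ofReal.comp (by fun_prop)
  have h2 : Tendsto (fun n : ℕ => ∫⁻ v, ENNReal.ofReal (Real.exp (-(1 / ((n : ℝ) + 1) * v)))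
      ∂stableMeasure s α) atTop (𝓝 (∫⁻ _, 1 ∂stableMeasure s α)) := by
    refine lintegral_tendsto_of_tendsto_of_monotone (fun n => by fun_prop) ?_
      (Eventually.of_forall fun v => ?_)
    · filter_upwards [ae_nonneg_stableMeasure s α] with v hv n m hnm
      refine ENNReal.ofReal_le_ofReal (Real.exp_le_exp.2 (neg_le_neg ?_))
      refine mul_le_mul_of_nonneg_right (one_div_le_one_div_of_le (by positivity) ?_) hv
      exact_mod_cast Nat.succ_le_succ hnm
    · simpa [Function.comp_def] using ((hcont v).tendsto 0).comp hlim
  have h3 : Tendsto (fun n : ℕ => ENNReal.ofReal (Real.exp (-(s * (1 / ((n : ℝ) + 1)) ^ α))))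
      atTop (𝓝 1) := by
    have hc : Continuous fun l : ℝ => ENNReal.ofReal (Real.exp (-(s * l ^ α))) := by
      have := Real.continuous_rpow_const (q := α) h0.le
      exact ENNReal.continuous_ofReal.comp (by fun_prop)
    simpa [Function.comp_def, Real.zero_rpow h0.ne'] using (hc.tendsto 0).comp hlim
  rw [lintegral_one] at h2
  refine tendsto_nhds_unique h2 (h3.congr fun n => ?_)
  rw [lintegral_exp_mul_stableMeasure hs h0 h1 (by positivity)]

end Density

theorem isProbabilityMeasure_stableMeasure (s : ℝ) {α : ℝ} (h0 : 0 < α) (h1 : α ≤ 1) :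
    IsProbabilityMeasure (stableMeasure s α) := by
  rcases le_or_gt s 0 with hs | hs
  · rw [stableMeasure, if_pos hs]; infer_instance
  rcases h1.eq_or_lt with rfl | h1
  · rw [stableMeasure_one hs.le]; infer_instance
  · exact ⟨stableMeasure_univ hs h0 h1⟩

theorem integral_exp_mul_stableMeasure {s α : ℝ} (hs : 0 ≤ s) (h0 : 0 < α) (h1 : α ≤ 1) {l : ℝ}
    (hl : 0 ≤ l) :
    ∫ v, Real.exp (-(l * v)) ∂stableMeasure s α = Real.exp (-(s * l ^ α)) := by
  have := isProbabilityMeasure_stableMeasure s h0 h1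
  rcases hs.eq_or_lt with rfl | hs
  · simp [stableMeasure_zero]
  rcases h1.eq_or_lt with rfl | h1
  · simp [stableMeasure_one hs.le, mul_comm]
  rcases hl.eq_or_lt with rfl | hl
  · simp [Real.zero_rpow h0.ne']
  · rw [integral_stableMeasure hs h0 h1, ← integral_exp_mul_stableDensity hs h0 h1 hl]
    simp only [smul_eq_mul, mul_comm]

/-- The stable measures as a Markov kernel in the time parameter. -/
def stableKernel (α : ℝ) : ProbabilityTheory.Kernel ℝ ℝ where
  toFun s := stableMeasure s α
  measurable' := measurable_stableMeasure α

theorem isMarkovKernel_stableKernel {α : ℝ} (h0 : 0 < α) (h1 : α ≤ 1) :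
    ProbabilityTheory.IsMarkovKernel (stableKernel α) :=
  ⟨fun s => isProbabilityMeasure_stableMeasure s h0 h1⟩

theorem map_mul_stableMeasure {s α c : ℝ} (hs : 0 ≤ s) (h0 : 0 < α) (h1 : α ≤ 1) (hc : 0 < c) :
    (stableMeasure s α).map (fun v => c * v) = stableMeasure (c ^ α * s) α := by
  have := isProbabilityMeasure_stableMeasure s h0 h1
  have := isProbabilityMeasure_stableMeasure (c ^ α * s) h0 h1
  have hm : Measurable fun v : ℝ => c * v := by fun_prop
  have := Measure.isProbabilityMeasure_map (μ := stableMeasure s α) hm.aemeasurable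
  refine eq_of_laplace ?_ (ae_nonneg_stableMeasure _ _) fun l hl => ?_
  · rw [ae_map_iff hm.aemeasurable measurableSet_Ici]
    filter_upwards [ae_nonneg_stableMeasure s α] with v hv using mul_nonneg hc.le hv
  · rw [integral_map hm.aemeasurable (by fun_prop),
      integral_exp_mul_stableMeasure (by positivity) h0 h1 hl]
    simp_rw [← mul_assoc]
    rw [integral_exp_mul_stableMeasure hs h0 h1 (by positivity), Real.mul_rpow hl hc.le]
    ring_nf

theorem ae_nonneg_conv {ν ν' : Measure ℝ} [SFinite ν] [SFinite ν'] (hν : ∀ᵐ v ∂ν, 0 ≤ v)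
    (hν' : ∀ᵐ v ∂ν', 0 ≤ v) : ∀ᵐ v ∂(ν.conv ν'), 0 ≤ v := by
  rw [Measure.conv, ae_map_iff (by fun_prop) measurableSet_Ici]
  have h1 : ∀ᵐ p ∂ν.prod ν', 0 ≤ p.1 := Measure.quasiMeasurePreserving_fst.ae hν
  have h2 : ∀ᵐ p ∂ν.prod ν', 0 ≤ p.2 := Measure.quasiMeasurePreserving_snd.ae hν'
  filter_upwards [h1, h2] with p hp hp' using add_nonneg hp hp'

theorem conv_stableMeasure {s t α : ℝ} (hs : 0 ≤ s) (ht : 0 ≤ t) (h0 : 0 < α) (h1 : α ≤ 1) :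
    (stableMeasure s α).conv (stableMeasure t α) = stableMeasure (s + t) α := by
  have := isProbabilityMeasure_stableMeasure s h0 h1
  have := isProbabilityMeasure_stableMeasure t h0 h1
  have := isProbabilityMeasure_stableMeasure (s + t) h0 h1
  have hae := ae_nonneg_conv (ae_nonneg_stableMeasure s α) (ae_nonneg_stableMeasure t α)
  refine eq_of_laplace hae (ae_nonneg_stableMeasure _ _) fun l hl => ?_
  rw [integral_conv (integrable_exp_neg_mul hae hl),
    integral_exp_mul_stableMeasure (by positivity) h0 h1 hl]
  simp_rw [mul_add, neg_add, Real.exp_add, integral_const_mul, integral_mul_const]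
  rw [integral_exp_mul_stableMeasure hs h0 h1 hl, integral_exp_mul_stableMeasure ht h0 h1 hl,
    ← Real.exp_add]
  ring_nf

open ProbabilityTheory in
theorem integral_bind_kernel {E : Type*} [NormedAddCommGroup E] [NormedSpace ℝ E] {ν : Measure ℝ}
    [SFinite ν] {κ : Kernel ℝ ℝ} [IsSFiniteKernel κ] {f : ℝ → E} (hf : Integrable f (ν.bind κ)) :
    ∫ v, f v ∂ν.bind κ = ∫ s, ∫ v, f v ∂κ s ∂ν := by
  have h : ν.bind κ = (κ ∘ₖ Kernel.const Unit ν) () := Measure.comp_eq_comp_const_apply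
  rw [h] at hf ⊢
  rw [Kernel.integral_comp hf, Kernel.const_apply]

/-- Subordination: a `γ`-stable mixture of the `α`-stable measures is `γ α`-stable. -/
theorem bind_stableMeasure {t γ α : ℝ} (ht : 0 ≤ t) (hγ0 : 0 < γ) (hγ1 : γ ≤ 1) (h0 : 0 < α)
    (h1 : α ≤ 1) : (stableMeasure t γ).bind (stableKernel α) = stableMeasure t (γ * α) := by
  have h0' : 0 < γ * α := by positivity
  have h1' : γ * α ≤ 1 := mul_le_one₀ hγ1 h0.le h1
  have := isProbabilityMeasure_stableMeasure t hγ0 hγ1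
  have := isProbabilityMeasure_stableMeasure t h0' h1'
  have := isMarkovKernel_stableKernel h0 h1
  have hae : ∀ᵐ v ∂(stableMeasure t γ).bind (stableKernel α), 0 ≤ v := by
    rw [ae_iff]
    simp only [not_le]
    rw [Measure.bind_apply (s := {a : ℝ | a < 0}) measurableSet_Iio
      (stableKernel α).aemeasurable]
    refine lintegral_eq_zero_of_ae_eq_zero (Eventually.of_forall fun s => ?_)
    have := ae_nonneg_stableMeasure s α
    rw [ae_iff] at this
    simp only [not_le] at this
    exact this
  refine eq_of_laplace hae (ae_nonneg_stableMeasure _ _) fun l hl => ?_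
  rw [integral_bind_kernel (integrable_exp_neg_mul hae hl),
    integral_exp_mul_stableMeasure ht h0' h1' hl]
  have : (fun s => ∫ v, Real.exp (-(l * v)) ∂stableKernel α s) =ᵐ[stableMeasure t γ]
      fun s => Real.exp (-(l ^ α * s)) := by
    filter_upwards [ae_nonneg_stableMeasure t γ] with s hs
    rw [mul_comm (l ^ α)]
    exact integral_exp_mul_stableMeasure hs h0 h1 hl
  rw [integral_congr_ae this, integral_exp_mul_stableMeasure ht hγ0 hγ1 (by positivity),
    ← Real.rpow_mul hl, mul_comm α]

theorem stableMeasure_mul_le {s r α : ℝ} (hs : 0 < s) (hr : 1 ≤ r) (h0 : 0 < α) (h1 : α < 1) :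
    stableMeasure (r * s) α ≤ ENNReal.ofReal (r ^ (1 / (1 - α))) • stableMeasure s α := by
  rw [stableMeasure_eq hs h1, stableMeasure_eq (by positivity) h1, ← withDensity_smul _
    (continuous_stableDensity hs h0 h1).measurable.ennreal_ofReal]
  refine withDensity_mono ?_
  filter_upwards [ae_stableDensity_mul_le hs hr h0 h1] with v hv
  rw [Pi.smul_apply, smul_eq_mul, ← ENNReal.ofReal_mul (by positivity)]
  exact ENNReal.ofReal_le_ofReal hv

/-! ### Tails, logarithmic moments and comparison of the stable measures -/

theorem stableMeasure_Ici_le {t γ R : ℝ} (ht : 0 ≤ t) (h0 : 0 < γ) (h1 : γ ≤ 1) (hR : 0 < R) :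
    (stableMeasure t γ).real (Ici R) ≤ 2 * (t * R ^ (-γ)) := by
  have := isProbabilityMeasure_stableMeasure t h0 h1
  set ν := stableMeasure t γ
  have hl : 0 ≤ R⁻¹ := by positivity
  have hint := integrable_exp_neg_mul (ae_nonneg_stableMeasure t γ) hl
  have h2 : (1 - Real.exp (-1)) * ν.real (Ici R) ≤ ∫ v, (1 - Real.exp (-(R⁻¹ * v))) ∂ν := by
    rw [mul_comm, ← smul_eq_mul, ← integral_indicator_const _ measurableSet_Ici]
    refine integral_mono_ae ((integrable_const _).indicator measurableSet_Ici)
      ((integrable_const _).sub hint) ?_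
    filter_upwards [ae_nonneg_stableMeasure t γ] with v hv
    by_cases h : v ∈ Ici R
    · rw [indicator_of_mem h]
      have h3 : 1 ≤ R⁻¹ * v := by
        rw [inv_mul_eq_div, one_le_div hR]; exact h
      have := Real.exp_le_exp.2 (neg_le_neg h3)
      linarith
    · rw [indicator_of_notMem h, sub_nonneg, Real.exp_le_one_iff]
      have := mul_nonneg hl hv
      linarith
  rw [integral_sub (integrable_const _) hint, integral_exp_mul_stableMeasure ht h0 h1 hl] at h2
  simp only [integral_const, probReal_univ, smul_eq_mul, mul_one] at h2
  rw [Real.inv_rpow hR.le, ← Real.rpow_neg hR.le] at h2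
  have h4 := Real.add_one_le_exp (-(t * R ^ (-γ)))
  have h5 := Real.exp_neg_one_lt_half
  have h6 : 0 ≤ ν.real (Ici R) := measureReal_nonneg
  nlinarith

theorem stableMeasure_Iic_le {t γ a : ℝ} (ht : 0 ≤ t) (h0 : 0 < γ) (h1 : γ ≤ 1) (ha : 0 < a) :
    (stableMeasure t γ).real (Iic a) ≤ Real.exp (1 - t * a ^ (-γ)) := by
  have := isProbabilityMeasure_stableMeasure t h0 h1
  set ν := stableMeasure t γ
  have hl : 0 ≤ a⁻¹ := by positivity
  have hint := integrable_exp_neg_mul (ae_nonneg_stableMeasure t γ) hl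
  have h2 : Real.exp (-1) * ν.real (Iic a) ≤ ∫ v, Real.exp (-(a⁻¹ * v)) ∂ν := by
    rw [mul_comm, ← smul_eq_mul, ← integral_indicator_const _ measurableSet_Iic]
    refine integral_mono ((integrable_const _).indicator measurableSet_Iic) hint fun v => ?_
    by_cases h : v ∈ Iic a
    · rw [indicator_of_mem h]
      have h3 : a⁻¹ * v ≤ 1 := by
        rw [inv_mul_eq_div, div_le_one ha]; exact h
      exact Real.exp_le_exp.2 (neg_le_neg h3)
    · rw [indicator_of_notMem h]
      exact Real.exp_nonneg _
  rw [integral_exp_mul_stableMeasure ht h0 h1 hl, Real.inv_rpow ha.le, ← Real.rpow_neg ha.le] at h2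
  rw [sub_eq_add_neg, Real.exp_add]
  have h7 : Real.exp 1 * Real.exp (-1) = 1 := by rw [← Real.exp_add]; simp
  calc ν.real (Iic a) = Real.exp 1 * (Real.exp (-1) * ν.real (Iic a)) := by
        rw [← mul_assoc, h7, one_mul]
    _ ≤ _ := mul_le_mul_of_nonneg_left h2 (Real.exp_nonneg _)

/-- Polynomial tails of order `γ` give a squared logarithmic moment of order `γ⁻²`. -/
theorem lintegral_posLog_sq_le {Ω : Type*} [MeasurableSpace Ω] {ν : Measure Ω}
    [IsProbabilityMeasure ν] {X : Ω → ℝ} (hX : Measurable X) (hX0 : ∀ᵐ x ∂ν, 0 ≤ X x) {γ : ℝ}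
    (hγ : 0 < γ) (htail : ∀ R, 0 < R → ν.real {x | R ≤ X x} ≤ 2 * R ^ (-γ)) :
    ∫⁻ x, ENNReal.ofReal (Real.posLog (X x) ^ 2) ∂ν ≤ ENNReal.ofReal (48 / γ ^ 2) := by
  have hp : 0 < γ / 2 := by positivity
  have hmom : ∫⁻ x, ENNReal.ofReal (X x ^ (γ / 2)) ∂ν ≤ 3 := by
    rw [lintegral_rpow_eq_lintegral_meas_le_mul ν hX0 hX.aemeasurable hp]
    have hsplit : Ioi (0 : ℝ) = Ioc 0 1 ∪ Ioi 1 := (Ioc_union_Ioi_eq_Ioi zero_le_one).symm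
    have e1 : ∫⁻ t in Ioc (0 : ℝ) 1, ν {a | t ≤ X a} * ENNReal.ofReal (t ^ (γ / 2 - 1)) ≤
        ENNReal.ofReal (2 / γ) := by
      have hi : IntegrableOn (fun t : ℝ => t ^ (γ / 2 - 1)) (Ioc 0 1) :=
        (intervalIntegrable_iff_integrableOn_Ioc_of_le zero_le_one).1
          (intervalIntegral.intervalIntegrable_rpow' (by linarith))
      calc _ ≤ ∫⁻ t in Ioc (0 : ℝ) 1, ENNReal.ofReal (t ^ (γ / 2 - 1)) := by
            refine lintegral_mono fun t => ?_
            exact (mul_le_mul_left (prob_le_one) _).trans_eq (one_mul _)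
        _ = ENNReal.ofReal (∫ t in Ioc (0 : ℝ) 1, t ^ (γ / 2 - 1)) := by
            rw [ofReal_integral_eq_lintegral_ofReal hi]
            exact (ae_restrict_mem measurableSet_Ioc).mono fun t ht =>
              Real.rpow_nonneg ht.1.le _
        _ = ENNReal.ofReal (2 / γ) := by
            rw [← intervalIntegral.integral_of_le zero_le_one,
              integral_rpow (Or.inl (by linarith))]
            congr 1
            rw [sub_add_cancel, Real.one_rpow, Real.zero_rpow (by linarith)]
            field_simp
            norm_num
    have e2 : ∫⁻ t in Ioi (1 : ℝ), ν {a | t ≤ X a} * ENNReal.ofReal (t ^ (γ / 2 - 1)) ≤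
        ENNReal.ofReal (4 / γ) := by
      have hi : IntegrableOn (fun t : ℝ => t ^ (-(γ / 2) - 1)) (Ioi 1) :=
        integrableOn_Ioi_rpow_of_lt (by linarith) one_pos
      calc _ ≤ ∫⁻ t in Ioi (1 : ℝ), ENNReal.ofReal (2 * t ^ (-(γ / 2) - 1)) := by
            refine setLIntegral_mono' measurableSet_Ioi fun t ht => ?_
            have ht0 : (0 : ℝ) < t := zero_lt_one.trans ht
            have h3 : ν {a | t ≤ X a} ≤ ENNReal.ofReal (2 * t ^ (-γ)) := by
              rw [← ofReal_measureReal]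
              exact ENNReal.ofReal_le_ofReal (htail t ht0)
            refine (mul_le_mul_left h3 _).trans_eq ?_
            rw [← ENNReal.ofReal_mul (by positivity), mul_assoc, ← Real.rpow_add ht0]
            ring_nf
        _ = ENNReal.ofReal (∫ t in Ioi (1 : ℝ), 2 * t ^ (-(γ / 2) - 1)) := by
            rw [ofReal_integral_eq_lintegral_ofReal (hi.const_mul 2)]
            exact (ae_restrict_mem measurableSet_Ioi).mono fun t ht =>
              mul_nonneg zero_le_two (Real.rpow_nonneg (zero_le_one.trans (le_of_lt ht)) _)
        _ = ENNReal.ofReal (4 / γ) := by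
            rw [integral_const_mul, integral_Ioi_rpow_of_lt (by linarith) one_pos]
            congr 1
            rw [sub_add_cancel, Real.one_rpow]
            field_simp
            norm_num
    rw [hsplit, lintegral_union measurableSet_Ioi (by
      rw [disjoint_left]; intro x hx hx'; exact absurd hx.2 (not_le.2 hx'))]
    calc _ ≤ ENNReal.ofReal (γ / 2) * (ENNReal.ofReal (2 / γ) + ENNReal.ofReal (4 / γ)) := by
          gcongr
      _ = 3 := by
          rw [← ENNReal.ofReal_add (by positivity) (by positivity),
            ← ENNReal.ofReal_mul (by positivity)]
          have : γ / 2 * (2 / γ + 4 / γ) = 3 := by field_simp; norm_num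
          rw [this]; norm_num
  have hpt : ∀ x : ℝ, 0 ≤ x → Real.posLog x ^ 2 ≤ 16 / γ ^ 2 * x ^ (γ / 2) := by
    intro x hx
    have hq : 0 < γ / 4 := by positivity
    have h1 : Real.posLog x ≤ x ^ (γ / 4) / (γ / 4) :=
      max_le (by positivity) (Real.log_le_rpow_div hx hq)
    calc Real.posLog x ^ 2 ≤ (x ^ (γ / 4) / (γ / 4)) ^ 2 :=
          pow_le_pow_left₀ Real.posLog_nonneg h1 2
      _ = 16 / γ ^ 2 * x ^ (γ / 2) := by
          rw [div_pow, ← Real.rpow_natCast (x ^ (γ / 4)), ← Real.rpow_mul hx]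
          have : γ / 4 * ((2 : ℕ) : ℝ) = γ / 2 := by push_cast; ring
          rw [this]
          field_simp
          norm_num
  calc _ ≤ ∫⁻ x, ENNReal.ofReal (16 / γ ^ 2) * ENNReal.ofReal (X x ^ (γ / 2)) ∂ν := by
        refine lintegral_mono_ae ?_
        filter_upwards [hX0] with x hx
        rw [← ENNReal.ofReal_mul (by positivity)]
        exact ENNReal.ofReal_le_ofReal (hpt _ hx)
    _ ≤ ENNReal.ofReal (16 / γ ^ 2) * 3 := by
        rw [lintegral_const_mul _ (by fun_prop)]
        gcongr
    _ = ENNReal.ofReal (48 / γ ^ 2) := by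
        rw [show (3 : ℝ≥0∞) = ENNReal.ofReal 3 by norm_num, ← ENNReal.ofReal_mul (by positivity)]
        ring_nf

theorem integral_posLog_sq_of_lintegral {Ω : Type*} [MeasurableSpace Ω] {ν : Measure Ω}
    {X : Ω → ℝ} (hX : Measurable X) {c : ℝ} (hc : 0 ≤ c)
    (h : ∫⁻ x, ENNReal.ofReal (Real.posLog (X x) ^ 2) ∂ν ≤ ENNReal.ofReal c) :
    Integrable (fun x => Real.posLog (X x) ^ 2) ν ∧ ∫ x, Real.posLog (X x) ^ 2 ∂ν ≤ c := by
  have hm : Measurable fun x => Real.posLog (X x) ^ 2 := by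
    have : Measurable Real.posLog := measurable_const.max Real.measurable_log
    exact (this.comp hX).pow_const 2
  refine ⟨⟨hm.aestronglyMeasurable, ?_⟩, ?_⟩
  · rw [hasFiniteIntegral_iff_ofReal (Eventually.of_forall fun x => by positivity)]
    exact h.trans_lt ENNReal.ofReal_lt_top
  · rw [integral_eq_lintegral_of_nonneg_ae (Eventually.of_forall fun x => by positivity)
      hm.aestronglyMeasurable]
    exact ENNReal.toReal_le_of_le_ofReal hc h

/-- The `γ`-stable measure at time `t` lives at the scale `t ^ (1 / γ)`: logarithmic deviations from
it, upwards and downwards, have second moments of order `γ⁻²`. -/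
theorem posLog_moment_stableMeasure {t γ : ℝ} (ht : 0 < t) (h0 : 0 < γ) (h1 : γ ≤ 1) :
    (Integrable (fun v => Real.posLog (v / t ^ (1 / γ)) ^ 2) (stableMeasure t γ) ∧
      ∫ v, Real.posLog (v / t ^ (1 / γ)) ^ 2 ∂stableMeasure t γ ≤ 48 / γ ^ 2) ∧
    (Integrable (fun v => Real.posLog (t ^ (1 / γ) / v) ^ 2) (stableMeasure t γ) ∧
      ∫ v, Real.posLog (t ^ (1 / γ) / v) ^ 2 ∂stableMeasure t γ ≤ 48 / γ ^ 2) := by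
  have := isProbabilityMeasure_stableMeasure t h0 h1
  set τ := t ^ (1 / γ) with hτ
  have hτ0 : 0 < τ := by positivity
  have hτγ : τ ^ (-γ) = t⁻¹ := by
    rw [hτ, ← Real.rpow_mul ht.le, ← Real.rpow_neg_one]
    congr 1
    field_simp
  refine ⟨integral_posLog_sq_of_lintegral (by fun_prop) (by positivity)
    (lintegral_posLog_sq_le (by fun_prop) ?_ h0 fun R hR => ?_),
    integral_posLog_sq_of_lintegral (by fun_prop) (by positivity)
    (lintegral_posLog_sq_le (by fun_prop) ?_ h0 fun R hR => ?_)⟩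
  · filter_upwards [ae_nonneg_stableMeasure t γ] with v hv
    positivity
  · have : {v : ℝ | R ≤ v / τ} = Ici (R * τ) := by
      ext v; simp only [mem_ofPred_eq, mem_Ici, le_div_iff₀ hτ0]
    rw [this]
    refine (stableMeasure_Ici_le ht.le h0 h1 (by positivity)).trans_eq ?_
    rw [Real.mul_rpow hR.le hτ0.le, hτγ]
    field_simp
  · filter_upwards [ae_nonneg_stableMeasure t γ] with v hv
    positivity
  · have hsub : (stableMeasure t γ).real {v : ℝ | R ≤ τ / v} ≤
        (stableMeasure t γ).real (Iic (τ / R)) := by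
      refine measureReal_mono (fun v hv => ?_)
      simp only [mem_ofPred_eq] at hv
      have hv0 : 0 < v := by
        by_contra h
        have := div_nonpos_of_nonneg_of_nonpos hτ0.le (not_lt.1 h)
        linarith
      rw [mem_Iic, le_div_iff₀ hR]
      rwa [le_div_iff₀ hv0, mul_comm] at hv
    refine hsub.trans ((stableMeasure_Iic_le ht.le h0 h1 (by positivity)).trans ?_)
    rw [Real.div_rpow hτ0.le hR.le, hτγ]
    have hx : 0 < R ^ (-γ) := by positivity
    have h2 : t * (t⁻¹ / R ^ (-γ)) = (R ^ (-γ))⁻¹ := by field_simp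
    rw [h2]
    set y := R ^ (-γ)
    -- `exp (1 - 1 / y) ≤ y`, from `1 / y ≤ exp (1 / y - 1)`
    have h3 := Real.add_one_le_exp (y⁻¹ - 1)
    have h4 : Real.exp (1 - y⁻¹) * Real.exp (y⁻¹ - 1) = 1 := by rw [← Real.exp_add]; simp
    have h5 : Real.exp (1 - y⁻¹) * y⁻¹ ≤ 1 := by
      refine le_trans ?_ h4.le
      exact mul_le_mul_of_nonneg_left (by linarith) (Real.exp_nonneg _)
    rw [← div_eq_mul_inv, div_le_one hx] at h5
    linarith

theorem half_le_stableMeasure_Icc {γ : ℝ} (h0 : 0 < γ) (h1 : γ ≤ 1) :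
    1 / 2 ≤ (stableMeasure 1 γ).real (Icc ((4 : ℝ) ^ (-(1 / γ))) ((8 : ℝ) ^ (1 / γ))) := by
  have := isProbabilityMeasure_stableMeasure 1 h0 h1
  set ν := stableMeasure 1 γ
  have e1 := stableMeasure_Iic_le zero_le_one h0 h1 
    (show (0 : ℝ) < (4 : ℝ) ^ (-(1 / γ)) by positivity)
  have e2 := stableMeasure_Ici_le zero_le_one h0 h1 (show (0 : ℝ) < (8 : ℝ) ^ (1 / γ) by positivity)
  rw [← Real.rpow_mul (by norm_num)] at e1 e2
  have h3 : -(1 / γ) * -γ = 1 := by field_simp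
  have h4 : 1 / γ * -γ = -1 := by field_simp
  rw [h3, Real.rpow_one] at e1
  rw [h4, Real.rpow_neg_one] at e2
  have h5 : Real.exp (1 - 1 * 4) ≤ 1 / 4 := by
    have : Real.exp (1 - 1 * 4) = Real.exp (-1) * (Real.exp (-1) * Real.exp (-1)) := by
      rw [← Real.exp_add, ← Real.exp_add]; norm_num
    rw [this]
    have h6 := Real.exp_neg_one_lt_half
    have h7 := Real.exp_pos (-1)
    have h8 : Real.exp (-1) * Real.exp (-1) ≤ 1 / 4 := by nlinarith
    nlinarith
  have hcov : (univ : Set ℝ) ⊆ Icc ((4 : ℝ) ^ (-(1 / γ))) ((8 : ℝ) ^ (1 / γ)) ∪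
      (Iic ((4 : ℝ) ^ (-(1 / γ))) ∪ Ici ((8 : ℝ) ^ (1 / γ))) := by
    intro x _
    simp only [mem_union, mem_Icc, mem_Iic, mem_Ici]
    rcases le_total x ((4 : ℝ) ^ (-(1 / γ))) with h | h
    · exact Or.inr (Or.inl h)
    · rcases le_total x ((8 : ℝ) ^ (1 / γ)) with h' | h'
      · exact Or.inl ⟨h, h'⟩
      · exact Or.inr (Or.inr h')
  have h9 := (measureReal_mono (μ := ν) hcov).trans ((measureReal_union_le _ _).trans
    (add_le_add_right (measureReal_union_le _ _) _))
  rw [probReal_univ] at h9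
  linarith

/-- The weight `(v / b) ^ K`, restricted to `0 < v ≤ b`. -/
def truncPow (K v b : ℝ) : ℝ≥0∞ :=
  {p : ℝ × ℝ | 0 < p.1 ∧ p.1 ≤ p.2}.indicator (fun p => ENNReal.ofReal ((p.1 / p.2) ^ K)) (v, b)

theorem measurable_truncPow (K : ℝ) : Measurable fun p : ℝ × ℝ => truncPow K p.1 p.2 := by
  have hs : MeasurableSet {p : ℝ × ℝ | 0 < p.1 ∧ p.1 ≤ p.2} :=
    (measurableSet_lt measurable_const measurable_fst).inter
      (measurableSet_le measurable_fst measurable_snd)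
  exact (Measurable.indicator (by fun_prop) hs)

theorem measurable_truncPow_left (K b : ℝ) : Measurable fun v => truncPow K v b :=
  (measurable_truncPow K).comp measurable_prodMk_right

theorem truncPow_of_mem {K v b : ℝ} (hv : 0 < v) (hb : v ≤ b) :
    truncPow K v b = ENNReal.ofReal ((v / b) ^ K) :=
  indicator_of_mem (show (v, b) ∈ {p : ℝ × ℝ | 0 < p.1 ∧ p.1 ≤ p.2} from ⟨hv, hb⟩) _

theorem truncPow_of_notMem {K v b : ℝ} (h : ¬(0 < v ∧ v ≤ b)) : truncPow K v b = 0 :=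
  indicator_of_notMem (show (v, b) ∉ {p : ℝ × ℝ | 0 < p.1 ∧ p.1 ≤ p.2} from h) _

theorem lintegral_truncPow_ge {K v a B : ℝ} (hK : 1 ≤ K) (hv : 0 < v) (ha : a ≤ v)
    (hB : 2 * v ≤ B) : ENNReal.ofReal (Real.exp (-1) / (2 * K)) ≤
      ∫⁻ b in Icc a B, ENNReal.ofReal b⁻¹ * truncPow K v b := by
  have hK0 : 0 < K := by linarith
  have hsub : Icc v (v * (1 + 1 / K)) ⊆ Icc a B := by
    refine Icc_subset_Icc ha (le_trans ?_ hB)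
    have : 1 / K ≤ 1 := by rw [div_le_one hK0]; exact hK
    nlinarith
  calc ENNReal.ofReal (Real.exp (-1) / (2 * K))
      = ∫⁻ _ in Icc v (v * (1 + 1 / K)), ENNReal.ofReal ((2 * v)⁻¹ * Real.exp (-1)) := by
        rw [lintegral_const, Measure.restrict_apply_univ, Real.volume_Icc,
          ← ENNReal.ofReal_mul (by positivity)]
        congr 1
        field_simp
        ring
    _ ≤ ∫⁻ b in Icc v (v * (1 + 1 / K)), ENNReal.ofReal b⁻¹ * truncPow K v b := by
        refine setLIntegral_mono' measurableSet_Icc fun b hb => ?_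
        have hb0 : 0 < b := hv.trans_le hb.1
        have hb2 : b ≤ 2 * v := by
          have : 1 / K ≤ 1 := by rw [div_le_one hK0]; exact hK
          nlinarith [hb.2]
        rw [truncPow_of_mem hv hb.1, ← ENNReal.ofReal_mul (by positivity)]
        refine ENNReal.ofReal_le_ofReal (mul_le_mul ?_ ?_ (Real.exp_nonneg _) (by positivity))
        · exact inv_anti₀ hb0 hb2
        · have h1 : Real.exp (-(1 / K)) ≤ v / b := by
            rw [Real.exp_neg, le_div_iff₀ hb0, inv_mul_le_iff₀ (Real.exp_pos _)]
            have := Real.add_one_le_exp (1 / K)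
            nlinarith [hb.2]
          calc Real.exp (-1) = Real.exp (-(1 / K)) ^ K := by
                rw [← Real.exp_mul]; congr 1; field_simp
            _ ≤ (v / b) ^ K := Real.rpow_le_rpow (Real.exp_nonneg _) h1 hK0.le
    _ ≤ _ := lintegral_mono_set hsub

/-- Averaging over the scale-invariant measure `db / b` produces a scale `b` at which the truncated
moment of order `K` of the `γ`-stable measure is at least of order `γ / K`. -/
theorem exists_lintegral_truncPow_ge {K γ : ℝ} (hK : 1 ≤ K) (h0 : 0 < γ) (h1 : γ ≤ 1) :
    ∃ b : ℝ, 0 < b ∧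
      ENNReal.ofReal (γ / (60 * K)) ≤ ∫⁻ v, truncPow K v b ∂stableMeasure 1 γ := by
  have := isProbabilityMeasure_stableMeasure 1 h0 h1
  set ν := stableMeasure 1 γ with hν
  have hK0 : 0 < K := by linarith
  set a : ℝ := (4 : ℝ) ^ (-(1 / γ)) with ha
  set A : ℝ := (8 : ℝ) ^ (1 / γ) with hA
  have ha0 : 0 < a := by positivity
  have hA0 : 0 < A := by positivity
  have hA1 : 1 ≤ A := Real.one_le_rpow (by norm_num) (by positivity)
  have ha1 : a ≤ 1 := Real.rpow_le_one_of_one_le_of_nonpos (by norm_num)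
    (by rw [neg_nonpos]; positivity)
  by_contra! hcon
  have hlog : Real.log (2 * A / a) ≤ 5 / γ := by
    rw [Real.log_div (by positivity) (by positivity), Real.log_mul (by norm_num) (by positivity),
      hA, ha, Real.log_rpow (by norm_num), Real.log_rpow (by norm_num)]
    have h8 : Real.log 8 = 3 * Real.log 2 := by
      rw [show (8 : ℝ) = 2 ^ 3 by norm_num, Real.log_pow]; norm_num
    have h4 : Real.log 4 = 2 * Real.log 2 := by
      rw [show (4 : ℝ) = 2 ^ 2 by norm_num, Real.log_pow]; norm_num
    rw [h8, h4, le_div_iff₀ h0]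
    have h2 := Real.log_two_lt_d9
    have h2' := Real.log_two_gt_d9
    have : (Real.log 2 + 1 / γ * (3 * Real.log 2) - -(1 / γ) * (2 * Real.log 2)) * γ =
        Real.log 2 * γ + 5 * Real.log 2 := by field_simp; ring
    rw [this]
    nlinarith
  have hI : ∫⁻ b in Icc a (2 * A), ENNReal.ofReal b⁻¹ = ENNReal.ofReal (Real.log (2 * A / a)) := by
    have hle : a ≤ 2 * A := by linarith
    have hii : IntegrableOn (fun b : ℝ => b⁻¹) (Icc a (2 * A)) :=
      ContinuousOn.integrableOn_Icc (continuousOn_inv₀.mono fun x hx => (ha0.trans_le hx.1).ne')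
    rw [← ofReal_integral_eq_lintegral_ofReal hii, integral_Icc_eq_integral_Ioc,
      ← intervalIntegral.integral_of_le hle, integral_inv_of_pos ha0 (by positivity)]
    exact (ae_restrict_mem measurableSet_Icc).mono fun x hx => inv_nonneg.2 (ha0.le.trans hx.1)
  have hup : ∫⁻ b in Icc a (2 * A), ∫⁻ v, ENNReal.ofReal b⁻¹ * truncPow K v b ∂ν ≤
      ENNReal.ofReal (1 / (12 * K)) := by
    calc _ ≤ ∫⁻ b in Icc a (2 * A), ENNReal.ofReal (γ / (60 * K)) * ENNReal.ofReal b⁻¹ := by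
          refine setLIntegral_mono' measurableSet_Icc fun b hb => ?_
          rw [lintegral_const_mul _ (measurable_truncPow_left K _),
            mul_comm]
          exact mul_le_mul_left (hcon b (ha0.trans_le hb.1)).le _
      _ = ENNReal.ofReal (γ / (60 * K)) * ENNReal.ofReal (Real.log (2 * A / a)) := by
          rw [lintegral_const_mul _ (by fun_prop), hI]
      _ ≤ ENNReal.ofReal (γ / (60 * K)) * ENNReal.ofReal (5 / γ) := by gcongr
      _ = ENNReal.ofReal (1 / (12 * K)) := by
          rw [← ENNReal.ofReal_mul (by positivity)]
          congr 1
          field_simp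
          norm_num
  have hm : Measurable fun p : ℝ × ℝ => ENNReal.ofReal p.1⁻¹ * truncPow K p.2 p.1 :=
    (by fun_prop : Measurable fun p : ℝ × ℝ => ENNReal.ofReal p.1⁻¹).mul
      ((measurable_truncPow K).comp measurable_swap)
  rw [lintegral_lintegral_swap hm.aemeasurable] at hup
  have hlow : ENNReal.ofReal (Real.exp (-1) / (4 * K)) ≤
      ∫⁻ v, (∫⁻ b in Icc a (2 * A), ENNReal.ofReal b⁻¹ * truncPow K v b) ∂ν := by
    calc ENNReal.ofReal (Real.exp (-1) / (4 * K))
        ≤ ENNReal.ofReal (Real.exp (-1) / (2 * K)) * ν (Icc a A) := by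
          rw [← ofReal_measureReal, ← ENNReal.ofReal_mul (by positivity)]
          refine ENNReal.ofReal_le_ofReal ?_
          have h2 := half_le_stableMeasure_Icc h0 h1
          calc Real.exp (-1) / (4 * K) = Real.exp (-1) / (2 * K) * (1 / 2) := by
                field_simp
                norm_num
            _ ≤ _ := mul_le_mul_of_nonneg_left h2 (by positivity)
      _ = ∫⁻ _ in Icc a A, ENNReal.ofReal (Real.exp (-1) / (2 * K)) ∂ν := by
          rw [setLIntegral_const]
      _ ≤ ∫⁻ v in Icc a A, (∫⁻ b in Icc a (2 * A),
            ENNReal.ofReal b⁻¹ * truncPow K v b) ∂ν := by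
          refine setLIntegral_mono' measurableSet_Icc fun v hv => ?_
          exact lintegral_truncPow_ge hK (ha0.trans_le hv.1) hv.1 (by linarith [hv.2])
      _ ≤ _ := setLIntegral_le_lintegral _ _
  have hfin := (ENNReal.ofReal_le_ofReal_iff (by positivity)).1 (hlow.trans hup)
  rw [div_le_div_iff₀ (by positivity) (by positivity)] at hfin
  have h3 : 1 / 3 < Real.exp (-1) := by
    rw [Real.exp_neg, one_div]
    exact inv_strictAnti₀ (Real.exp_pos 1) (by linarith [Real.exp_one_lt_d9])
  nlinarith

/-- A stable measure of larger exponent is dominated by one of smaller exponent: the latter is a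
mixture of the measures `stableMeasure s α`, and each of these with `s ≤ b` dominates
`(s / b) ^ (1 / (1 - α))` times `stableMeasure b α`. -/
theorem exists_stableMeasure_le {γ α b : ℝ} (hγ0 : 0 < γ) (hγ1 : γ ≤ 1) (h0 : 0 < α) (h1 : α < 1)
    (hb : 0 < b) : ∃ t : ℝ, 0 < t ∧ stableMeasure b α ≤
      ENNReal.ofReal (60 / (γ * (1 - α))) • stableMeasure t (γ * α) := by
  have hu : 0 < 1 - α := by linarith
  set K := 1 / (1 - α) with hK
  have hK1 : 1 ≤ K := by rw [hK, le_div_iff₀ hu]; linarith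
  have hK0 : 0 < K := by linarith
  obtain ⟨b₀, hb₀, hJ⟩ := exists_lintegral_truncPow_ge hK1 hγ0 hγ1
  have hconst : 60 / (γ * (1 - α)) * (γ / (60 * K)) = 1 := by rw [hK]; field_simp
  have hone : stableMeasure b₀ α ≤
      ENNReal.ofReal (60 / (γ * (1 - α))) • stableMeasure 1 (γ * α) := by
    refine Measure.le_iff.2 fun A hA => ?_
    rw [← bind_stableMeasure zero_le_one hγ0 hγ1 h0 h1.le, Measure.smul_apply,
      Measure.bind_apply hA (stableKernel α).aemeasurable, smul_eq_mul]
    have hpt : ∀ s, truncPow K s b₀ * stableMeasure b₀ α A ≤ stableMeasure s α A := by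
      intro s
      by_cases hs : 0 < s ∧ s ≤ b₀
      · rw [truncPow_of_mem hs.1 hs.2]
        have h2 := stableMeasure_mul_le (α := α) hs.1 ((one_le_div hs.1).2 hs.2) h0 h1
        rw [div_mul_cancel₀ _ hs.1.ne', ← hK] at h2
        have h3 := Measure.le_iff'.1 h2 A
        rw [Measure.smul_apply, smul_eq_mul] at h3
        have hs1 := hs.1
        have h4 : (s / b₀) ^ K * (b₀ / s) ^ K = 1 := by
          rw [← Real.mul_rpow (by positivity) (by positivity)]
          have : s / b₀ * (b₀ / s) = 1 := by field_simp
          rw [this, Real.one_rpow]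
        calc _ ≤ ENNReal.ofReal ((s / b₀) ^ K) *
              (ENNReal.ofReal ((b₀ / s) ^ K) * stableMeasure s α A) := by gcongr
          _ = stableMeasure s α A := by
              rw [← mul_assoc, ← ENNReal.ofReal_mul (by positivity), h4, ENNReal.ofReal_one,
                one_mul]
      · rw [truncPow_of_notMem hs, zero_mul]
        exact zero_le
    calc stableMeasure b₀ α A
        = ENNReal.ofReal (60 / (γ * (1 - α))) *
            (ENNReal.ofReal (γ / (60 * K)) * stableMeasure b₀ α A) := by
          rw [← mul_assoc, ← ENNReal.ofReal_mul (by positivity), hconst, ENNReal.ofReal_one,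
            one_mul]
      _ ≤ ENNReal.ofReal (60 / (γ * (1 - α))) *
            ((∫⁻ v, truncPow K v b₀ ∂stableMeasure 1 γ) * stableMeasure b₀ α A) := by gcongr
      _ = ENNReal.ofReal (60 / (γ * (1 - α))) *
            ∫⁻ v, truncPow K v b₀ * stableMeasure b₀ α A ∂stableMeasure 1 γ := by
          rw [lintegral_mul_const _ (measurable_truncPow_left K _)]
      _ ≤ _ := by
          gcongr with s
          exact hpt s
  set c := (b / b₀) ^ (1 / α) with hc
  have hc0 : 0 < c := by positivity
  have hcα : c ^ α * b₀ = b := by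
    rw [hc, ← Real.rpow_mul (by positivity), one_div_mul_cancel h0.ne', Real.rpow_one,
      div_mul_cancel₀ _ hb₀.ne']
  refine ⟨c ^ (γ * α) * 1, by positivity, ?_⟩
  have hm : Measurable fun v : ℝ => c * v := by fun_prop
  rw [← map_mul_stableMeasure zero_le_one (by positivity) (mul_le_one₀ hγ1 h0.le h1.le) hc0,
    ← Measure.map_smul, ← hcα, ← map_mul_stableMeasure hb₀.le h0 h1.le hc0]
  exact Measure.map_mono hone hm

variable {M : Type u} [MeasurableSpace M] {μ : Measure M}

/-! ### The duality between `L^∞` and `L^1` -/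

theorem ae_norm_le (f : Lp ℂ ∞ μ) : ∀ᵐ x ∂μ, ‖f x‖ ≤ ‖f‖ := by
  filter_upwards [ae_le_eLpNormEssSup (f := f) (μ := μ)] with x hx
  rw [Lp.norm_def, eLpNorm_exponent_top]
  have := Lp.eLpNorm_ne_top f
  rw [eLpNorm_exponent_top] at this
  rw [← toReal_enorm]
  exact ENNReal.toReal_mono this hx

theorem norm_le_of_ae {f : Lp ℂ ∞ μ} {C : ℝ} (hC : 0 ≤ C) (h : ∀ᵐ x ∂μ, ‖f x‖ ≤ C) : ‖f‖ ≤ C := by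
  rw [Lp.norm_def, eLpNorm_exponent_top]
  refine ENNReal.toReal_le_of_le_ofReal hC (eLpNormEssSup_le_of_ae_bound h)

theorem integrable_L1 (g : Lp ℂ 1 μ) : Integrable g μ := memLp_one_iff_integrable.1 (Lp.memLp g)

theorem integrable_mul_L1 (f : Lp ℂ ∞ μ) {g : M → ℂ} (hg : Integrable g μ) :
    Integrable (fun x => f x * g x) μ :=
  hg.bdd_mul (Lp.aestronglyMeasurable f) (ae_norm_le f)

theorem integrable_conj {g : M → ℂ} (hg : Integrable g μ) :
    Integrable (fun x => (starRingEnd ℂ) (g x)) μ := by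
  refine ⟨Complex.continuous_conj.comp_aestronglyMeasurable hg.1, ?_⟩
  refine hg.2.congr' (Eventually.of_forall fun x => ?_)
  simp

theorem integrable_pairing (f : Lp ℂ ∞ μ) (g : Lp ℂ 1 μ) :
    Integrable (fun x => f x * (starRingEnd ℂ) (g x)) μ :=
  integrable_mul_L1 f (integrable_conj (integrable_L1 g))

theorem pairing_add (f f' : Lp ℂ ∞ μ) (g : Lp ℂ 1 μ) :
    pairing (f + f') g = pairing f g + pairing f' g := by
  rw [pairing, pairing, pairing, ← integral_add (integrable_pairing f g) (integrable_pairing f' g)]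
  refine integral_congr_ae ?_
  filter_upwards [Lp.coeFn_add f f'] with x hx
  rw [hx, Pi.add_apply, add_mul]

theorem pairing_smul (c : ℂ) (f : Lp ℂ ∞ μ) (g : Lp ℂ 1 μ) :
    pairing (c • f) g = c * pairing f g := by
  rw [pairing, pairing, ← integral_const_mul]
  refine integral_congr_ae ?_
  filter_upwards [Lp.coeFn_smul c f] with x hx
  rw [hx, Pi.smul_apply, smul_eq_mul, mul_assoc]

/-- The pairing with a fixed `g`, as a linear functional on `L^∞`. -/
def pairingL (g : Lp ℂ 1 μ) : Lp ℂ ∞ μ →ₗ[ℂ] ℂ where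
  toFun f := pairing f g
  map_add' f f' := pairing_add f f' g
  map_smul' c f := pairing_smul c f g

theorem pairing_add_right (f : Lp ℂ ∞ μ) (g g' : Lp ℂ 1 μ) :
    pairing f (g + g') = pairing f g + pairing f g' := by
  rw [pairing, pairing, pairing, ← integral_add (integrable_pairing f g) (integrable_pairing f g')]
  refine integral_congr_ae ?_
  filter_upwards [Lp.coeFn_add g g'] with x hx
  rw [hx, Pi.add_apply, map_add, mul_add]

theorem pairing_smul_right (c : ℂ) (f : Lp ℂ ∞ μ) (g : Lp ℂ 1 μ) :
    pairing f (c • g) = (starRingEnd ℂ) c * pairing f g := by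
  rw [pairing, pairing, ← integral_const_mul]
  refine integral_congr_ae ?_
  filter_upwards [Lp.coeFn_smul c g] with x hx
  rw [hx, Pi.smul_apply, smul_eq_mul, map_mul]
  ring

theorem norm_pairing_le (f : Lp ℂ ∞ μ) (g : Lp ℂ 1 μ) : ‖pairing f g‖ ≤ ‖f‖ * ‖g‖ := by
  have hg : ∫ x, ‖g x‖ ∂μ = ‖g‖ := by
    rw [L1.norm_eq_integral_norm]
  rw [pairing, ← hg, ← integral_const_mul]
  refine norm_integral_le_of_norm_le ((integrable_L1 g).norm.const_mul _) ?_
  filter_upwards [ae_norm_le f] with x hx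
  rw [norm_mul, RCLike.norm_conj]
  exact mul_le_mul_of_nonneg_right hx (norm_nonneg _)

theorem pairing_indicator (f : Lp ℂ ∞ μ) {A : Set M} (hA : MeasurableSet A) (hμ : μ A ≠ ∞) :
    pairing f (indicatorConstLp 1 hA hμ (1 : ℂ)) = ∫ x in A, f x ∂μ := by
  rw [pairing, ← integral_indicator hA]
  refine integral_congr_ae ?_
  filter_upwards [indicatorConstLp_coeFn (p := 1) (hs := hA) (hμs := hμ) (c := (1 : ℂ))] with x hx
  rw [hx]
  by_cases h : x ∈ A <;> simp [h]

theorem integrableOn_Linf (f : Lp ℂ ∞ μ) {A : Set M} (hμ : μ A < ∞) : IntegrableOn f A μ := by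
  have : IsFiniteMeasure (μ.restrict A) := ⟨by rwa [Measure.restrict_apply_univ]⟩
  exact Integrable.of_bound (Lp.aestronglyMeasurable f).restrict ‖f‖
    (ae_restrict_of_ae (ae_norm_le f))

theorem ext_pairing [SigmaFinite μ] {f f' : Lp ℂ ∞ μ} (h : ∀ g, pairing f g = pairing f' g) :
    f = f' := by
  refine Lp.ext (ae_eq_of_forall_setIntegral_eq_of_sigmaFinite
    (fun s _ hs => integrableOn_Linf f hs) (fun s _ hs => integrableOn_Linf f' hs)
    fun s hs hμs => ?_)
  rw [← pairing_indicator f hs hμs.ne, ← pairing_indicator f' hs hμs.ne, h]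

/-- `g ≥ 0` for a class `g ∈ L^1`. -/
def IsNonnegL1 (g : Lp ℂ 1 μ) : Prop := ∀ᵐ x ∂μ, 0 ≤ (g x).re ∧ (g x).im = 0

theorem re_pairing (f : Lp ℂ ∞ μ) (g : Lp ℂ 1 μ) :
    (pairing f g).re = ∫ x, (f x * (starRingEnd ℂ) (g x)).re ∂μ :=
  (integral_re (integrable_pairing f g)).symm

theorem im_pairing (f : Lp ℂ ∞ μ) (g : Lp ℂ 1 μ) :
    (pairing f g).im = ∫ x, (f x * (starRingEnd ℂ) (g x)).im ∂μ :=
  (integral_im (integrable_pairing f g)).symm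

theorem IsNonneg.pairing_nonneg {f : Lp ℂ ∞ μ} {g : Lp ℂ 1 μ} (hf : IsNonneg f)
    (hg : IsNonnegL1 g) : 0 ≤ (pairing f g).re ∧ (pairing f g).im = 0 := by
  constructor
  · rw [re_pairing]
    refine integral_nonneg_of_ae ?_
    filter_upwards [hf, hg] with x hx hx'
    simp [hx.2, hx'.2, mul_nonneg hx.1 hx'.1]
  · rw [im_pairing]
    refine integral_eq_zero_of_ae ?_
    filter_upwards [hf, hg] with x hx hx'
    simp [hx.2, hx'.2]

theorem isNonnegL1_indicator {A : Set M} (hA : MeasurableSet A) (hμ : μ A ≠ ∞) :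
    IsNonnegL1 (indicatorConstLp 1 hA hμ (1 : ℂ)) := by
  filter_upwards [indicatorConstLp_coeFn (p := 1) (hs := hA) (hμs := hμ) (c := (1 : ℂ))] with x hx
  rw [hx]
  by_cases h : x ∈ A <;> simp [h]

theorem isNonneg_of_pairing [SigmaFinite μ] {f : Lp ℂ ∞ μ}
    (h : ∀ g, IsNonnegL1 g → 0 ≤ (pairing f g).re ∧ (pairing f g).im = 0) : IsNonneg f := by
  have key : ∀ s, MeasurableSet s → μ s < ∞ →
      0 ≤ ∫ x in s, (f x).re ∂μ ∧ ∫ x in s, (f x).im ∂μ = 0 := by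
    intro s hs hμs
    have := h _ (isNonnegL1_indicator hs hμs.ne)
    rw [pairing_indicator f hs hμs.ne] at this
    have h1 := integral_re (integrableOn_Linf f hμs)
    have h2 := integral_im (integrableOn_Linf f hμs)
    simp only [RCLike.re_eq_complex_re, RCLike.im_eq_complex_im] at h1 h2
    rwa [h1, h2]
  have hre := ae_nonneg_of_forall_setIntegral_nonneg_of_sigmaFinite (μ := μ)
    (f := fun x => (f x).re) (fun s _ hμs => (integrableOn_Linf f hμs).re)
    fun s hs hμs => (key s hs hμs).1
  have him := ae_eq_zero_of_forall_setIntegral_eq_of_sigmaFinite (μ := μ)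
    (f := fun x => (f x).im) (fun s _ hμs => (integrableOn_Linf f hμs).im)
    fun s hs hμs => (key s hs hμs).2
  filter_upwards [hre, him] with x hx hx' using ⟨hx, hx'⟩

/-! ### Products in `L^∞` -/

theorem memLp_mulConj (f h : Lp ℂ ∞ μ) : MemLp (fun x => f x * (starRingEnd ℂ) (h x)) ∞ μ := by
  refine memLp_top_of_bound ((Lp.aestronglyMeasurable f).mul
    (Complex.continuous_conj.comp_aestronglyMeasurable (Lp.aestronglyMeasurable h)))
    (‖f‖ * ‖h‖) ?_
  filter_upwards [ae_norm_le f, ae_norm_le h] with x hx hx'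
  rw [norm_mul, RCLike.norm_conj]
  exact mul_le_mul hx hx' (norm_nonneg _) (norm_nonneg _)

/-- The product `f h^*` in `L^∞`. -/
def mulConj (f h : Lp ℂ ∞ μ) : Lp ℂ ∞ μ := (memLp_mulConj f h).toLp _

theorem coeFn_mulConj (f h : Lp ℂ ∞ μ) :
    mulConj f h =ᵐ[μ] fun x => f x * (starRingEnd ℂ) (h x) := MemLp.coeFn_toLp _

theorem coeFn_absSq (f : Lp ℂ ∞ μ) : absSq f =ᵐ[μ] fun x => ((‖f x‖ ^ 2 : ℝ) : ℂ) :=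
  MemLp.coeFn_toLp _

theorem isNonneg_absSq (f : Lp ℂ ∞ μ) : IsNonneg (absSq f) := by
  filter_upwards [coeFn_absSq f] with x hx
  rw [hx]
  exact ⟨by rw [Complex.ofReal_re]; positivity, Complex.ofReal_im _⟩

theorem memLp_const_Linf (c : ℂ) : MemLp (fun _ : M => c) ∞ μ := memLp_top_const c

/-- The constant function `c` in `L^∞`. -/
def constL (μ : Measure M) (c : ℂ) : Lp ℂ ∞ μ := (memLp_const_Linf c).toLp _

theorem coeFn_constL (c : ℂ) : constL μ c =ᵐ[μ] fun _ => c := MemLp.coeFn_toLp _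

theorem absSq_sub (f h : Lp ℂ ∞ μ) :
    absSq (f - h) = absSq f - mulConj f h - mulConj h f + absSq h := by
  refine Lp.ext ?_
  filter_upwards [coeFn_absSq (f - h), coeFn_absSq f, coeFn_absSq h, coeFn_mulConj f h,
    coeFn_mulConj h f, Lp.coeFn_sub f h, Lp.coeFn_add (absSq f - mulConj f h - mulConj h f)
    (absSq h), Lp.coeFn_sub (absSq f - mulConj f h) (mulConj h f),
    Lp.coeFn_sub (absSq f) (mulConj f h)] with x h1 h2 h3 h4 h5 h6 h7 h8 h9
  rw [h1, h7, Pi.add_apply, h8, Pi.sub_apply, h9, Pi.sub_apply, h2, h3, h4, h5, h6, Pi.sub_apply]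
  simp only [← Complex.normSq_eq_norm_sq, ← Complex.mul_conj, map_sub]
  ring

theorem absSq_eq_mulConj (f : Lp ℂ ∞ μ) : absSq f = mulConj f f := by
  refine Lp.ext ?_
  filter_upwards [coeFn_absSq f, coeFn_mulConj f f] with x h1 h2
  rw [h1, h2, Complex.mul_conj, Complex.normSq_eq_norm_sq]

theorem integrable_smulL1 (k : Lp ℂ ∞ μ) (g : Lp ℂ 1 μ) : MemLp (fun x => k x * g x) 1 μ :=
  memLp_one_iff_integrable.2 (integrable_mul_L1 k (integrable_L1 g))

theorem exists_pairing_mulConj (k : Lp ℂ ∞ μ) (g : Lp ℂ 1 μ) :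
    ∃ g' : Lp ℂ 1 μ, ∀ f, pairing (mulConj f k) g = pairing f g' := by
  refine ⟨(integrable_smulL1 k g).toLp _, fun f => integral_congr_ae ?_⟩
  filter_upwards [coeFn_mulConj f k, (integrable_smulL1 k g).coeFn_toLp] with x h1 h2
  rw [h1, h2, map_mul, mul_assoc]

/-! ### Representation of functionals -/

theorem memLp_ind {A : Set M} (hA : MeasurableSet A) :
    MemLp (A.indicator fun _ => (1 : ℂ)) ∞ μ := (memLp_const_Linf 1).indicator hA

open Classical in
/-- The indicator function of a measurable set in `L^∞` (`0` if the set is not measurable). -/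
def ind (μ : Measure M) (A : Set M) : Lp ℂ ∞ μ :=
  if hA : MeasurableSet A then (memLp_ind hA).toLp _ else 0

theorem coeFn_ind {A : Set M} (hA : MeasurableSet A) :
    ind μ A =ᵐ[μ] A.indicator fun _ => (1 : ℂ) := by
  rw [ind, dif_pos hA]; exact MemLp.coeFn_toLp _

theorem norm_ind_le (A : Set M) : ‖ind μ A‖ ≤ 1 := by
  by_cases hA : MeasurableSet A
  · refine norm_le_of_ae zero_le_one ?_
    filter_upwards [coeFn_ind hA] with x hx
    rw [hx]
    by_cases h : x ∈ A <;> simp [h]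
  · rw [ind, dif_neg hA]; simp

/-- A linear functional on `L^∞` that is continuous along norm bounded, almost everywhere
convergent sequences. -/
def SeqNormal (Λ : Lp ℂ ∞ μ →ₗ[ℂ] ℂ) : Prop :=
  ∀ (F : ℕ → Lp ℂ ∞ μ) (h : Lp ℂ ∞ μ) (C : ℝ), (∀ n, ‖F n‖ ≤ C) →
    (∀ᵐ x ∂μ, Tendsto (fun n => F n x) atTop (𝓝 (h x))) →
    Tendsto (fun n => Λ (F n)) atTop (𝓝 (Λ h))

theorem seqNormal_pairingL (g : Lp ℂ 1 μ) : SeqNormal (pairingL g) := by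
  intro F h C hC hlim
  refine tendsto_integral_of_dominated_convergence (fun x => C * ‖g x‖)
    (fun n => (integrable_pairing (F n) g).1) ((integrable_L1 g).norm.const_mul C)
    (fun n => ?_) ?_
  · filter_upwards [ae_norm_le (F n)] with x hx
    rw [norm_mul, RCLike.norm_conj]
    exact mul_le_mul_of_nonneg_right (hx.trans (hC n)) (norm_nonneg _)
  · filter_upwards [hlim] with x hx using hx.mul_const _

theorem sum_ind {f : ℕ → Set M} (hf : ∀ i, MeasurableSet (f i))
    (hd : Pairwise (Function.onFun Disjoint f)) (s : Finset ℕ) :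
    ∑ i ∈ s, ind μ (f i) = ind μ (⋃ i ∈ s, f i) := by
  classical
  induction s using Finset.induction_on with
  | empty =>
    rw [Finset.sum_empty]
    refine Lp.ext ?_
    filter_upwards [Lp.coeFn_zero ℂ ∞ μ, coeFn_ind (μ := μ) (A := ⋃ i ∈ (∅ : Finset ℕ), f i)
      (by simp)] with x h1 h2
    rw [h1, h2]; simp
  | insert a s ha ih =>
    have hm : MeasurableSet (⋃ i ∈ s, f i) := Finset.measurableSet_biUnion s fun i _ => hf i
    have hm' : MeasurableSet (⋃ i ∈ insert a s, f i) :=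
      Finset.measurableSet_biUnion _ fun i _ => hf i
    rw [Finset.sum_insert ha, ih]
    refine Lp.ext ?_
    filter_upwards [Lp.coeFn_add (ind μ (f a)) (ind μ (⋃ i ∈ s, f i)), coeFn_ind (μ := μ) (hf a),
      coeFn_ind (μ := μ) hm, coeFn_ind (μ := μ) hm'] with x h1 h2 h3 h4
    have hdis : Disjoint (f a) (⋃ i ∈ s, f i) := by
      refine disjoint_iUnion₂_right.2 fun i hi => hd ?_
      rintro rfl
      exact ha hi
    rw [h1, Pi.add_apply, h2, h3, h4, Finset.set_biUnion_insert,
      indicator_union_of_disjoint hdis]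

theorem SeqNormal.hasSum_ind {Λ : Lp ℂ ∞ μ →ₗ[ℂ] ℂ} (hΛ : SeqNormal Λ) {f : ℕ → Set M}
    (hf : ∀ i, MeasurableSet (f i)) (hd : Pairwise (Function.onFun Disjoint f)) :
    HasSum (fun i => Λ (ind μ (f i))) (Λ (ind μ (⋃ i, f i))) := by
  have h : Tendsto (fun s : Finset ℕ => ∑ i ∈ s, Λ (ind μ (f i))) atTop
      (𝓝 (Λ (ind μ (⋃ i, f i)))) := by
    refine tendsto_of_seq_tendsto fun s hs => ?_
    simp_rw [← map_sum, sum_ind hf hd]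
    refine hΛ _ _ 1 (fun n => norm_ind_le _) ?_
    have hm : ∀ n, MeasurableSet (⋃ i ∈ s n, f i) := fun n =>
      Finset.measurableSet_biUnion _ fun i _ => hf i
    filter_upwards [ae_all_iff.2 fun n => coeFn_ind (μ := μ) (hm n),
      coeFn_ind (μ := μ) (MeasurableSet.iUnion hf)] with x h1 h2
    simp_rw [h1, h2]
    refine tendsto_const_nhds.congr' ?_
    by_cases hx : x ∈ ⋃ i, f i
    · obtain ⟨i, hi⟩ := mem_iUnion.1 hx
      filter_upwards [hs.eventually (eventually_ge_atTop {i})] with n hn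
      have : x ∈ ⋃ i ∈ s n, f i := mem_iUnion₂.2 ⟨i, hn (Finset.mem_singleton_self i), hi⟩
      simp only [indicator_of_mem hx, indicator_of_mem this]
    · refine Eventually.of_forall fun n => ?_
      have : x ∉ ⋃ i ∈ s n, f i := fun h' => hx (iUnion₂_subset_iUnion _ _ h')
      simp only [indicator_of_notMem hx, indicator_of_notMem this]
  exact h

/-- The real signed measure `A ↦ L (Λ 1_A)`, for a real functional `L` on `ℂ`. -/
def SeqNormal.signedMeasure {Λ : Lp ℂ ∞ μ →ₗ[ℂ] ℂ} (hΛ : SeqNormal Λ) (L : ℂ →L[ℝ] ℝ) :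
    SignedMeasure M where
  measureOf' A := L (Λ (ind μ A))
  empty' := by
    have : ind μ (∅ : Set M) = 0 := by
      refine Lp.ext ?_
      filter_upwards [Lp.coeFn_zero ℂ ∞ μ, coeFn_ind (μ := μ) MeasurableSet.empty] with x h1 h2
      rw [h1, h2]; simp
    rw [this, map_zero, map_zero]
  not_measurable' A hA := by rw [ind, dif_neg hA, map_zero, map_zero]
  m_iUnion' f hf hd := (hΛ.hasSum_ind hf hd).mapL L

theorem SeqNormal.exists_density [SigmaFinite μ] {Λ : Lp ℂ ∞ μ →ₗ[ℂ] ℂ} (hΛ : SeqNormal Λ)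
    (L : ℂ →L[ℝ] ℝ) : ∃ w : M → ℝ, Integrable w μ ∧
      ∀ A, MeasurableSet A → ∫ x in A, w x ∂μ = L (Λ (ind μ A)) := by
  have hac : hΛ.signedMeasure L ≪ᵥ μ.toENNRealVectorMeasure := by
    refine VectorMeasure.AbsolutelyContinuous.mk fun A hA h0 => ?_
    rw [Measure.toENNRealVectorMeasure_apply_measurable hA] at h0
    have : ind μ A = 0 := by
      refine Lp.ext ?_
      filter_upwards [Lp.coeFn_zero ℂ ∞ μ, coeFn_ind (μ := μ) hA,
        measure_eq_zero_iff_ae_notMem.1 h0] with x h1 h2 h3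
      rw [h1, h2, indicator_of_notMem h3, Pi.zero_apply]
    change L (Λ (ind μ A)) = 0
    rw [this, map_zero, map_zero]
  refine ⟨_, SignedMeasure.integrable_rnDeriv (hΛ.signedMeasure L) μ, fun A hA => ?_⟩
  have h := SignedMeasure.withDensityᵥ_rnDeriv_eq _ μ hac
  have h2 : _ = L (Λ (ind μ A)) := congrArg (fun s : SignedMeasure M => s A) h
  rwa [withDensityᵥ_apply (SignedMeasure.integrable_rnDeriv _ _) hA] at h2

theorem toLp_indicator_smul {A : Set M} (hA : MeasurableSet A) (c : ℂ)
    (h : MemLp (A.indicator fun _ => c) ∞ μ) : h.toLp _ = c • ind μ A := by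
  refine Lp.ext ?_
  filter_upwards [h.coeFn_toLp, Lp.coeFn_smul c (ind μ A), coeFn_ind (μ := μ) hA] with x h1 h2 h3
  rw [h1, h2, Pi.smul_apply, h3]
  by_cases hx : x ∈ A <;> simp [hx]

/-- Two sequentially normal functionals which agree on indicator functions are equal. -/
theorem SeqNormal.eq_of_ind {Λ Λ' : Lp ℂ ∞ μ →ₗ[ℂ] ℂ} (hΛ : SeqNormal Λ) (hΛ' : SeqNormal Λ')
    (h : ∀ A, MeasurableSet A → Λ (ind μ A) = Λ' (ind μ A)) : Λ = Λ' := by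
  have hsimple : ∀ φ : SimpleFunc M ℂ,
      Λ ((φ.memLp_top μ).toLp _) = Λ' ((φ.memLp_top μ).toLp _) := by
    intro φ
    induction φ using SimpleFunc.induction with
    | const c hs =>
      rename_i s
      have h1 : MemLp (s.indicator fun _ => c) ∞ μ := (memLp_const_Linf c).indicator hs
      have h2 : (SimpleFunc.memLp_top (SimpleFunc.piecewise s hs (SimpleFunc.const M c)
          (SimpleFunc.const M 0)) μ).toLp _ = h1.toLp _ := by
        congr 1
      rw [h2, toLp_indicator_smul hs, map_smul, map_smul, h s hs]
    | add _ hf hg =>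
      rename_i f g _
      have h2 : (SimpleFunc.memLp_top (f + g) μ).toLp _ =
          (f.memLp_top μ).toLp _ + (g.memLp_top μ).toLp _ := by
        rw [← MemLp.toLp_add]; rfl
      rw [h2, map_add, map_add, hf, hg]
  refine LinearMap.ext fun f => ?_
  set f' := (Lp.stronglyMeasurable f) with hf'
  let φ := f'.approxBounded ‖f‖
  have hb : ∀ n, ‖((φ n).memLp_top μ).toLp _‖ ≤ ‖f‖ := by
    intro n
    refine norm_le_of_ae (norm_nonneg _) ?_
    filter_upwards [((φ n).memLp_top μ).coeFn_toLp] with x hx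
    rw [hx]
    exact f'.norm_approxBounded_le (norm_nonneg _) n x
  have hl : ∀ᵐ x ∂μ, Tendsto (fun n => ((φ n).memLp_top μ).toLp _ x) atTop (𝓝 (f x)) := by
    filter_upwards [f'.tendsto_approxBounded_ae (ae_norm_le f),
      ae_all_iff.2 fun n => ((φ n).memLp_top μ).coeFn_toLp] with x h1 h2
    simpa only [h2] using h1
  refine tendsto_nhds_unique (hΛ _ _ _ hb hl) ((hΛ' _ _ _ hb hl).congr fun n => ?_)
  exact (hsimple (φ n)).symm

/-- Radon–Nikodym: sequentially normal functionals on `L^∞` come from `L^1`. -/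
theorem SeqNormal.exists_L1 [SigmaFinite μ] {Λ : Lp ℂ ∞ μ →ₗ[ℂ] ℂ} (hΛ : SeqNormal Λ) :
    ∃ g : Lp ℂ 1 μ, ∀ f, Λ f = pairing f g := by
  obtain ⟨w, hw, hw'⟩ := hΛ.exists_density Complex.reCLM
  obtain ⟨z, hz, hz'⟩ := hΛ.exists_density Complex.imCLM
  have hi : Integrable (fun x => (w x : ℂ) - z x * Complex.I) μ :=
    hw.ofReal.sub (hz.ofReal.mul_const _)
  have hmem := memLp_one_iff_integrable.2 hi
  refine ⟨hmem.toLp _, fun f => ?_⟩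
  refine DFunLike.congr_fun (hΛ.eq_of_ind (seqNormal_pairingL (hmem.toLp _)) fun A hA => ?_) f
  have h1 : pairingL (hmem.toLp _) (ind μ A) = ∫ x in A, ((w x : ℂ) + z x * Complex.I) ∂μ := by
    rw [← integral_indicator hA]
    refine integral_congr_ae ?_
    filter_upwards [hmem.coeFn_toLp, coeFn_ind (μ := μ) hA] with x h1 h2
    rw [h1, h2]
    by_cases hx : x ∈ A <;> simp [hx]
  have hi1 : Integrable (fun x => (w x : ℂ)) (μ.restrict A) := hw.ofReal.restrict
  have hi2 : Integrable (fun x => (z x : ℂ) * Complex.I) (μ.restrict A) :=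
    (hz.ofReal.mul_const _).restrict
  rw [h1, integral_add hi1 hi2, integral_mul_const]
  rw [show ∫ x in A, (w x : ℂ) ∂μ = ((∫ x in A, w x ∂μ : ℝ) : ℂ) from integral_ofReal,
    show ∫ x in A, (z x : ℂ) ∂μ = ((∫ x in A, z x ∂μ : ℝ) : ℂ) from integral_ofReal,
    hw' A hA, hz' A hA]
  exact (Complex.re_add_im _).symm

/-! ### The dual of `L^1` and preduals of weak* continuous operators -/

theorem tendsto_L1_of_dominated {F : ℕ → Lp ℂ 1 μ} {G : Lp ℂ 1 μ} {b : M → ℝ}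
    (hb : Integrable b μ) (hF : ∀ n, ∀ᵐ x ∂μ, ‖F n x‖ ≤ b x)
    (hlim : ∀ᵐ x ∂μ, Tendsto (fun n => F n x) atTop (𝓝 (G x))) :
    Tendsto F atTop (𝓝 G) := by
  rw [tendsto_iff_norm_sub_tendsto_zero]
  have h1 : ∀ n, ‖F n - G‖ = ∫ x, ‖F n x - G x‖ ∂μ := by
    intro n
    rw [L1.norm_eq_integral_norm]
    refine integral_congr_ae ?_
    filter_upwards [Lp.coeFn_sub (F n) G] with x hx
    rw [hx, Pi.sub_apply]
  simp_rw [h1]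
  rw [show (0 : ℝ) = ∫ _x, (0 : ℝ) ∂μ by simp]
  refine tendsto_integral_of_dominated_convergence (fun x => b x + ‖G x‖)
    (fun n => ((Lp.aestronglyMeasurable (F n)).sub (Lp.aestronglyMeasurable G)).norm)
    (hb.add (integrable_L1 G).norm) (fun n => ?_) ?_
  · filter_upwards [hF n] with x hx
    rw [norm_norm]
    exact (norm_sub_le _ _).trans (by gcongr)
  · filter_upwards [hlim] with x hx
    have := (hx.sub_const (G x)).norm
    rwa [sub_self, norm_zero] at this

theorem memLp_conj_mul (f : Lp ℂ ∞ μ) {w : M → ℂ} (hw : Integrable w μ) :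
    MemLp (fun x => (starRingEnd ℂ) (f x) * w x) 1 μ := by
  refine memLp_one_iff_integrable.2 (hw.bdd_mul (c := ‖f‖)
    (Complex.continuous_conj.comp_aestronglyMeasurable (Lp.aestronglyMeasurable f)) ?_)
  filter_upwards [ae_norm_le f] with x hx
  rwa [RCLike.norm_conj]

/-- For a bounded antilinear functional `ℓ` on `L^1` and a fixed integrable `w`, the functional
`f ↦ ℓ (f^* w)` on `L^∞`. -/
def weightedFunctional (ℓ : Lp ℂ 1 μ →ₗ⋆[ℂ] ℂ) {w : M → ℂ} (hw : Integrable w μ) :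
    Lp ℂ ∞ μ →ₗ[ℂ] ℂ where
  toFun f := ℓ ((memLp_conj_mul f hw).toLp _)
  map_add' f f' := by
    rw [← map_add, ← MemLp.toLp_add]
    congr 1
    refine MemLp.toLp_congr _ _ ?_
    filter_upwards [Lp.coeFn_add f f'] with x hx
    simp only [Pi.add_apply]
    rw [hx, Pi.add_apply, map_add, add_mul]
  map_smul' c f := by
    have h : (memLp_conj_mul (c • f) hw).toLp _ =
        (starRingEnd ℂ) c • (memLp_conj_mul f hw).toLp _ := by
      rw [← MemLp.toLp_const_smul]
      refine MemLp.toLp_congr _ _ ?_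
      filter_upwards [Lp.coeFn_smul c f] with x hx
      simp only [Pi.smul_apply]
      rw [hx, Pi.smul_apply, smul_eq_mul, map_mul, smul_eq_mul, mul_assoc]
    rw [h, map_smulₛₗ, Complex.conj_conj, smul_eq_mul, RingHom.id_apply, smul_eq_mul]

theorem seqNormal_weightedFunctional {ℓ : Lp ℂ 1 μ →ₗ⋆[ℂ] ℂ} {C : ℝ}
    (hℓ : ∀ g, ‖ℓ g‖ ≤ C * ‖g‖) {w : M → ℂ} (hw : Integrable w μ) :
    SeqNormal (weightedFunctional ℓ hw) := by
  intro F h K hK hlim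
  have hc : Continuous ℓ := (ℓ.mkContinuous C hℓ).continuous
  refine (hc.tendsto _).comp (tendsto_L1_of_dominated (b := fun x => K * ‖w x‖)
    (hw.norm.const_mul K) (fun n => ?_) ?_)
  · filter_upwards [(memLp_conj_mul (F n) hw).coeFn_toLp, ae_norm_le (F n)] with x h1 h2
    rw [h1, norm_mul, RCLike.norm_conj]
    exact mul_le_mul_of_nonneg_right (h2.trans (hK n)) (norm_nonneg _)
  · filter_upwards [ae_all_iff.2 fun n => (memLp_conj_mul (F n) hw).coeFn_toLp,
      (memLp_conj_mul h hw).coeFn_toLp, hlim] with x h1 h2 h3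
    simp_rw [h1, h2]
    exact ((Complex.continuous_conj.tendsto _).comp h3).mul_const _

/-- The dual of `L^1` is `L^∞`: this is Radon–Nikodym for `f ↦ ℓ (f^* w)`, where `w > 0` is a
fixed integrable weight. -/
theorem exists_Linf_of_functional [SigmaFinite μ] (ℓ : Lp ℂ 1 μ →ₗ⋆[ℂ] ℂ) {C : ℝ} (hC : 0 ≤ C)
    (hℓ : ∀ g, ‖ℓ g‖ ≤ C * ‖g‖) : ∃ k : Lp ℂ ∞ μ, ‖k‖ ≤ C ∧ ∀ g, ℓ g = pairing k g := by
  obtain ⟨w, hw0, hwm, hwr⟩ : ∃ w : M → ℝ, (∀ x, 0 < w x) ∧ Measurable w ∧ Integrable w μ := by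
    obtain ⟨w, hw0, hwm, hwi⟩ := exists_pos_lintegral_lt_of_sigmaFinite μ one_ne_zero
    refine ⟨fun x => w x, fun x => NNReal.coe_pos.2 (hw0 x), measurable_coe_nnreal_real.comp hwm,
      (measurable_coe_nnreal_real.comp hwm).aestronglyMeasurable, ?_⟩
    refine lt_of_le_of_lt (lintegral_mono fun x => ?_) (hwi.trans ENNReal.one_lt_top)
    rw [Real.enorm_eq_ofReal (w x).coe_nonneg, ENNReal.ofReal_coe_nnreal]
  have hwc : Integrable (fun x => (w x : ℂ)) μ := hwr.ofReal
  have hwne : ∀ x, (w x : ℂ) ≠ 0 := fun x =>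
    Complex.ofReal_ne_zero.2 (hw0 x).ne'
  obtain ⟨g₀, hg₀⟩ := (seqNormal_weightedFunctional hℓ hwc).exists_L1
  have hg₀' : ∀ f : Lp ℂ ∞ μ, ℓ ((memLp_conj_mul f hwc).toLp _) = pairing f g₀ := hg₀
  -- testing against `1_A g₀ / |g₀|` bounds the density
  have hbd : ∀ᵐ x ∂μ, ‖g₀ x‖ ≤ C * w x := by
    refine ae_le_of_forall_setIntegral_le (integrable_L1 g₀).norm (hwr.const_mul C) ?_
    intro A hA _
    have hm : MemLp (A.indicator fun x => g₀ x / (‖g₀ x‖ : ℂ)) ∞ μ := by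
      refine memLp_top_of_bound (AEStronglyMeasurable.indicator
        ((Lp.stronglyMeasurable g₀).measurable.div (Complex.measurable_ofReal.comp
          (Lp.stronglyMeasurable g₀).measurable.norm)).aestronglyMeasurable hA) 1
        (Eventually.of_forall fun x => ?_)
      by_cases hx : x ∈ A
      · rw [indicator_of_mem hx, norm_div, Complex.norm_real, norm_norm]
        exact div_self_le_one _
      · rw [indicator_of_notMem hx, norm_zero]; exact zero_le_one
    have h1 : pairing (hm.toLp _) g₀ = ((∫ x in A, ‖g₀ x‖ ∂μ : ℝ) : ℂ) := by
      rw [← integral_indicator hA]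
      refine Eq.trans ?_ integral_ofReal
      refine integral_congr_ae ?_
      filter_upwards [hm.coeFn_toLp] with x hx
      rw [hx]
      by_cases hx : x ∈ A
      · rw [indicator_of_mem hx, indicator_of_mem hx]
        by_cases h0 : g₀ x = 0
        · simp [h0]
        · have : (‖g₀ x‖ : ℂ) ≠ 0 := by simpa using h0
          rw [div_mul_eq_mul_div, Complex.mul_conj, Complex.normSq_eq_norm_sq]
          push_cast
          field_simp
          rfl
      · simp [hx]
    have h2 : ‖(memLp_conj_mul (hm.toLp _) hwc).toLp _‖ ≤ ∫ x in A, w x ∂μ := by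
      rw [L1.norm_eq_integral_norm, ← integral_indicator hA]
      refine integral_mono_ae (integrable_L1 _).norm (hwr.indicator hA) ?_
      filter_upwards [(memLp_conj_mul (hm.toLp _) hwc).coeFn_toLp, hm.coeFn_toLp] with x h1 h2
      rw [h1, h2, norm_mul, RCLike.norm_conj, Complex.norm_real, Real.norm_of_nonneg (hw0 x).le]
      by_cases hx : x ∈ A
      · rw [indicator_of_mem hx, indicator_of_mem hx, norm_div, Complex.norm_real, norm_norm]
        exact mul_le_of_le_one_left (hw0 x).le (div_self_le_one _)
      · simp [hx]
    have h3 := hℓ ((memLp_conj_mul (hm.toLp _) hwc).toLp _)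
    rw [hg₀', h1, Complex.norm_real, Real.norm_of_nonneg
      (integral_nonneg fun x => norm_nonneg _)] at h3
    rw [integral_const_mul]
    exact h3.trans (mul_le_mul_of_nonneg_left h2 hC)
  have hkb : ∀ᵐ x ∂μ, ‖(starRingEnd ℂ) (g₀ x) / (w x : ℂ)‖ ≤ C := by
    filter_upwards [hbd] with x hx
    rw [norm_div, RCLike.norm_conj, Complex.norm_real, Real.norm_of_nonneg (hw0 x).le]
    exact div_le_of_le_mul₀ (hw0 x).le hC hx
  have hwcm : Measurable fun x => (w x : ℂ) :=
    Complex.measurable_ofReal.comp hwm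
  have hkm : MemLp (fun x => (starRingEnd ℂ) (g₀ x) / (w x : ℂ)) ∞ μ :=
    memLp_top_of_bound ((Complex.continuous_conj.measurable.comp
      (Lp.stronglyMeasurable g₀).measurable).div hwcm).aestronglyMeasurable C hkb
  refine ⟨hkm.toLp _, norm_le_of_ae hC ?_, fun g => ?_⟩
  · filter_upwards [hkm.coeFn_toLp, hkb] with x h1 h2
    rwa [h1]
  -- functions bounded by a multiple of `w` are dense in `L^1`
  let A : ℕ → Set M := fun n => {x | ‖g x‖ ≤ n * w x}
  have hA : ∀ n, MeasurableSet (A n) := fun n =>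
    measurableSet_le (Lp.stronglyMeasurable g).measurable.norm
      (hwm.const_mul _)
  have hfb : ∀ n x, ‖(A n).indicator (fun x => (starRingEnd ℂ) (g x) / (w x : ℂ)) x‖ ≤ n := by
    intro n x
    by_cases hx : x ∈ A n
    · rw [indicator_of_mem hx, norm_div, RCLike.norm_conj, Complex.norm_real,
        Real.norm_of_nonneg (hw0 x).le]
      exact div_le_of_le_mul₀ (hw0 x).le (Nat.cast_nonneg n) hx
    · rw [indicator_of_notMem hx, norm_zero]; exact Nat.cast_nonneg n
  have hfm : ∀ n, MemLp ((A n).indicator fun x => (starRingEnd ℂ) (g x) / (w x : ℂ)) ∞ μ :=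
    fun n => memLp_top_of_bound (((Complex.continuous_conj.measurable.comp
      (Lp.stronglyMeasurable g).measurable).div hwcm).indicator (hA n)).aestronglyMeasurable n
        (Eventually.of_forall (hfb n))
  let G : ℕ → Lp ℂ 1 μ := fun n => (memLp_conj_mul ((hfm n).toLp _) hwc).toLp _
  have hG : ∀ n, G n =ᵐ[μ] (A n).indicator fun x => g x := by
    intro n
    filter_upwards [(memLp_conj_mul ((hfm n).toLp _) hwc).coeFn_toLp, (hfm n).coeFn_toLp]
      with x h1 h2
    rw [h1, h2]
    by_cases hx : x ∈ A n
    · rw [indicator_of_mem hx, indicator_of_mem hx, map_div₀, Complex.conj_conj,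
        Complex.conj_ofReal, div_mul_cancel₀ _ (hwne x)]
    · simp [hx]
  have hGlim : Tendsto G atTop (𝓝 g) := by
    refine tendsto_L1_of_dominated (integrable_L1 g).norm (fun n => ?_) ?_
    · filter_upwards [hG n] with x hx
      rw [hx]
      exact norm_indicator_le_norm_self _ _
    · filter_upwards [ae_all_iff.2 hG] with x hx
      simp_rw [hx]
      refine tendsto_const_nhds.congr' ?_
      obtain ⟨n, hn⟩ := exists_nat_ge (‖g x‖ / w x)
      filter_upwards [eventually_ge_atTop n] with m hm
      rw [indicator_of_mem]
      have : ‖g x‖ / w x ≤ m := hn.trans (Nat.cast_le.2 hm)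
      exact (div_le_iff₀ (hw0 x)).1 this
  have hGeq : ∀ n, ℓ (G n) = pairing (hkm.toLp _) (G n) := by
    intro n
    rw [hg₀']
    refine integral_congr_ae ?_
    filter_upwards [hG n, (hfm n).coeFn_toLp, hkm.coeFn_toLp] with x h1 h2 h3
    rw [h1, h2, h3]
    by_cases hx : x ∈ A n
    · rw [indicator_of_mem hx, indicator_of_mem hx]; ring
    · simp [hx]
  have hc : Continuous ℓ := (ℓ.mkContinuous C hℓ).continuous
  refine tendsto_nhds_unique ((hc.tendsto g).comp hGlim) ?_
  have h4 : Tendsto (fun n => pairing (hkm.toLp _) (G n)) atTop (𝓝 (pairing (hkm.toLp _) g)) := by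
    rw [tendsto_iff_norm_sub_tendsto_zero]
    have h5 : ∀ n, ‖pairing (hkm.toLp _) (G n) - pairing (hkm.toLp _) g‖ ≤
        ‖hkm.toLp _‖ * ‖G n - g‖ := by
      intro n
      have h6 := pairing_add_right (hkm.toLp _) (G n - g) g
      rw [sub_add_cancel] at h6
      rw [h6, add_sub_cancel_right]
      exact norm_pairing_le _ _
    refine squeeze_zero (fun n => norm_nonneg _) h5 ?_
    have := (tendsto_iff_norm_sub_tendsto_zero.1 hGlim).const_mul ‖hkm.toLp _‖
    rwa [mul_zero] at this
  exact h4.congr fun n => (hGeq n).symm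

/-- A weak* continuous operator on `L^∞` has a preadjoint: `f ↦ ⟨T f, g⟩` is weak* continuous,
hence a finite linear combination of the functionals `⟨·, g_i⟩`. -/
theorem exists_preadjoint {T : Lp ℂ ∞ μ →ₗ[ℂ] Lp ℂ ∞ μ} (hT : Continuous[weakStar μ, weakStar μ] T)
    (g : Lp ℂ 1 μ) : ∃ g', ∀ f, pairing (T f) g = pairing f g' := by
  let Φ : Lp ℂ ∞ μ → Lp ℂ 1 μ → ℂ := fun f g => pairing f g
  have h0 : ∀ g, Φ 0 g = 0 := fun g => (pairingL g).map_zero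
  have h1 : Tendsto T (comap Φ (𝓝 (Φ 0))) (comap Φ (𝓝 (Φ (T 0)))) := by
    have := @Continuous.tendsto _ _ (weakStar μ) (weakStar μ) _ hT 0
    rwa [nhds_induced, nhds_induced] at this
  have h2 : Tendsto (fun f => pairing (T f) g) (comap Φ (𝓝 (Φ 0))) (𝓝 0) := by
    have := (tendsto_pi_nhds.1 (tendsto_comap_iff.1 h1)) g
    rwa [map_zero, h0] at this
  have h3 := h2 (Metric.ball_mem_nhds 0 zero_lt_one)
  obtain ⟨V, hV, hVs⟩ := mem_comap.1 h3
  rw [nhds_pi, Filter.mem_pi] at hV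
  obtain ⟨I, hI, t, ht, hts⟩ := hV
  have hker : ∀ f, (∀ i ∈ I, pairing f i = 0) → pairing (T f) g = 0 := by
    intro f hf
    have h4 : ∀ n : ℕ, n * ‖pairing (T f) g‖ < 1 := by
      intro n
      have h5 : ((n : ℂ) • f) ∈ Φ ⁻¹' V := by
        refine hts fun i hi => ?_
        have : Φ ((n : ℂ) • f) i = Φ 0 i := by
          rw [h0]; change pairing _ _ = 0; rw [pairing_smul, hf i hi, mul_zero]
        rw [this]
        exact mem_of_mem_nhds (ht i)
      have h6 := hVs h5
      rw [mem_preimage, map_smul, pairing_smul, mem_ball_zero_iff, norm_mul,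
        Complex.norm_natCast] at h6
      exact h6
    by_contra hne
    obtain ⟨n, hn⟩ := exists_nat_gt (1 / ‖pairing (T f) g‖)
    have h7 := (div_lt_iff₀ (norm_pos_iff.2 hne)).1 hn
    exact absurd (h4 n) h7.le.not_gt
  have : Finite I := hI
  have hspan : (pairingL g) ∘ₗ T ∈
      Submodule.span ℂ (range fun i : I => pairingL (i : Lp ℂ 1 μ)) := by
    refine mem_span_of_iInf_ker_le_ker fun f hf => ?_
    rw [Submodule.mem_iInf] at hf
    exact hker f fun i hi => hf ⟨i, hi⟩
  have hrep : ∀ K ∈ Submodule.span ℂ (range fun i : I => pairingL (i : Lp ℂ 1 μ)),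
      ∃ g', K = pairingL g' := by
    intro K hK
    induction hK using Submodule.span_induction with
    | mem K h => obtain ⟨i, rfl⟩ := h; exact ⟨i, rfl⟩
    | zero =>
      refine ⟨(0 : ℂ) • g, LinearMap.ext fun f => ?_⟩
      change 0 = pairing f ((0 : ℂ) • g)
      rw [pairing_smul_right, map_zero, zero_mul]
    | add K K' _ _ h h' =>
      obtain ⟨a, rfl⟩ := h
      obtain ⟨b, rfl⟩ := h'
      exact ⟨a + b, LinearMap.ext fun f => (pairing_add_right f a b).symm⟩
    | smul c K _ h =>
      obtain ⟨a, rfl⟩ := h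
      refine ⟨(starRingEnd ℂ) c • a, LinearMap.ext fun f => ?_⟩
      change c * pairing f a = pairing f ((starRingEnd ℂ) c • a)
      rw [pairing_smul_right, Complex.conj_conj]
  obtain ⟨g', hg'⟩ := hrep _ hspan
  exact ⟨g', fun f => DFunLike.congr_fun hg' f⟩

theorem continuous_weakStar_of_preadjoint {T : Lp ℂ ∞ μ →ₗ[ℂ] Lp ℂ ∞ μ}
    (h : ∀ g, ∃ g', ∀ f, pairing (T f) g = pairing f g') :
    Continuous[weakStar μ, weakStar μ] T := by
  refine continuous_induced_rng.2 ?_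
  refine @continuous_pi _ _ _ (weakStar μ) _ _ fun g => ?_
  obtain ⟨g', hg'⟩ := h g
  have : (fun f => pairing (T f) g) = (fun Ψ : Lp ℂ 1 μ → ℂ => Ψ g') ∘ fun f g => pairing f g :=
    funext hg'
  change @Continuous _ _ (weakStar μ) _ fun f => pairing (T f) g
  rw [this]
  exact @Continuous.comp _ _ _ (weakStar μ) _ _ _ _ (continuous_apply g') continuous_induced_dom

/-! ### Positive operators and the Kadison–Schwarz inequality -/

/-- `Re a ≤ Re b` almost everywhere. On real functions this is the order of `L^∞`. -/
def ReLe (a b : Lp ℂ ∞ μ) : Prop := ∀ᵐ x ∂μ, (a x).re ≤ (b x).re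

/-- Positive operators on `L^∞`. -/
def PosOp (Q : Lp ℂ ∞ μ →ₗ[ℂ] Lp ℂ ∞ μ) : Prop := ∀ f, IsNonneg f → IsNonneg (Q f)

theorem ReLe.refl (a : Lp ℂ ∞ μ) : ReLe a a := Eventually.of_forall fun _ => le_rfl

theorem ReLe.trans {a b c : Lp ℂ ∞ μ} (h : ReLe a b) (h' : ReLe b c) : ReLe a c := by
  filter_upwards [h, h'] with x h1 h2 using h1.trans h2

theorem isNonneg_constL {c : ℝ} (hc : 0 ≤ c) : IsNonneg (constL μ c) := by
  filter_upwards [coeFn_constL (μ := μ) (c : ℂ)] with x hx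
  rw [hx]
  exact ⟨hc, Complex.ofReal_im c⟩

theorem IsNonneg.add {a b : Lp ℂ ∞ μ} (ha : IsNonneg a) (hb : IsNonneg b) : IsNonneg (a + b) := by
  filter_upwards [ha, hb, Lp.coeFn_add a b] with x h1 h2 h3
  rw [h3]
  simp [h1.2, h2.2, add_nonneg h1.1 h2.1]

theorem IsNonneg.reLe_zero {a : Lp ℂ ∞ μ} (ha : IsNonneg a) : ReLe 0 a := by
  filter_upwards [ha, Lp.coeFn_zero ℂ ∞ μ] with x h1 h2
  rw [h2]
  exact h1.1

theorem PosOp.im_eq_zero {Q : Lp ℂ ∞ μ →ₗ[ℂ] Lp ℂ ∞ μ} (hQ : PosOp Q) {f : Lp ℂ ∞ μ}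
    (hf : ∀ᵐ x ∂μ, (f x).im = 0) : ∀ᵐ x ∂μ, (Q f x).im = 0 := by
  have h1 : IsNonneg (f + constL μ (‖f‖ : ℝ)) := by
    filter_upwards [hf, ae_norm_le f, coeFn_constL (μ := μ) ((‖f‖ : ℝ) : ℂ),
      Lp.coeFn_add f (constL μ (‖f‖ : ℝ))] with x h1 h2 h3 h4
    rw [h4, Pi.add_apply, h3]
    have := (abs_le.1 ((Complex.abs_re_le_norm (f x)).trans h2)).1
    simp only [Complex.add_re, Complex.ofReal_re, Complex.add_im, Complex.ofReal_im, h1, add_zero,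
      and_true]
    linarith
  have h2 := hQ _ h1
  have h3 := hQ _ (isNonneg_constL (μ := μ) (norm_nonneg f))
  rw [map_add] at h2
  filter_upwards [h2, h3, Lp.coeFn_add (Q f) (Q (constL μ (‖f‖ : ℝ)))] with x h4 h5 h6
  rw [h6, Pi.add_apply, Complex.add_im, h5.2] at h4
  simpa using h4.2

theorem PosOp.re_eq_zero {Q : Lp ℂ ∞ μ →ₗ[ℂ] Lp ℂ ∞ μ} (hQ : PosOp Q) {f : Lp ℂ ∞ μ}
    (hf : ∀ᵐ x ∂μ, (f x).re = 0) : ∀ᵐ x ∂μ, (Q f x).re = 0 := by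
  have h1 := hQ.im_eq_zero (f := Complex.I • f) (by
    filter_upwards [hf, Lp.coeFn_smul Complex.I f] with x h1 h2
    rw [h2]; simp [h1])
  rw [map_smul] at h1
  filter_upwards [h1, Lp.coeFn_smul Complex.I (Q f)] with x h2 h3
  rw [h3] at h2
  simpa using h2

theorem memLp_re (f : Lp ℂ ∞ μ) : MemLp (fun x => ((f x).re : ℂ)) ∞ μ := by
  refine memLp_top_of_bound (Complex.continuous_ofReal.comp_aestronglyMeasurable
    (Complex.continuous_re.comp_aestronglyMeasurable (Lp.aestronglyMeasurable f))) ‖f‖ ?_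
  filter_upwards [ae_norm_le f] with x hx
  rw [Complex.norm_real]
  exact (Complex.abs_re_le_norm _).trans hx

theorem PosOp.mono {Q : Lp ℂ ∞ μ →ₗ[ℂ] Lp ℂ ∞ μ} (hQ : PosOp Q) {a b : Lp ℂ ∞ μ}
    (h : ReLe a b) : ReLe (Q a) (Q b) := by
  have hr := (memLp_re (b - a)).coeFn_toLp
  set r : Lp ℂ ∞ μ := (memLp_re (b - a)).toLp _
  have h1 : IsNonneg r := by
    filter_upwards [hr, h, Lp.coeFn_sub b a] with x h1 h2 h3
    rw [h1, h3]
    simpa using h2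
  have h2 : ∀ᵐ x ∂μ, ((b - a - r : Lp ℂ ∞ μ) x).re = 0 := by
    filter_upwards [hr, Lp.coeFn_sub (b - a) r] with x h1 h2
    rw [h2, Pi.sub_apply, h1]
    simp
  have h3 := hQ.re_eq_zero h2
  rw [map_sub, map_sub] at h3
  filter_upwards [h3, hQ _ h1, Lp.coeFn_sub (Q b - Q a) (Q r), Lp.coeFn_sub (Q b) (Q a)]
    with x h4 h5 h6 h7
  rw [h6, Pi.sub_apply, h7, Pi.sub_apply, Complex.sub_re, Complex.sub_re] at h4
  linarith [h5.1]

theorem PosOp.re_mulConj_comm {Q : Lp ℂ ∞ μ →ₗ[ℂ] Lp ℂ ∞ μ} (hQ : PosOp Q) (f h : Lp ℂ ∞ μ) :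
    ∀ᵐ x ∂μ, (Q (mulConj f h) x).re = (Q (mulConj h f) x).re := by
  have h1 := hQ.re_eq_zero (f := mulConj f h - mulConj h f) (by
    filter_upwards [coeFn_mulConj f h, coeFn_mulConj h f,
      Lp.coeFn_sub (mulConj f h) (mulConj h f)] with x h1 h2 h3
    rw [h3, Pi.sub_apply, h1, h2]
    simp only [Complex.sub_re, Complex.mul_re, Complex.conj_re, Complex.conj_im]
    ring)
  rw [map_sub] at h1
  filter_upwards [h1, Lp.coeFn_sub (Q (mulConj f h)) (Q (mulConj h f))] with x h2 h3
  rw [h3, Pi.sub_apply, Complex.sub_re] at h2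
  linarith

/-- The Kadison–Schwarz inequality `|Q f|^2 ≤ m Q |f|^2` for a positive operator with `Q 1 ≤ m`:
expand `Q |f - z|^2 ≥ 0` for all `z` in a countable dense set. -/
theorem PosOp.kadison_schwarz {Q : Lp ℂ ∞ μ →ₗ[ℂ] Lp ℂ ∞ μ} (hQ : PosOp Q) {m : ℝ} (hm : 0 < m)
    (h1 : ReLe (Q (constL μ 1)) (constL μ m)) (f : Lp ℂ ∞ μ) :
    ∀ᵐ x ∂μ, ‖Q f x‖ ^ 2 ≤ m * (Q (absSq f) x).re := by
  have hz : ∀ z : ℂ, ∀ᵐ x ∂μ, 0 ≤ (Q (absSq f) x).re - 2 * ((starRingEnd ℂ) z * Q f x).re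
      + ‖z‖ ^ 2 * m := by
    intro z
    have e1 := hQ.re_eq_zero (f := absSq f + ((‖z‖ ^ 2 : ℝ) : ℂ) • constL μ 1
        - absSq (f - constL μ z) - (2 * (starRingEnd ℂ) z) • f) (by
      filter_upwards [coeFn_absSq f, coeFn_absSq (f - constL μ z), Lp.coeFn_sub f (constL μ z),
        coeFn_constL (μ := μ) z, coeFn_constL (μ := μ) 1,
        Lp.coeFn_smul ((‖z‖ ^ 2 : ℝ) : ℂ) (constL μ 1), Lp.coeFn_smul (2 * (starRingEnd ℂ) z) f,
        Lp.coeFn_add (absSq f) (((‖z‖ ^ 2 : ℝ) : ℂ) • constL μ 1),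
        Lp.coeFn_sub (absSq f + ((‖z‖ ^ 2 : ℝ) : ℂ) • constL μ 1) (absSq (f - constL μ z)),
        Lp.coeFn_sub (absSq f + ((‖z‖ ^ 2 : ℝ) : ℂ) • constL μ 1 - absSq (f - constL μ z))
          ((2 * (starRingEnd ℂ) z) • f)] with x a1 a2 a3 a4 a5 a6 a7 a8 a9 a10
      rw [a10, Pi.sub_apply, a9, Pi.sub_apply, a8, Pi.add_apply, a7, a6, a1, a2, a3, Pi.smul_apply,
        Pi.smul_apply, a5, Pi.sub_apply, a4]
      simp only [← Complex.normSq_eq_norm_sq, Complex.normSq_apply, smul_eq_mul, mul_one,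
        Complex.sub_re, Complex.add_re, Complex.ofReal_re, Complex.mul_re, Complex.sub_im,
        Complex.conj_re, Complex.conj_im, Complex.mul_im, Complex.re_ofNat, Complex.im_ofNat]
      ring)
    rw [map_sub, map_sub, map_add, map_smul, map_smul] at e1
    filter_upwards [e1, hQ _ (isNonneg_absSq (f - constL μ z)), h1, coeFn_constL (μ := μ) (m : ℂ),
      Lp.coeFn_smul ((‖z‖ ^ 2 : ℝ) : ℂ) (Q (constL μ 1)),
      Lp.coeFn_smul (2 * (starRingEnd ℂ) z) (Q f),
      Lp.coeFn_add (Q (absSq f)) (((‖z‖ ^ 2 : ℝ) : ℂ) • Q (constL μ 1)),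
      Lp.coeFn_sub (Q (absSq f) + ((‖z‖ ^ 2 : ℝ) : ℂ) • Q (constL μ 1))
        (Q (absSq (f - constL μ z))),
      Lp.coeFn_sub (Q (absSq f) + ((‖z‖ ^ 2 : ℝ) : ℂ) • Q (constL μ 1)
        - Q (absSq (f - constL μ z))) ((2 * (starRingEnd ℂ) z) • Q f)]
      with x a0 a1 a2 a3 a4 a5 a6 a7 a8
    rw [a8, Pi.sub_apply, a7, Pi.sub_apply, a6, Pi.add_apply, a5, a4, Pi.smul_apply,
      Pi.smul_apply, smul_eq_mul, smul_eq_mul, mul_assoc] at a0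
    rw [a3, Complex.ofReal_re] at a2
    simp only [Complex.sub_re, Complex.add_re, Complex.re_ofReal_mul] at a0
    have a9 : (2 * ((starRingEnd ℂ) z * Q f x)).re = 2 * ((starRingEnd ℂ) z * Q f x).re := by
      rw [show (2 : ℂ) = ((2 : ℝ) : ℂ) by norm_num, Complex.re_ofReal_mul]
    rw [a9] at a0
    have := mul_le_mul_of_nonneg_left a2 (sq_nonneg ‖z‖)
    linarith [a1.1]
  filter_upwards [ae_all_iff.2 fun n => hz (TopologicalSpace.denseSeq ℂ n)] with x hx
  have hall : ∀ z : ℂ, 0 ≤ (Q (absSq f) x).re - 2 * ((starRingEnd ℂ) z * Q f x).re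
      + ‖z‖ ^ 2 * m := by
    intro z
    refine (TopologicalSpace.denseRange_denseSeq ℂ).induction_on (p := fun z => 0 ≤
      (Q (absSq f) x).re - 2 * ((starRingEnd ℂ) z * Q f x).re + ‖z‖ ^ 2 * m) z ?_ hx
    refine isClosed_le continuous_const ?_
    have := Complex.continuous_conj
    have h2 := Complex.continuous_re
    fun_prop
  have h3 := hall ((m⁻¹ : ℝ) * Q f x)
  rw [map_mul, Complex.conj_ofReal, mul_assoc, Complex.re_ofReal_mul, mul_comm _ (Q f x),
    Complex.mul_conj, Complex.normSq_eq_norm_sq, Complex.ofReal_re, norm_mul, Complex.norm_real,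
    Real.norm_of_nonneg (inv_nonneg.2 hm.le)] at h3
  have h4 : (m⁻¹ * ‖Q f x‖) ^ 2 * m = m⁻¹ * ‖Q f x‖ ^ 2 := by field_simp
  rw [h4] at h3
  have h5 : m⁻¹ * ‖Q f x‖ ^ 2 ≤ (Q (absSq f) x).re := by linarith
  rwa [inv_mul_le_iff₀ hm] at h5

/-! ### Averages of a semigroup and the subordinated semigroups -/

/-- The real part of the pairing, as a real linear functional. -/
def rePairing (g : Lp ℂ 1 μ) : Lp ℂ ∞ μ →ₗ[ℝ] ℝ :=
  Complex.reLm ∘ₗ (pairingL g).restrictScalars ℝ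

theorem rePairing_apply (g : Lp ℂ 1 μ) (a : Lp ℂ ∞ μ) : rePairing g a = (pairing a g).re := rfl

theorem measurable_of_rightContinuous {φ : ℝ → ℂ} (h : ∀ v, ContinuousWithinAt φ (Ioi v) v) :
    Measurable φ := by
  let u : ℕ → ℝ → ℝ := fun n v => ((⌊v * (n + 1)⌋ : ℤ) + 1 : ℝ) / (n + 1)
  have hu : ∀ n v, v < u n v ∧ u n v ≤ v + 1 / ((n : ℝ) + 1) := by
    intro n v
    have hn : (0 : ℝ) < n + 1 := by positivity
    constructor
    · rw [lt_div_iff₀ hn]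
      exact Int.lt_floor_add_one _
    · rw [div_le_iff₀ hn, add_mul, one_div, inv_mul_cancel₀ hn.ne']
      gcongr
      exact Int.floor_le _
  refine measurable_of_tendsto_metrizable (f := fun n v => φ (u n v)) (fun n => ?_) ?_
  · have h1 : Measurable fun k : ℤ => φ (((k : ℝ) + 1) / (n + 1)) := measurable_from_top
    have h2 : Measurable fun v : ℝ => ⌊v * ((n : ℝ) + 1)⌋ :=
      Int.measurable_floor.comp (measurable_id.mul_const _)
    exact h1.comp h2
  · refine tendsto_pi_nhds.2 fun v => (h v).tendsto.comp (tendsto_nhdsWithin_iff.2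
      ⟨?_, Eventually.of_forall fun n => (hu n v).1⟩)
    refine tendsto_of_tendsto_of_tendsto_of_le_of_le tendsto_const_nhds ?_
      (fun n => (hu n v).1.le) fun n => (hu n v).2
    have := (tendsto_one_div_add_atTop_nhds_zero_nat (𝕜 := ℝ)).const_add v
    rwa [add_zero] at this

namespace PositiveContractionSemigroup

variable (S : PositiveContractionSemigroup μ)

/-- The semigroup extended by the identity to negative times. -/
def op (v : ℝ) : Lp ℂ ∞ μ →ₗ[ℂ] Lp ℂ ∞ μ := S.T (max v 0)

theorem op_of_nonneg {v : ℝ} (hv : 0 ≤ v) : S.op v = S.T v := by rw [op, max_eq_left hv]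

theorem norm_op_le (v : ℝ) (f : Lp ℂ ∞ μ) : ‖S.op v f‖ ≤ ‖f‖ :=
  S.contractive _ (le_max_right _ _) f

theorem posOp_op (v : ℝ) : PosOp (S.op v) := S.positive _ (le_max_right _ _)

theorem op_zero (f : Lp ℂ ∞ μ) : S.op 0 f = f := by rw [S.op_of_nonneg le_rfl, S.zero]

theorem op_add {s t : ℝ} (hs : 0 ≤ s) (ht : 0 ≤ t) (f : Lp ℂ ∞ μ) :
    S.op (s + t) f = S.op s (S.op t f) := by
  rw [S.op_of_nonneg hs, S.op_of_nonneg ht, S.op_of_nonneg (add_nonneg hs ht), S.add s t hs ht]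

theorem exists_preadjoint_op (v : ℝ) (g : Lp ℂ 1 μ) :
    ∃ g', ∀ f, pairing (S.op v f) g = pairing f g' :=
  exists_preadjoint (S.normal _ (le_max_right _ _)) g

theorem continuousWithinAt_pairing_op (f : Lp ℂ ∞ μ) (g : Lp ℂ 1 μ) (v : ℝ) :
    ContinuousWithinAt (fun v => pairing (S.op v f) g) (Ioi v) v := by
  rcases lt_or_ge v 0 with hv | hv
  · refine ContinuousAt.continuousWithinAt (f := fun v => pairing (S.op v f) g) ?_
    refine (continuousAt_const (y := pairing (S.op v f) g)).congr ?_
    filter_upwards [Iio_mem_nhds hv] with w hw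
    rw [op, op, max_eq_right hv.le, max_eq_right (le_of_lt hw)]
  · obtain ⟨g', hg'⟩ := S.exists_preadjoint_op v g
    have h1 : Tendsto (fun w => w - v) (𝓝[>] v) (𝓝[>] 0) := by
      refine tendsto_nhdsWithin_iff.2 ⟨?_, ?_⟩
      · have : Tendsto (fun w => w - v) (𝓝 v) (𝓝 (v - v)) :=
          (continuous_id.sub continuous_const).tendsto v
        rw [sub_self] at this
        exact this.mono_left nhdsWithin_le_nhds
      · filter_upwards [self_mem_nhdsWithin] with w hw using mem_Ioi.2 (sub_pos.2 (mem_Ioi.1 hw))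
    have h2 := (S.tendsto_zero f g').comp h1
    rw [← hg'] at h2
    refine h2.congr' ?_
    filter_upwards [self_mem_nhdsWithin] with w hw
    have hw' : 0 ≤ w - v := (sub_pos.2 (mem_Ioi.1 hw)).le
    rw [Function.comp_apply, ← S.op_of_nonneg hw', ← hg', ← S.op_add hv hw', add_sub_cancel]

theorem measurable_pairing_op (f : Lp ℂ ∞ μ) (g : Lp ℂ 1 μ) :
    Measurable fun v => pairing (S.op v f) g :=
  measurable_of_rightContinuous (S.continuousWithinAt_pairing_op f g)

theorem norm_pairing_op_le (f : Lp ℂ ∞ μ) (g : Lp ℂ 1 μ) (v : ℝ) :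
    ‖pairing (S.op v f) g‖ ≤ ‖f‖ * ‖g‖ :=
  (norm_pairing_le _ _).trans (mul_le_mul_of_nonneg_right (S.norm_op_le v f) (norm_nonneg _))

theorem integrable_pairing_op (ν : Measure ℝ) [IsFiniteMeasure ν] (f : Lp ℂ ∞ μ) (g : Lp ℂ 1 μ) :
    Integrable (fun v => pairing (S.op v f) g) ν :=
  Integrable.of_bound (S.measurable_pairing_op f g).aestronglyMeasurable (‖f‖ * ‖g‖)
    (Eventually.of_forall (S.norm_pairing_op_le f g))

theorem integrable_rePairing_op (ν : Measure ℝ) [IsFiniteMeasure ν] (f : Lp ℂ ∞ μ)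
    (g : Lp ℂ 1 μ) : Integrable (fun v => rePairing g (S.op v f)) ν :=
  (S.integrable_pairing_op ν f g).re

variable [SigmaFinite μ]

theorem exists_avg (ν : Measure ℝ) [IsFiniteMeasure ν] (f : Lp ℂ ∞ μ) :
    ∃ k : Lp ℂ ∞ μ, ‖k‖ ≤ ‖f‖ * ν.real univ ∧
      ∀ g, pairing k g = ∫ v, pairing (S.op v f) g ∂ν := by
  let ℓ : Lp ℂ 1 μ →ₗ⋆[ℂ] ℂ :=
    { toFun := fun g => ∫ v, pairing (S.op v f) g ∂ν
      map_add' := fun g g' => by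
        simp_rw [pairing_add_right]
        exact integral_add (S.integrable_pairing_op ν f g) (S.integrable_pairing_op ν f g')
      map_smul' := fun c g => by
        simp_rw [pairing_smul_right]
        rw [integral_const_mul, smul_eq_mul] }
  obtain ⟨k, hk, hk'⟩ := exists_Linf_of_functional ℓ (C := ‖f‖ * ν.real univ) (by positivity)
    fun g => (norm_integral_le_of_norm_le_const
      (Eventually.of_forall (S.norm_pairing_op_le f g))).trans (le_of_eq (by ring))
  exact ⟨k, hk, fun g => (hk' g).symm⟩

/-- The weak* average `∫ T_v f dν(v)` of the semigroup. -/
def avg (ν : Measure ℝ) [IsFiniteMeasure ν] : Lp ℂ ∞ μ →ₗ[ℂ] Lp ℂ ∞ μ where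
  toFun f := (S.exists_avg ν f).choose
  map_add' f f' := ext_pairing fun g => by
    rw [pairing_add, (S.exists_avg ν _).choose_spec.2, (S.exists_avg ν f).choose_spec.2,
      (S.exists_avg ν f').choose_spec.2,
      ← integral_add (S.integrable_pairing_op ν f g) (S.integrable_pairing_op ν f' g)]
    simp_rw [map_add, pairing_add]
  map_smul' c f := ext_pairing fun g => by
    rw [RingHom.id_apply, pairing_smul, (S.exists_avg ν _).choose_spec.2,
      (S.exists_avg ν f).choose_spec.2, ← integral_const_mul]
    simp_rw [map_smul, pairing_smul]

theorem pairing_avg (ν : Measure ℝ) [IsFiniteMeasure ν] (f : Lp ℂ ∞ μ) (g : Lp ℂ 1 μ) :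
    pairing (S.avg ν f) g = ∫ v, pairing (S.op v f) g ∂ν := (S.exists_avg ν f).choose_spec.2 g

theorem norm_avg_le (ν : Measure ℝ) [IsProbabilityMeasure ν] (f : Lp ℂ ∞ μ) :
    ‖S.avg ν f‖ ≤ ‖f‖ := by
  refine (S.exists_avg ν f).choose_spec.1.trans (le_of_eq ?_)
  rw [probReal_univ, mul_one]

theorem rePairing_avg (ν : Measure ℝ) [IsFiniteMeasure ν] (f : Lp ℂ ∞ μ) (g : Lp ℂ 1 μ) :
    rePairing g (S.avg ν f) = ∫ v, rePairing g (S.op v f) ∂ν := by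
  rw [rePairing_apply, S.pairing_avg]
  exact (integral_re (S.integrable_pairing_op ν f g)).symm

theorem posOp_avg (ν : Measure ℝ) [IsFiniteMeasure ν] : PosOp (S.avg ν) := by
  refine fun f hf => isNonneg_of_pairing fun g hg => ⟨?_, ?_⟩
  · rw [← rePairing_apply, S.rePairing_avg]
    exact integral_nonneg fun v => ((S.posOp_op v f hf).pairing_nonneg hg).1
  · rw [S.pairing_avg]
    refine (integral_im (S.integrable_pairing_op ν f g)).symm.trans ?_
    exact integral_eq_zero_of_ae (Eventually.of_forall fun v =>
      ((S.posOp_op v f hf).pairing_nonneg hg).2)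

theorem exists_preadjoint_avg (ν : Measure ℝ) [IsFiniteMeasure ν] (g : Lp ℂ 1 μ) :
    ∃ g', ∀ f, pairing (S.avg ν f) g = pairing f g' := by
  refine SeqNormal.exists_L1 (Λ := pairingL g ∘ₗ S.avg ν) fun F h C hC hlim => ?_
  change Tendsto (fun n => pairing (S.avg ν (F n)) g) atTop (𝓝 (pairing (S.avg ν h) g))
  simp_rw [S.pairing_avg]
  refine tendsto_integral_of_dominated_convergence (fun _ => C * ‖g‖)
    (fun n => (S.measurable_pairing_op (F n) g).aestronglyMeasurable) (integrable_const _)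
    (fun n => Eventually.of_forall fun v => (S.norm_pairing_op_le (F n) g v).trans
      (mul_le_mul_of_nonneg_right (hC n) (norm_nonneg _))) (Eventually.of_forall fun v => ?_)
  obtain ⟨g', hg'⟩ := S.exists_preadjoint_op v g
  simp_rw [hg']
  exact seqNormal_pairingL g' F h C hC hlim

theorem avg_dirac {v : ℝ} (f : Lp ℂ ∞ μ) : S.avg (Measure.dirac v) f = S.op v f :=
  ext_pairing fun g => by rw [S.pairing_avg, integral_dirac]

theorem op_avg {u : ℝ} (hu : 0 ≤ u) (ν : Measure ℝ) [IsFiniteMeasure ν] (hν : ∀ᵐ v ∂ν, 0 ≤ v)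
    (f : Lp ℂ ∞ μ) (g : Lp ℂ 1 μ) :
    pairing (S.op u (S.avg ν f)) g = ∫ v, pairing (S.op (u + v) f) g ∂ν := by
  obtain ⟨g', hg'⟩ := S.exists_preadjoint_op u g
  rw [hg', S.pairing_avg]
  refine integral_congr_ae ?_
  filter_upwards [hν] with v hv
  rw [← hg', S.op_add hu hv]

theorem avg_avg (ν ν' : Measure ℝ) [IsFiniteMeasure ν] [IsFiniteMeasure ν']
    [IsFiniteMeasure (ν.conv ν')] (hν : ∀ᵐ v ∂ν, 0 ≤ v) (hν' : ∀ᵐ v ∂ν', 0 ≤ v)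
    (f : Lp ℂ ∞ μ) : S.avg ν (S.avg ν' f) = S.avg (ν.conv ν') f := by
  refine ext_pairing fun g => ?_
  rw [S.pairing_avg, S.pairing_avg, integral_conv (S.integrable_pairing_op _ f g)]
  refine integral_congr_ae ?_
  filter_upwards [hν] with u hu using S.op_avg hu ν' hν' f g

/-- The semigroup `(T_{t,α})_{t ≥ 0}` subordinated to `(T_t)`, for `0 < α ≤ 1`. -/
def subord {α : ℝ} (h0 : 0 < α) (h1 : α ≤ 1) : PositiveContractionSemigroup μ where
  T t := haveI := isProbabilityMeasure_stableMeasure t h0 h1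
    S.avg (stableMeasure t α)
  positive t _ := haveI := isProbabilityMeasure_stableMeasure t h0 h1
    S.posOp_avg _
  contractive t _ := haveI := isProbabilityMeasure_stableMeasure t h0 h1
    S.norm_avg_le _
  normal t _ := haveI := isProbabilityMeasure_stableMeasure t h0 h1
    continuous_weakStar_of_preadjoint (S.exists_preadjoint_avg _)
  zero f := by
    have := isProbabilityMeasure_stableMeasure 0 h0 h1
    have h : ∀ ν : Measure ℝ, ∀ [IsProbabilityMeasure ν], ν = Measure.dirac 0 → S.avg ν f = f := by
      rintro ν _ rfl
      rw [S.avg_dirac, S.op_zero]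
    exact h _ (stableMeasure_zero α)
  add s t hs ht f := by
    have := isProbabilityMeasure_stableMeasure s h0 h1
    have := isProbabilityMeasure_stableMeasure t h0 h1
    have := isProbabilityMeasure_stableMeasure (s + t) h0 h1
    refine ext_pairing fun g => ?_
    rw [S.avg_avg _ _ (ae_nonneg_stableMeasure s α) (ae_nonneg_stableMeasure t α), S.pairing_avg,
      S.pairing_avg, conv_stableMeasure hs ht h0 h1]
  tendsto_zero f g := by
    have := isProbabilityMeasure_stableMeasure 1 h0 h1
    have hp : Tendsto (fun t : ℝ => t ^ (1 / α)) (𝓝[>] 0) (𝓝 0) := by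
      have : ContinuousAt (fun t : ℝ => t ^ (1 / α)) 0 :=
        Real.continuousAt_rpow_const _ _ (Or.inr (by positivity))
      have h2 := this.tendsto
      rw [Real.zero_rpow (by positivity)] at h2
      exact h2.mono_left nhdsWithin_le_nhds
    have h2 : Tendsto (fun t : ℝ => ∫ v, pairing (S.op (t ^ (1 / α) * v) f) g ∂stableMeasure 1 α)
        (𝓝[>] 0) (𝓝 (∫ _v, pairing f g ∂stableMeasure 1 α)) := by
      refine tendsto_integral_filter_of_dominated_convergence (fun _ => ‖f‖ * ‖g‖)
        (Eventually.of_forall fun t => ((S.measurable_pairing_op f g).comp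
          (measurable_const_mul _)).aestronglyMeasurable)
        (Eventually.of_forall fun t => Eventually.of_forall fun v => S.norm_pairing_op_le f g _)
        (integrable_const _) ?_
      filter_upwards [ae_nonneg_stableMeasure 1 α] with v hv
      rcases hv.eq_or_lt with rfl | hv
      · simp_rw [mul_zero, S.op_zero]
        exact tendsto_const_nhds
      · have h3 := (S.continuousWithinAt_pairing_op f g 0).tendsto
        rw [S.op_zero] at h3
        refine h3.comp (tendsto_nhdsWithin_iff.2 ⟨?_, ?_⟩)
        · have := hp.mul_const v
          rwa [zero_mul] at this
        · filter_upwards [self_mem_nhdsWithin] with t ht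
          exact mul_pos (Real.rpow_pos_of_pos ht _) hv
    rw [integral_const, probReal_univ, one_smul] at h2
    refine h2.congr' ?_
    filter_upwards [self_mem_nhdsWithin] with t ht
    have := isProbabilityMeasure_stableMeasure t h0 h1
    have ht' : (0 : ℝ) < t := ht
    have h4 := map_mul_stableMeasure zero_le_one h0 h1 (Real.rpow_pos_of_pos ht' (1 / α))
    rw [← Real.rpow_mul ht'.le, one_div_mul_cancel h0.ne', Real.rpow_one, mul_one] at h4
    rw [S.pairing_avg, ← h4, integral_map (measurable_const_mul _).aemeasurable
      (S.measurable_pairing_op f g).aestronglyMeasurable]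

theorem pairing_frac {α t : ℝ} (h0 : 0 < α) (h1 : α ≤ 1) (ht : 0 < t) (f : Lp ℂ ∞ μ)
    (g : Lp ℂ 1 μ) :
    pairing (S.frac α t f) g = ∫ v, pairing (S.op v f) g ∂stableMeasure t α := by
  rcases h1.eq_or_lt with rfl | h1
  · rw [stableMeasure_one ht.le, integral_dirac, frac, if_pos rfl, S.op_of_nonneg ht.le]
  have := isProbabilityMeasure_stableMeasure t h0 h1.le
  have key : IsWeakStarIntegral (stableDensity t α) (fun v => S.T v f)
      (S.avg (stableMeasure t α) f) := by
    intro g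
    have hc : EqOn (fun v => (stableDensity t α v : ℂ) * pairing (S.op v f) g)
        (fun v => (stableDensity t α v : ℂ) * pairing (S.T v f) g) (Ioi 0) := fun v hv => by
      simp only [S.op_of_nonneg (le_of_lt hv)]
    refine ⟨((integrable_stableMeasure_iff ht h0 h1 _).1
      (S.integrable_pairing_op _ f g)).congr_fun hc measurableSet_Ioi, ?_⟩
    rw [S.pairing_avg, integral_stableMeasure ht h0 h1]
    simp_rw [Complex.real_smul]
    exact setIntegral_congr_fun measurableSet_Ioi hc
  have hex : ∃ k, IsWeakStarIntegral (stableDensity t α) (fun v => S.T v f) k := ⟨_, key⟩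
  rw [frac, if_neg h1.ne, weakStarIntegral, dif_pos hex, (hex.choose_spec g).2, ← (key g).2,
    S.pairing_avg]

theorem frac_eq_avg {α t : ℝ} (h0 : 0 < α) (h1 : α ≤ 1) (ht : 0 < t)
    [IsFiniteMeasure (stableMeasure t α)] (f : Lp ℂ ∞ μ) :
    S.frac α t f = S.avg (stableMeasure t α) f :=
  ext_pairing fun g => by rw [S.pairing_frac h0 h1 ht, S.pairing_avg]

/-- `(L^α)^γ = L^{γα}`, by the mixture formula for the stable measures. -/
theorem frac_subord {α γ t : ℝ} (h0 : 0 < α) (h1 : α ≤ 1) (hγ0 : 0 < γ) (hγ1 : γ ≤ 1) (ht : 0 < t)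
    (f : Lp ℂ ∞ μ) : (S.subord h0 h1).frac γ t f = S.frac (γ * α) t f := by
  refine ext_pairing fun g => ?_
  have hγα : γ * α ≤ 1 := mul_le_one₀ hγ1 h0.le h1
  have := isProbabilityMeasure_stableMeasure t (mul_pos hγ0 h0) hγα
  rw [pairing_frac _ hγ0 hγ1 ht, S.pairing_frac (mul_pos hγ0 h0) hγα ht]
  have := isProbabilityMeasure_stableMeasure t hγ0 hγ1
  have := isMarkovKernel_stableKernel h0 h1
  have hb := bind_stableMeasure ht.le hγ0 hγ1 h0 h1
  have hi := S.integrable_pairing_op (stableMeasure t (γ * α)) f g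
  rw [← hb] at hi ⊢
  rw [integral_bind_kernel hi]
  refine integral_congr_ae ?_
  filter_upwards [ae_nonneg_stableMeasure t γ] with s hs
  rw [op_of_nonneg _ hs]
  have := isProbabilityMeasure_stableMeasure s h0 h1
  exact S.pairing_avg _ f g

theorem bmo_subord {α γ : ℝ} (h0 : 0 < α) (h1 : α ≤ 1) (hγ0 : 0 < γ) (hγ1 : γ ≤ 1)
    (f : Lp ℂ ∞ μ) : (S.subord h0 h1).bmo γ f = S.bmo (γ * α) f := by
  refine iSup_congr fun t => iSup_congr fun ht => ?_
  rw [S.frac_subord h0 h1 hγ0 hγ1 ht, S.frac_subord h0 h1 hγ0 hγ1 ht]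

theorem BMO_subord {α γ : ℝ} (h0 : 0 < α) (h1 : α ≤ 1) (hγ0 : 0 < γ) (hγ1 : γ ≤ 1)
    (f : Lp ℂ ∞ μ) : (S.subord h0 h1).BMO γ f = S.BMO (γ * α) f := by
  refine iSup_congr fun t => iSup_congr fun ht => ?_
  rw [S.frac_subord h0 h1 hγ0 hγ1 ht, S.frac_subord h0 h1 hγ0 hγ1 ht]

end PositiveContractionSemigroup

/-! ### Order and norm estimates for positive contractions -/

theorem rePairing_mono {g : Lp ℂ 1 μ} (hg : IsNonnegL1 g) {a b : Lp ℂ ∞ μ} (h : ReLe a b) :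
    rePairing g a ≤ rePairing g b := by
  rw [rePairing_apply, rePairing_apply, re_pairing, re_pairing]
  refine integral_mono_ae (integrable_pairing a g).re (integrable_pairing b g).re ?_
  filter_upwards [h, hg] with x h1 h2
  simp only [Complex.mul_re, Complex.conj_re, Complex.conj_im, h2.2, neg_zero, mul_zero, sub_zero]
  exact mul_le_mul_of_nonneg_right h1 h2.1

theorem reLe_of_rePairing [SigmaFinite μ] {a b : Lp ℂ ∞ μ}
    (h : ∀ g, IsNonnegL1 g → rePairing g a ≤ rePairing g b) : ReLe a b := by
  have key : ∀ s, MeasurableSet s → μ s < ∞ → 0 ≤ ∫ x in s, ((b - a : Lp ℂ ∞ μ) x).re ∂μ := by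
    intro s hs hμs
    have h1 := h _ (isNonnegL1_indicator hs hμs.ne)
    rw [← sub_nonneg, ← map_sub, rePairing_apply, pairing_indicator _ hs hμs.ne] at h1
    have h2 := integral_re (integrableOn_Linf (b - a) hμs)
    simp only [RCLike.re_eq_complex_re] at h2
    rwa [h2]
  have hre := ae_nonneg_of_forall_setIntegral_nonneg_of_sigmaFinite (μ := μ)
    (f := fun x => ((b - a : Lp ℂ ∞ μ) x).re) (fun s _ hμs => (integrableOn_Linf _ hμs).re) key
  filter_upwards [hre, Lp.coeFn_sub b a] with x h1 h2
  rw [h2] at h1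
  simpa using h1

theorem rePairing_constL (g : Lp ℂ 1 μ) (K : ℝ) :
    rePairing g (constL μ K) = K * rePairing g (constL μ 1) := by
  have : constL μ (K : ℂ) = (K : ℂ) • constL μ 1 := by
    refine Lp.ext ?_
    filter_upwards [coeFn_constL (μ := μ) (K : ℂ), coeFn_constL (μ := μ) 1,
      Lp.coeFn_smul (K : ℂ) (constL μ 1)] with x h1 h2 h3
    rw [h1, h3, Pi.smul_apply, h2, smul_eq_mul, mul_one]
  rw [this, rePairing_apply, pairing_smul, Complex.re_ofReal_mul, rePairing_apply]

theorem rePairing_one_nonneg {g : Lp ℂ 1 μ} (hg : IsNonnegL1 g) : 0 ≤ rePairing g (constL μ 1) := by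
  have := (isNonneg_constL (μ := μ) zero_le_one).pairing_nonneg hg
  rw [Complex.ofReal_one] at this
  exact this.1

theorem IsNonneg.norm_le {a : Lp ℂ ∞ μ} (ha : IsNonneg a) {K : ℝ} (hK : 0 ≤ K)
    (h : ReLe a (constL μ K)) : ‖a‖ ≤ K := by
  refine norm_le_of_ae hK ?_
  filter_upwards [ha, h, coeFn_constL (μ := μ) (K : ℂ)] with x h1 h2 h3
  rw [h3, Complex.ofReal_re] at h2
  have : a x = ((a x).re : ℂ) := Complex.ext (by simp) (by simp [h1.2])
  rwa [this, Complex.norm_real, Real.norm_of_nonneg h1.1]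

theorem reLe_constL {a : Lp ℂ ∞ μ} {K : ℝ} (h : ‖a‖ ≤ K) : ReLe a (constL μ K) := by
  filter_upwards [ae_norm_le a, coeFn_constL (μ := μ) (K : ℂ)] with x h1 h2
  rw [h2, Complex.ofReal_re]
  exact (Complex.re_le_norm _).trans (h1.trans h)

theorem constL_mono {K K' : ℝ} (h : K ≤ K') : ReLe (constL μ K) (constL μ K') := by
  filter_upwards [coeFn_constL (μ := μ) (K : ℂ), coeFn_constL (μ := μ) (K' : ℂ)] with x h1 h2
  rwa [h1, h2, Complex.ofReal_re, Complex.ofReal_re]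

theorem norm_le_of_absSq {f : Lp ℂ ∞ μ} {N : ℝ} (hN : 0 ≤ N)
    (h : ReLe (absSq f) (constL μ (N ^ 2 : ℝ))) : ‖f‖ ≤ N := by
  refine norm_le_of_ae hN ?_
  filter_upwards [h, coeFn_absSq f, coeFn_constL (μ := μ) ((N ^ 2 : ℝ) : ℂ)] with x h1 h2 h3
  rw [h2, h3, Complex.ofReal_re, Complex.ofReal_re] at h1
  exact (pow_le_pow_iff_left₀ (norm_nonneg _) hN two_ne_zero).1 h1

theorem absSq_reLe {f : Lp ℂ ∞ μ} {N : ℝ} (h : ‖f‖ ≤ N) :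
    ReLe (absSq f) (constL μ (N ^ 2 : ℝ)) := by
  filter_upwards [ae_norm_le f, coeFn_absSq f, coeFn_constL (μ := μ) ((N ^ 2 : ℝ) : ℂ)]
    with x h1 h2 h3
  rw [h2, h3, Complex.ofReal_re, Complex.ofReal_re]
  gcongr
  exact h1.trans h

theorem absSq_add_reLe (f h : Lp ℂ ∞ μ) :
    ReLe (absSq (f + h)) ((2 : ℂ) • absSq f + (2 : ℂ) • absSq h) := by
  filter_upwards [coeFn_absSq f, coeFn_absSq h, coeFn_absSq (f + h), Lp.coeFn_add f h,
    Lp.coeFn_add ((2 : ℂ) • absSq f) ((2 : ℂ) • absSq h), Lp.coeFn_smul (2 : ℂ) (absSq f),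
    Lp.coeFn_smul (2 : ℂ) (absSq h)] with x h1 h2 h3 h4 h5 h6 h7
  rw [h3, h5, Pi.add_apply, h6, h7, Pi.smul_apply, Pi.smul_apply, h1, h2, h4, Pi.add_apply]
  simp only [smul_eq_mul, Complex.add_re, Complex.ofReal_re, Complex.mul_re, Complex.re_ofNat,
    Complex.im_ofNat, zero_mul, sub_zero]
  have h8 := norm_add_le (f x) (h x)
  nlinarith [sq_nonneg (‖f x‖ - ‖h x‖), norm_nonneg (f x + h x), norm_nonneg (f x),
    norm_nonneg (h x)]

/-- A positive contraction of `L^∞` with a preadjoint. -/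
structure PosContraction (P : Lp ℂ ∞ μ →ₗ[ℂ] Lp ℂ ∞ μ) : Prop where
  pos : PosOp P
  le : ∀ f, ‖P f‖ ≤ ‖f‖
  pre : ∀ g, ∃ g', ∀ f, pairing (P f) g = pairing f g'

theorem norm_constL_le {K : ℝ} (hK : 0 ≤ K) : ‖constL μ (K : ℂ)‖ ≤ K := by
  refine norm_le_of_ae hK ?_
  filter_upwards [coeFn_constL (μ := μ) (K : ℂ)] with x h1
  rw [h1, Complex.norm_real, Real.norm_of_nonneg hK]

theorem PosContraction.reLe_constL {P : Lp ℂ ∞ μ →ₗ[ℂ] Lp ℂ ∞ μ} (hP : PosContraction P)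
    {a : Lp ℂ ∞ μ} {K : ℝ} (hK : 0 ≤ K) (h : ReLe a (constL μ K)) : ReLe (P a) (constL μ K) :=
  (hP.pos.mono h).trans (SemigroupBMO.reLe_constL ((hP.le _).trans (norm_constL_le hK)))

theorem PosContraction.kadison_schwarz {P : Lp ℂ ∞ μ →ₗ[ℂ] Lp ℂ ∞ μ} (hP : PosContraction P)
    (f : Lp ℂ ∞ μ) : ReLe (absSq (P f)) (P (absSq f)) := by
  have h1 : ReLe (P (constL μ 1)) (constL μ (1 : ℝ)) :=
    SemigroupBMO.reLe_constL ((hP.le _).trans (by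
      have := norm_constL_le (μ := μ) zero_le_one
      rwa [Complex.ofReal_one] at this))
  filter_upwards [hP.pos.kadison_schwarz one_pos h1 f, coeFn_absSq (P f)] with x h2 h3
  rw [h3, Complex.ofReal_re]
  linarith

/-! ### The gradient form of a positive contraction -/

/-- The gradient form `Γ_P(f) = P |f|^2 - |P f|^2`. -/
def gam (P : Lp ℂ ∞ μ →ₗ[ℂ] Lp ℂ ∞ μ) (f : Lp ℂ ∞ μ) : Lp ℂ ∞ μ := P (absSq f) - absSq (P f)

theorem PosContraction.isNonneg_gam {P : Lp ℂ ∞ μ →ₗ[ℂ] Lp ℂ ∞ μ} (hP : PosContraction P)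
    (f : Lp ℂ ∞ μ) : IsNonneg (gam P f) := by
  filter_upwards [hP.kadison_schwarz f, hP.pos _ (isNonneg_absSq f), isNonneg_absSq (P f),
    Lp.coeFn_sub (P (absSq f)) (absSq (P f))] with x h1 h2 h3 h4
  rw [gam, h4, Pi.sub_apply, Complex.sub_re, Complex.sub_im, h2.2, h3.2]
  exact ⟨sub_nonneg.2 h1, sub_zero _⟩

theorem PosContraction.norm_gam_le {P : Lp ℂ ∞ μ →ₗ[ℂ] Lp ℂ ∞ μ} (hP : PosContraction P)
    (f : Lp ℂ ∞ μ) : ‖gam P f‖ ≤ ‖f‖ ^ 2 := by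
  refine (hP.isNonneg_gam f).norm_le (sq_nonneg _) ?_
  refine ReLe.trans (b := P (absSq f)) ?_ (hP.reLe_constL (sq_nonneg _) (absSq_reLe le_rfl))
  filter_upwards [isNonneg_absSq (P f), Lp.coeFn_sub (P (absSq f)) (absSq (P f))] with x h3 h4
  rw [gam, h4, Pi.sub_apply, Complex.sub_re]
  linarith [h3.1]

theorem rePairing_absSq_sub {P : Lp ℂ ∞ μ →ₗ[ℂ] Lp ℂ ∞ μ} (hP : PosOp P) {g : Lp ℂ 1 μ}
    (hg : IsNonnegL1 g) (h k : Lp ℂ ∞ μ) :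
    rePairing g (P (absSq (h - k))) = rePairing g (P (absSq h))
      - 2 * rePairing g (P (mulConj h k)) + rePairing g (P (absSq k)) := by
  have h1 : rePairing g (P (mulConj k h)) = rePairing g (P (mulConj h k)) :=
    le_antisymm (rePairing_mono hg ((hP.re_mulConj_comm k h).mono fun x hx => hx.le))
      (rePairing_mono hg ((hP.re_mulConj_comm h k).mono fun x hx => hx.le))
  rw [absSq_sub]
  simp only [map_sub, map_add]
  rw [h1]
  ring

theorem posOp_id : PosOp (LinearMap.id : Lp ℂ ∞ μ →ₗ[ℂ] Lp ℂ ∞ μ) := fun _ h => h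

/-- A real bilinear form on `L^∞`, weak* continuous in the first variable and satisfying the
inequality `2 B(h, k) ≤ B(h, h) + B(k, k)` of positive semidefinite forms. -/
structure NormalForm (B : Lp ℂ ∞ μ → Lp ℂ ∞ μ → ℝ) : Prop where
  two_mul_le : ∀ h k, 2 * B h k ≤ B h h + B k k
  normal : ∀ k, ∃ G, ∀ h, B h k = rePairing G h

theorem PosContraction.exists_rePairing_mulConj {P : Lp ℂ ∞ μ →ₗ[ℂ] Lp ℂ ∞ μ}
    (hP : PosContraction P) (g : Lp ℂ 1 μ) (k : Lp ℂ ∞ μ) :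
    ∃ G, ∀ h, pairing (P (mulConj h k)) g = pairing h G := by
  obtain ⟨g', hg'⟩ := hP.pre g
  obtain ⟨G, hG⟩ := exists_pairing_mulConj k g'
  exact ⟨G, fun h => by rw [hg', hG]⟩

theorem PosContraction.normalForm {P : Lp ℂ ∞ μ →ₗ[ℂ] Lp ℂ ∞ μ} (hP : PosContraction P)
    {g : Lp ℂ 1 μ} (hg : IsNonnegL1 g) : NormalForm fun h k => rePairing g (P (mulConj h k)) where
  two_mul_le h k := by
    have h1 := rePairing_absSq_sub hP.pos hg h k
    have h2 := ((hP.pos _ (isNonneg_absSq (h - k))).pairing_nonneg hg).1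
    rw [← rePairing_apply] at h2
    rw [← absSq_eq_mulConj, ← absSq_eq_mulConj]
    linarith
  normal k := by
    obtain ⟨G, hG⟩ := hP.exists_rePairing_mulConj g k
    exact ⟨G, fun h => congrArg Complex.re (hG h)⟩

theorem PosContraction.rePairing_gam_sub {P : Lp ℂ ∞ μ →ₗ[ℂ] Lp ℂ ∞ μ} (hP : PosContraction P)
    {g : Lp ℂ 1 μ} (hg : IsNonnegL1 g) (h k : Lp ℂ ∞ μ) :
    rePairing g (gam P (h - k)) = rePairing g (gam P h)
      - 2 * rePairing g (P (mulConj h k) - mulConj (P h) (P k)) + rePairing g (gam P k) := by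
  have h1 := rePairing_absSq_sub hP.pos hg h k
  have h2 := rePairing_absSq_sub posOp_id hg (P h) (P k)
  simp only [LinearMap.id_apply] at h2
  simp only [gam, map_sub] at h1 h2 ⊢
  rw [h1, h2]
  ring

theorem PosContraction.rePairing_gam_nonneg {P : Lp ℂ ∞ μ →ₗ[ℂ] Lp ℂ ∞ μ} (hP : PosContraction P)
    {g : Lp ℂ 1 μ} (hg : IsNonnegL1 g) (h : Lp ℂ ∞ μ) : 0 ≤ rePairing g (gam P h) :=
  ((hP.isNonneg_gam h).pairing_nonneg hg).1

theorem PosContraction.normalForm_gam {P : Lp ℂ ∞ μ →ₗ[ℂ] Lp ℂ ∞ μ} (hP : PosContraction P)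
    {g : Lp ℂ 1 μ} (hg : IsNonnegL1 g) :
    NormalForm fun h k => rePairing g (P (mulConj h k) - mulConj (P h) (P k)) where
  two_mul_le h k := by
    have h1 := hP.rePairing_gam_sub hg h k
    have h2 := hP.rePairing_gam_nonneg hg (h - k)
    rw [← absSq_eq_mulConj, ← absSq_eq_mulConj, ← absSq_eq_mulConj, ← absSq_eq_mulConj, ← gam,
      ← gam]
    linarith
  normal k := by
    obtain ⟨G, hG⟩ := hP.exists_rePairing_mulConj g k
    obtain ⟨g₁, hg₁⟩ := exists_pairing_mulConj (P k) g
    obtain ⟨g₂, hg₂⟩ := hP.pre g₁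
    refine ⟨G + (-1 : ℂ) • g₂, fun h => ?_⟩
    rw [map_sub, rePairing_apply, rePairing_apply, rePairing_apply, hG, hg₁, hg₂,
      pairing_add_right, pairing_smul_right]
    simp [sub_eq_add_neg]

theorem absSq_smul (c : ℝ) (f : Lp ℂ ∞ μ) :
    absSq ((c : ℂ) • f) = ((c ^ 2 : ℝ) : ℂ) • absSq f := by
  refine Lp.ext ?_
  filter_upwards [coeFn_absSq ((c : ℂ) • f), coeFn_absSq f, Lp.coeFn_smul (c : ℂ) f,
    Lp.coeFn_smul ((c ^ 2 : ℝ) : ℂ) (absSq f)] with x h1 h2 h3 h4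
  rw [h1, h4, Pi.smul_apply, h2, h3, Pi.smul_apply, smul_eq_mul, smul_eq_mul, norm_mul,
    Complex.norm_real, mul_pow, Real.norm_eq_abs, sq_abs, Complex.ofReal_mul]

theorem gam_smul (P : Lp ℂ ∞ μ →ₗ[ℂ] Lp ℂ ∞ μ) (c : ℝ) (f : Lp ℂ ∞ μ) :
    gam P ((c : ℂ) • f) = ((c ^ 2 : ℝ) : ℂ) • gam P f := by
  rw [gam, gam, absSq_smul, map_smul, map_smul, absSq_smul, smul_sub]

theorem rePairing_smul (g : Lp ℂ 1 μ) (c : ℝ) (f : Lp ℂ ∞ μ) :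
    rePairing g ((c : ℂ) • f) = c * rePairing g f := by
  rw [rePairing_apply, pairing_smul, Complex.re_ofReal_mul, rePairing_apply]

/-- Young's inequality for the gradient form. -/
theorem PosContraction.rePairing_gam_le {P : Lp ℂ ∞ μ →ₗ[ℂ] Lp ℂ ∞ μ} (hP : PosContraction P)
    {g : Lp ℂ 1 μ} (hg : IsNonnegL1 g) (h k : Lp ℂ ∞ μ) {c : ℝ} (hc : 0 < c) :
    rePairing g (gam P (h - k)) ≤
      (1 + c) * rePairing g (gam P h) + (1 + c⁻¹) * rePairing g (gam P k) := by
  have h1 := hP.rePairing_gam_sub hg h k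
  have h2 := (hP.normalForm_gam hg).two_mul_le (((-c : ℝ) : ℂ) • h) k
  obtain ⟨G, hG⟩ := (hP.normalForm_gam hg).normal k
  simp only [hG (((-c : ℝ) : ℂ) • h)] at h2
  rw [← absSq_eq_mulConj, ← absSq_eq_mulConj, ← absSq_eq_mulConj, ← absSq_eq_mulConj, ← gam,
    ← gam, gam_smul, rePairing_smul, rePairing_smul, ← hG h] at h2
  rw [h1]
  set x := rePairing g (gam P h)
  set y := rePairing g (gam P k)
  set z := rePairing g (P (mulConj h k) - mulConj (P h) (P k))
  have h3 : c⁻¹ * (2 * (-c * z)) ≤ c⁻¹ * ((-c) ^ 2 * x + y) :=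
    mul_le_mul_of_nonneg_left h2 (inv_nonneg.2 hc.le)
  have h4 : c⁻¹ * (2 * (-c * z)) = -2 * z := by field_simp
  have h5 : c⁻¹ * ((-c) ^ 2 * x + y) = c * x + c⁻¹ * y := by field_simp
  linarith

/-- Jensen's inequality for positive forms: if `H = ∫ h_v dν(v)` in the weak* sense, then
`B(H, H) ≤ ∫ B(h_v, h_v) dν(v)`. Only an integrable upper bound of `B(h_v, h_v)` is needed. -/
theorem NormalForm.jensen {B : Lp ℂ ∞ μ → Lp ℂ ∞ μ → ℝ} (hB : NormalForm B) {ν : Measure ℝ}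
    [IsProbabilityMeasure ν] {h : ℝ → Lp ℂ ∞ μ} {H : Lp ℂ ∞ μ}
    (hi : ∀ G, Integrable (fun v => rePairing G (h v)) ν)
    (hH : ∀ G, rePairing G H = ∫ v, rePairing G (h v) ∂ν) {b : ℝ → ℝ} (hb : Integrable b ν)
    (hle : ∀ᵐ v ∂ν, B (h v) (h v) ≤ b v) : B H H ≤ ∫ v, b v ∂ν := by
  obtain ⟨G, hG⟩ := hB.normal H
  have h1 : 2 * B H H ≤ ∫ v, (b v + B H H) ∂ν := by
    rw [hG H, hH G, ← integral_const_mul]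
    refine integral_mono_ae ((hi G).const_mul 2) (hb.add (integrable_const _)) ?_
    filter_upwards [hle] with v hv
    have h2 := hB.two_mul_le (h v) H
    rw [← hH G, ← hG H]
    have h3 := hG (h v)
    linarith
  rw [integral_add hb (integrable_const _), integral_const, probReal_univ, one_smul] at h1
  linarith

/-! ### Comparison of `BMO` norms under subordination -/

/-- Passage from estimates at the level `N` to the extended norms. The bound `R` makes the
right-hand supremum finite, so that it can serve as `N`. -/
theorem iSup_sqrt_le {a b : ℝ → ℝ} {c R : ℝ} (hc : 0 ≤ c) (hb0 : ∀ t, 0 < t → 0 ≤ b t)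
    (hbR : ∀ t, 0 < t → b t ≤ R)
    (h : ∀ N, 0 ≤ N → (∀ t, 0 < t → b t ≤ N ^ 2) → ∀ t, 0 < t → a t ≤ (c * N) ^ 2) :
    ⨆ (t : ℝ) (_ : 0 < t), ENNReal.ofReal (Real.sqrt (a t)) ≤
      ENNReal.ofReal c * ⨆ (t : ℝ) (_ : 0 < t), ENNReal.ofReal (Real.sqrt (b t)) := by
  set B := ⨆ (t : ℝ) (_ : 0 < t), ENNReal.ofReal (Real.sqrt (b t)) with hB
  have hBR : B ≤ ENNReal.ofReal (Real.sqrt R) :=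
    iSup₂_le fun t ht => ENNReal.ofReal_le_ofReal (Real.sqrt_le_sqrt (hbR t ht))
  have hBtop : B ≠ ∞ := (hBR.trans_lt ENNReal.ofReal_lt_top).ne
  have hle : ∀ t, 0 < t → b t ≤ B.toReal ^ 2 := by
    intro t ht
    have h1 : ENNReal.ofReal (Real.sqrt (b t)) ≤ B :=
      le_iSup₂ (f := fun (t : ℝ) (_ : 0 < t) => ENNReal.ofReal (Real.sqrt (b t))) t ht
    rw [ENNReal.ofReal_le_iff_le_toReal hBtop] at h1
    calc b t = Real.sqrt (b t) ^ 2 := (Real.sq_sqrt (hb0 t ht)).symm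
      _ ≤ B.toReal ^ 2 := by gcongr
  refine iSup₂_le fun t ht => ?_
  have h2 := h _ ENNReal.toReal_nonneg hle t ht
  rw [← ENNReal.ofReal_toReal hBtop, ← ENNReal.ofReal_mul hc]
  exact ENNReal.ofReal_le_ofReal (Real.sqrt_le_iff.2 ⟨mul_nonneg hc ENNReal.toReal_nonneg, h2⟩)

namespace PositiveContractionSemigroup

variable (S : PositiveContractionSemigroup μ)

theorem posContraction_op (v : ℝ) : PosContraction (S.op v) :=
  ⟨S.posOp_op v, S.norm_op_le v, S.exists_preadjoint_op v⟩

theorem posContraction_avg [SigmaFinite μ] (ν : Measure ℝ) [IsProbabilityMeasure ν] :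
    PosContraction (S.avg ν) :=
  ⟨S.posOp_avg ν, S.norm_avg_le ν, S.exists_preadjoint_avg ν⟩

theorem BMO_one_eq (f : Lp ℂ ∞ μ) : S.BMO 1 f = ⨆ (t : ℝ) (_ : 0 < t),
    ENNReal.ofReal (Real.sqrt ‖S.op t (absSq (f - S.op t f))‖) := by
  refine iSup_congr fun t => iSup_congr fun ht => ?_
  rw [frac, if_pos rfl, frac, if_pos rfl, S.op_of_nonneg ht.le]

theorem bmo_one_eq (f : Lp ℂ ∞ μ) : S.bmo 1 f = ⨆ (t : ℝ) (_ : 0 < t),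
    ENNReal.ofReal (Real.sqrt ‖gam (S.op t) f‖) := by
  refine iSup_congr fun t => iSup_congr fun ht => ?_
  rw [frac, if_pos rfl, frac, if_pos rfl, gam, S.op_of_nonneg ht.le]

theorem norm_op_absSq_sub_le (f : Lp ℂ ∞ μ) (t : ℝ) :
    ‖S.op t (absSq (f - S.op t f))‖ ≤ (2 * ‖f‖) ^ 2 := by
  refine ((S.posOp_op t) _ (isNonneg_absSq _)).norm_le (sq_nonneg _)
    ((S.posContraction_op t).reLe_constL (sq_nonneg _) (absSq_reLe ?_))
  have := norm_sub_le f (S.op t f)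
  linarith [S.norm_op_le t f]

section oscillation

variable {S} {f : Lp ℂ ∞ μ} {N : ℝ}

/-- Short-time oscillation: for `v ≤ s`, `T_s |f - T_v f|^2 = T_{s-v} T_v |f - T_v f|^2`. -/
theorem op_absSq_sub_le_of_le (hf : ∀ t, 0 < t → ‖S.op t (absSq (f - S.op t f))‖ ≤ N ^ 2) {s v : ℝ}
    (hv : 0 < v) (hvs : v ≤ s) : ReLe (S.op s (absSq (f - S.op v f))) (constL μ (N ^ 2 : ℝ)) := by
  have h1 : S.op s (absSq (f - S.op v f)) = S.op (s - v) (S.op v (absSq (f - S.op v f))) := by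
    rw [← S.op_add (sub_nonneg.2 hvs) hv.le, sub_add_cancel]
  rw [h1]
  exact (S.posContraction_op _).reLe_constL (sq_nonneg _) (reLe_constL (hf v hv))

theorem norm_op_sub_op_le_of_le_two_mul (hN : 0 ≤ N)
    (hf : ∀ t, 0 < t → ‖S.op t (absSq (f - S.op t f))‖ ≤ N ^ 2) {s v : ℝ}
    (hs : 0 < s) (hsv : s ≤ v) (hv : v ≤ 2 * s) : ‖S.op s f - S.op v f‖ ≤ N := by
  rcases hsv.eq_or_lt with rfl | hsv
  · rwa [sub_self, norm_zero]
  have h1 : S.op s f - S.op v f = S.op s (f - S.op (v - s) f) := by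
    rw [map_sub, ← S.op_add hs.le (sub_pos.2 hsv).le, add_sub_cancel]
  rw [h1]
  exact norm_le_of_absSq hN (((S.posContraction_op s).kadison_schwarz _).trans
    (op_absSq_sub_le_of_le hf (sub_pos.2 hsv) (by linarith)))

theorem norm_op_sub_op_le_of_le_pow (hN : 0 ≤ N)
    (hf : ∀ t, 0 < t → ‖S.op t (absSq (f - S.op t f))‖ ≤ N ^ 2) {s : ℝ} (hs : 0 < s) (n : ℕ) :
    ∀ v, s ≤ v → v ≤ 2 ^ n * s → ‖S.op s f - S.op v f‖ ≤ n * N := by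
  induction n with
  | zero =>
    intro v h1 h2
    have : v = s := le_antisymm (by linarith) h1
    simp [this]
  | succ n ih =>
    intro v h1 h2
    have hn : (1 : ℝ) ≤ 2 ^ n := one_le_pow₀ one_le_two
    have hns : s ≤ 2 ^ n * s := le_mul_of_one_le_left hs.le hn
    push_cast
    rcases le_total v (2 ^ n * s) with h3 | h3
    · have := ih v h1 h3
      linarith
    · have h4 := ih _ hns le_rfl
      have h5 := norm_op_sub_op_le_of_le_two_mul hN hf (by positivity) h3
        (by rw [pow_succ] at h2; linarith)
      calc ‖S.op s f - S.op v f‖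
          = ‖(S.op s f - S.op (2 ^ n * s) f) + (S.op (2 ^ n * s) f - S.op v f)‖ := by
            rw [sub_add_sub_cancel]
        _ ≤ _ := (norm_add_le _ _).trans (by linarith)

/-- The logarithmic growth of the oscillation of `f` at the scale `s` between the times `0` and
`v`. -/
theorem op_absSq_sub_le (hN : 0 ≤ N)
    (hf : ∀ t, 0 < t → ‖S.op t (absSq (f - S.op t f))‖ ≤ N ^ 2) {s v : ℝ}
    (hs : 0 < s) (hv : 0 ≤ v) : ReLe (S.op s (absSq (f - S.op v f)))
      (constL μ (N ^ 2 * (2 + 4 * Real.posLog (v / s)) ^ 2 : ℝ)) := by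
  have hp := Real.posLog_nonneg (x := v / s)
  have hN2 : N ^ 2 ≤ N ^ 2 * (2 + 4 * Real.posLog (v / s)) ^ 2 :=
    le_mul_of_one_le_right (sq_nonneg _) (by nlinarith)
  rcases le_total v s with hvs | hvs
  · rcases hv.eq_or_lt with rfl | hv
    · refine (S.posContraction_op s).reLe_constL (by positivity)
        (ReLe.trans (absSq_reLe (N := 0) ?_)
          (constL_mono (by rw [zero_pow two_ne_zero]; positivity)))
      rw [S.op_zero, sub_self, norm_zero]
    · exact (op_absSq_sub_le_of_le hf hv hvs).trans (constL_mono hN2)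
  set r := v / s with hr
  have hr1 : 1 ≤ r := (one_le_div hs).2 hvs
  have hlog : Real.posLog r = Real.log r := Real.posLog_eq_log (by rwa [abs_of_pos (by linarith)])
  have hlog0 : 0 ≤ Real.log r := Real.log_nonneg hr1
  -- `2 ^ n ≥ r` since `2 log 2 ≥ 1`
  set n := ⌈2 * Real.log r⌉₊ with hn
  have hn1 : (n : ℝ) ≤ 2 * Real.log r + 1 := (Nat.ceil_lt_add_one (by positivity)).le
  have hvn : v ≤ 2 ^ n * s := by
    rw [← div_le_iff₀ hs, ← hr, ← Real.log_le_log_iff (by linarith) (by positivity), Real.log_pow]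
    have h1 : 2 * Real.log r ≤ n := Nat.le_ceil _
    have h2 : (1 / 2 : ℝ) ≤ Real.log 2 := by linarith [Real.log_two_gt_d9]
    nlinarith
  have h3 := norm_op_sub_op_le_of_le_pow hN hf hs n v hvs hvn
  have h4 : ReLe (S.op s (absSq (f - S.op v f)))
      (constL μ ((2 + 2 * (n : ℝ) ^ 2) * N ^ 2 : ℝ)) := by
    have h5 := (S.posOp_op s).mono (absSq_add_reLe (f - S.op s f) (S.op s f - S.op v f))
    rw [sub_add_sub_cancel, map_add, map_smul, map_smul] at h5
    have h6 := reLe_constL (hf s hs)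
    have h7 := (S.posContraction_op s).reLe_constL (sq_nonneg _) (absSq_reLe h3)
    filter_upwards [h5, h6, h7, coeFn_constL (μ := μ) ((N ^ 2 : ℝ) : ℂ),
      coeFn_constL (μ := μ) (((n * N) ^ 2 : ℝ) : ℂ),
      coeFn_constL (μ := μ) (((2 + 2 * (n : ℝ) ^ 2) * N ^ 2 : ℝ) : ℂ),
      Lp.coeFn_add ((2 : ℂ) • S.op s (absSq (f - S.op s f)))
        ((2 : ℂ) • S.op s (absSq (S.op s f - S.op v f))),
      Lp.coeFn_smul (2 : ℂ) (S.op s (absSq (f - S.op s f))),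
      Lp.coeFn_smul (2 : ℂ) (S.op s (absSq (S.op s f - S.op v f)))]
      with x a1 a2 a3 a4 a5 a6 a7 a8 a9
    rw [a4, Complex.ofReal_re] at a2
    rw [a5, Complex.ofReal_re] at a3
    rw [a7, Pi.add_apply, a8, a9, Pi.smul_apply, Pi.smul_apply] at a1
    rw [a6, Complex.ofReal_re]
    simp only [smul_eq_mul, Complex.add_re, Complex.mul_re, Complex.re_ofNat,
      Complex.im_ofNat, zero_mul, sub_zero] at a1
    nlinarith
  refine h4.trans (constL_mono ?_)
  rw [mul_comm, hlog]
  gcongr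
  nlinarith

variable [SigmaFinite μ]

/-- Averages over a measure with squared logarithmic moments at some scale `τ` increase the `BMO`
norm by at most a constant: Jensen's inequality for the forms
`⟨T_s (h k^*), g⟩` and `f - P f = ∫ (f - T_v f) dν(v)`. -/
theorem norm_avg_absSq_sub_le (hN : 0 ≤ N)
    (hf : ∀ t, 0 < t → ‖S.op t (absSq (f - S.op t f))‖ ≤ N ^ 2) (ν : Measure ℝ)
    [IsProbabilityMeasure ν] (hν : ∀ᵐ v ∂ν, 0 < v) {τ K : ℝ} (hτ : 0 < τ)
    (hA : Integrable (fun v => Real.posLog (v / τ) ^ 2) ν)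
    (hA' : ∫ v, Real.posLog (v / τ) ^ 2 ∂ν ≤ K)
    (hB : Integrable (fun v => Real.posLog (τ / v) ^ 2) ν)
    (hB' : ∫ v, Real.posLog (τ / v) ^ 2 ∂ν ≤ K) :
    ‖S.avg ν (absSq (f - S.avg ν f))‖ ≤ N ^ 2 * (12 + 96 * K) := by
  have hK : 0 ≤ K := (integral_nonneg fun v => sq_nonneg _).trans hA'
  refine ((S.posOp_avg ν) _ (isNonneg_absSq _)).norm_le (by positivity)
    (reLe_of_rePairing fun g hg => ?_)
  set m := rePairing g (constL μ 1) with hm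
  have hm0 : 0 ≤ m := rePairing_one_nonneg hg
  rw [rePairing_constL, S.rePairing_avg]
  have hpoint : ∀ s, 0 < s → rePairing g (S.op s (absSq (f - S.avg ν f))) ≤
      N ^ 2 * m * (12 + 48 * K + 48 * Real.posLog (τ / s) ^ 2) := by
    intro s hs
    have hform := (S.posContraction_op s).normalForm hg
    have h1 := hform.jensen (ν := ν) (h := fun v => f - S.op v f) (H := f - S.avg ν f)
      (fun G => by
        simp_rw [map_sub]
        exact (integrable_const _).sub (S.integrable_rePairing_op ν f G))
      (fun G => by
        simp_rw [map_sub]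
        rw [integral_sub (integrable_const _) (S.integrable_rePairing_op ν f G), integral_const,
          probReal_univ, one_smul, S.rePairing_avg])
      (b := fun v => N ^ 2 * m * (12 + 48 * Real.posLog (v / τ) ^ 2
        + 48 * Real.posLog (τ / s) ^ 2))
      ((((integrable_const _).add (hA.const_mul 48)).add (integrable_const _)).const_mul _)
      (by
        filter_upwards [hν] with v hv
        rw [← absSq_eq_mulConj]
        refine (rePairing_mono hg (op_absSq_sub_le hN hf hs hv.le)).trans ?_
        rw [rePairing_constL, ← hm]
        -- compare both times with the scale `τ`
        have h2 : Real.posLog (v / s) ≤ Real.posLog (v / τ) + Real.posLog (τ / s) := by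
          have := Real.posLog_mul (x := v / τ) (y := τ / s)
          rwa [div_mul_div_cancel₀ hτ.ne'] at this
        have h3 : (2 + 4 * Real.posLog (v / s)) ^ 2 ≤
            12 + 48 * Real.posLog (v / τ) ^ 2 + 48 * Real.posLog (τ / s) ^ 2 := by
          have h4 : (2 + 4 * Real.posLog (v / s)) ^ 2 ≤
              (2 + 4 * (Real.posLog (v / τ) + Real.posLog (τ / s))) ^ 2 := by
            have := Real.posLog_nonneg (x := v / s)
            gcongr
          nlinarith [sq_nonneg (2 - 4 * Real.posLog (v / τ)),
            sq_nonneg (2 - 4 * Real.posLog (τ / s)),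
            sq_nonneg (4 * Real.posLog (v / τ) - 4 * Real.posLog (τ / s))]
        have := mul_le_mul_of_nonneg_left h3 (mul_nonneg (sq_nonneg N) hm0)
        linarith)
    rw [← absSq_eq_mulConj] at h1
    refine h1.trans ?_
    have hA1 : Integrable (fun v => 12 + 48 * Real.posLog (v / τ) ^ 2) ν :=
      (integrable_const _).add (hA.const_mul 48)
    rw [integral_const_mul, integral_add hA1 (integrable_const _),
      integral_add (integrable_const _) (hA.const_mul 48), integral_const_mul,
      integral_const, integral_const, probReal_univ, one_smul, one_smul]
    gcongr
  have hint : Integrable (fun s => N ^ 2 * m * (12 + 48 * K + 48 * Real.posLog (τ / s) ^ 2)) ν :=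
    ((integrable_const _).add (hB.const_mul 48)).const_mul _
  refine (integral_mono_ae (S.integrable_rePairing_op ν _ g) hint
    (hν.mono fun s hs => hpoint s hs)).trans ?_
  rw [integral_const_mul, integral_add (integrable_const _) (hB.const_mul 48), integral_const_mul,
    integral_const, probReal_univ, one_smul]
  have := mul_le_mul_of_nonneg_left (show 12 + 48 * K + 48 * ∫ v, Real.posLog (τ / v) ^ 2 ∂ν ≤
    12 + 96 * K by linarith) (mul_nonneg (sq_nonneg N) hm0)
  linarith

end oscillation

variable [SigmaFinite μ]

theorem BMO_le_BMO_one {γ : ℝ} (h0 : 0 < γ) (h1 : γ < 1) (f : Lp ℂ ∞ μ) :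
    S.BMO γ f ≤ ENNReal.ofReal (68 / γ) * S.BMO 1 f := by
  rw [S.BMO_one_eq]
  refine iSup_sqrt_le (by positivity) (fun t _ => norm_nonneg _)
    (fun t _ => S.norm_op_absSq_sub_le f t) fun N hN hf t ht => ?_
  have := isProbabilityMeasure_stableMeasure t h0 h1.le
  rw [S.frac_eq_avg h0 h1.le ht, S.frac_eq_avg h0 h1.le ht]
  have hpos : ∀ᵐ v ∂stableMeasure t γ, 0 < v := by
    rw [stableMeasure_eq ht h1]
    exact (withDensity_absolutelyContinuous _ _).ae_le (ae_restrict_mem measurableSet_Ioi)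
  obtain ⟨⟨a1, a2⟩, b1, b2⟩ := posLog_moment_stableMeasure ht h0 h1.le
  refine (norm_avg_absSq_sub_le hN hf _ hpos (Real.rpow_pos_of_pos ht (1 / γ)) a1 a2 b1 b2).trans ?_
  rw [mul_pow, mul_comm]
  gcongr
  have hγ2 : γ ^ 2 ≤ 1 := pow_le_one₀ h0.le h1.le
  rw [div_pow, le_div_iff₀ (by positivity), add_mul, mul_assoc 96,
    div_mul_cancel₀ _ (by positivity)]
  linarith

theorem BMO_le_BMO {α β : ℝ} (hβ : 0 < β) (hβα : β < α) (hα : α ≤ 1) (f : Lp ℂ ∞ μ) :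
    S.BMO β f ≤ ENNReal.ofReal (68 * α / β) * S.BMO α f := by
  have h0 : 0 < α := hβ.trans hβα
  have h1 := (S.subord h0 hα).BMO_le_BMO_one (div_pos hβ h0) ((div_lt_one h0).2 hβα) f
  rw [S.BMO_subord h0 hα (div_pos hβ h0) ((div_lt_one h0).2 hβα).le,
    S.BMO_subord h0 hα one_pos le_rfl, div_mul_cancel₀ _ h0.ne', one_mul] at h1
  rwa [div_div_eq_mul_div] at h1

end PositiveContractionSemigroup

namespace PositiveContractionSemigroup

variable (S : PositiveContractionSemigroup μ)

/-! ### The gradient form along the semigroup -/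

theorem gam_op_op_le {g : Lp ℂ 1 μ} (hg : IsNonnegL1 g) {t : ℝ} (ht : 0 ≤ t) (f : Lp ℂ ∞ μ) :
    rePairing g (gam (S.op t) (S.op t f)) ≤ rePairing g (gam (S.op (2 * t)) f) := by
  have h1 := rePairing_mono hg ((S.posOp_op t).mono ((S.posContraction_op t).kadison_schwarz f))
  rw [gam, gam, two_mul, S.op_add ht ht, S.op_add ht ht, map_sub, map_sub]
  linarith

theorem absSq_sub_op_eq {t : ℝ} (ht : 0 ≤ t) (f : Lp ℂ ∞ μ) :
    S.op t (absSq (f - S.op t f)) =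
      gam (S.op t) (f - S.op t f) + absSq (S.op t f - S.op (2 * t) f) := by
  rw [gam, two_mul, S.op_add ht ht, map_sub, sub_add_cancel]

theorem GammaTwoNonneg.reLe {S : PositiveContractionSemigroup μ} (hS : S.GammaTwoNonneg) {t u : ℝ}
    (ht : 0 < t) (hu : 0 < u) (f : Lp ℂ ∞ μ) :
    ReLe (gam (S.op t) (S.op u f)) (S.op u (gam (S.op t) f)) := by
  have h := hS t u ht hu f
  rw [← S.op_of_nonneg ht.le, ← S.op_of_nonneg hu.le] at h
  filter_upwards [h, Lp.coeFn_sub (S.op u (gam (S.op t) f)) (gam (S.op t) (S.op u f))] with x h1 h2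
  change 0 ≤ (((S.op u (gam (S.op t) f)) - gam (S.op t) (S.op u f) : Lp ℂ ∞ μ) x).re ∧ _ at h1
  rw [h2, Pi.sub_apply, Complex.sub_re] at h1
  linarith [h1.1]

/-- The criterion in a form that is symmetric in `T_t` and `T_u`. -/
theorem GammaTwoNonneg.reLe_op {S : PositiveContractionSemigroup μ} (hS : S.GammaTwoNonneg)
    {t u : ℝ} (ht : 0 ≤ t) (hu : 0 ≤ u) (f : Lp ℂ ∞ μ) :
    ReLe (S.op t (absSq (S.op u f)) + gam (S.op u) (S.op t f)) (S.op u (S.op t (absSq f))) := by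
  rcases hu.eq_or_lt with rfl | hu
  · simp only [gam, S.op_zero, sub_self, add_zero]
    exact ReLe.refl _
  rcases ht.eq_or_lt with rfl | ht
  · simp only [gam, S.op_zero, add_sub_cancel]
    exact ReLe.refl _
  have hcomm : S.op t (S.op u f) = S.op u (S.op t f) := by
    rw [← S.op_add ht.le hu.le, add_comm, S.op_add hu.le ht.le]
  have h1 := hS.reLe ht hu f
  simp only [gam, map_sub, hcomm] at h1 ⊢
  filter_upwards [h1, Lp.coeFn_sub (S.op t (absSq (S.op u f))) (absSq (S.op u (S.op t f))),
    Lp.coeFn_sub (S.op u (S.op t (absSq f))) (S.op u (absSq (S.op t f))),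
    Lp.coeFn_sub (S.op u (absSq (S.op t f))) (absSq (S.op u (S.op t f))),
    Lp.coeFn_add (S.op t (absSq (S.op u f)))
      (S.op u (absSq (S.op t f)) - absSq (S.op u (S.op t f)))] with x a1 a2 a3 a4 a5
  rw [a2, a3, Pi.sub_apply, Pi.sub_apply, Complex.sub_re, Complex.sub_re] at a1
  rw [a5, Pi.add_apply, a4, Pi.sub_apply, Complex.add_re, Complex.sub_re]
  linarith

/-- Under `Γ² ≥ 0`, `Γ_{T_t}(T_t f)` is at most half of `Γ_{T_{2t}}(f)`. -/
theorem GammaTwoNonneg.two_mul_gam_le {S : PositiveContractionSemigroup μ} (hS : S.GammaTwoNonneg)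
    {g : Lp ℂ 1 μ} (hg : IsNonnegL1 g) {t : ℝ} (ht : 0 < t) (f : Lp ℂ ∞ μ) :
    2 * rePairing g (gam (S.op t) (S.op t f)) ≤ rePairing g (gam (S.op (2 * t)) f) := by
  have h1 := rePairing_mono hg (hS.reLe ht ht f)
  rw [two_mul t]
  simp only [gam, map_sub, S.op_add ht.le ht.le] at h1 ⊢
  linarith

variable [SigmaFinite μ]

/-! ### Averages over dominated measures -/

theorem integral_le_of_measure_le {ν ν' : Measure ℝ} [IsFiniteMeasure ν'] {C : ℝ} (hC : 0 ≤ C)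
    (hνν' : ν ≤ ENNReal.ofReal C • ν') {φ : ℝ → ℝ} (h0 : ∀ v, 0 ≤ φ v) (hφ : Integrable φ ν') :
    ∫ v, φ v ∂ν ≤ C * ∫ v, φ v ∂ν' := by
  have h1 := integral_mono_measure hνν' (Eventually.of_forall h0)
    (hφ.smul_measure ENNReal.ofReal_ne_top)
  rwa [integral_smul_measure, ENNReal.toReal_ofReal hC, smul_eq_mul] at h1

/-- If `ν ≤ C ν'`, then the positive operator `Q = C P' - P` satisfies `Q 1 ≤ C - 1`, and the
Kadison–Schwarz inequality for `Q` reads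
`C (P' |f|^2 - |P' f|^2) - (P |f|^2 - |P f|^2) ≥ C / (C - 1) |P f - P' f|^2`. -/
theorem gam_avg_of_measure_le {ν ν' : Measure ℝ} [IsProbabilityMeasure ν] [IsProbabilityMeasure ν']
    {C : ℝ} (hC : 1 < C) (hνν' : ν ≤ ENNReal.ofReal C • ν') (f : Lp ℂ ∞ μ) :
    ∀ᵐ x ∂μ, (C - 1) * (gam (S.avg ν) f x).re + C * ‖(S.avg ν f - S.avg ν' f : Lp ℂ ∞ μ) x‖ ^ 2 ≤
      (C - 1) * (C * (gam (S.avg ν') f x).re) := by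
  have hC0 : 0 ≤ C := by linarith
  set Q : Lp ℂ ∞ μ →ₗ[ℂ] Lp ℂ ∞ μ := (C : ℂ) • S.avg ν' - S.avg ν with hQdef
  have hQre : ∀ g a, rePairing g (Q a) =
      C * (∫ v, rePairing g (S.op v a) ∂ν') - ∫ v, rePairing g (S.op v a) ∂ν := by
    intro g a
    rw [hQdef, LinearMap.sub_apply, LinearMap.smul_apply, map_sub, rePairing_smul, S.rePairing_avg,
      S.rePairing_avg]
  have hQ : PosOp Q := by
    intro a ha
    have h1 : ReLe 0 (Q a) := reLe_of_rePairing fun g hg => by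
      rw [map_zero, hQre, sub_nonneg]
      exact integral_le_of_measure_le hC0 hνν'
        (fun v => ((S.posOp_op v a ha).pairing_nonneg hg).1) (S.integrable_rePairing_op ν' a g)
    filter_upwards [h1, Lp.coeFn_zero ℂ ∞ μ, S.posOp_avg ν' a ha, S.posOp_avg ν a ha,
      Lp.coeFn_sub ((C : ℂ) • S.avg ν' a) (S.avg ν a), Lp.coeFn_smul (C : ℂ) (S.avg ν' a)]
      with x b1 b2 b3 b4 b5 b6
    rw [b2, Pi.zero_apply, Complex.zero_re] at b1
    refine ⟨b1, ?_⟩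
    rw [hQdef, LinearMap.sub_apply, LinearMap.smul_apply, b5, Pi.sub_apply, b6, Pi.smul_apply,
      smul_eq_mul, Complex.sub_im, Complex.im_ofReal_mul, b3.2, b4.2, mul_zero, sub_zero]
  have hQ1 : ReLe (Q (constL μ 1)) (constL μ ((C - 1 : ℝ) : ℂ)) := reLe_of_rePairing fun g hg => by
    set m := rePairing g (constL μ 1) with hm
    have h1 : ∀ v, 0 ≤ m - rePairing g (S.op v (constL μ 1)) := fun v => by
      have h2 := rePairing_mono hg ((S.posContraction_op v).reLe_constL zero_le_one
        (ReLe.refl (constL μ ((1 : ℝ) : ℂ))))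
      rw [Complex.ofReal_one] at h2
      exact sub_nonneg.2 h2
    have hi := S.integrable_rePairing_op ν' (constL μ 1) g
    have hi' := S.integrable_rePairing_op ν (constL μ 1) g
    have h3 := integral_le_of_measure_le hC0 hνν' h1 ((integrable_const _).sub hi)
    rw [integral_sub (integrable_const _) hi, integral_sub (integrable_const _) hi', integral_const,
      integral_const, probReal_univ, probReal_univ, one_smul] at h3
    rw [hQre, rePairing_constL, ← hm]
    linarith
  filter_upwards [hQ.kadison_schwarz (sub_pos.2 hC) hQ1 f,
    Lp.coeFn_sub ((C : ℂ) • S.avg ν' (absSq f)) (S.avg ν (absSq f)),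
    Lp.coeFn_smul (C : ℂ) (S.avg ν' (absSq f)), Lp.coeFn_sub ((C : ℂ) • S.avg ν' f) (S.avg ν f),
    Lp.coeFn_smul (C : ℂ) (S.avg ν' f), Lp.coeFn_sub (S.avg ν f) (S.avg ν' f),
    Lp.coeFn_sub (S.avg ν (absSq f)) (absSq (S.avg ν f)),
    Lp.coeFn_sub (S.avg ν' (absSq f)) (absSq (S.avg ν' f)), coeFn_absSq (S.avg ν f),
    coeFn_absSq (S.avg ν' f)] with x a1 a2 a3 a4 a5 a6 a7 a8 a9 a10
  rw [hQdef, LinearMap.sub_apply, LinearMap.sub_apply, LinearMap.smul_apply, LinearMap.smul_apply,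
    a2, a4, Pi.sub_apply, Pi.sub_apply, a3, a5, Pi.smul_apply, Pi.smul_apply] at a1
  rw [gam, gam, a7, a8, a6, Pi.sub_apply, Pi.sub_apply, Pi.sub_apply, a9, a10]
  generalize S.avg ν f x = p at *
  generalize S.avg ν' f x = q at *
  simp only [← Complex.normSq_eq_norm_sq, Complex.normSq_apply, smul_eq_mul, Complex.sub_re,
    Complex.sub_im, Complex.ofReal_re, Complex.re_ofReal_mul, Complex.im_ofReal_mul] at a1 ⊢
  nlinarith

theorem norm_gam_avg_le_of_measure_le {ν ν' : Measure ℝ} [IsProbabilityMeasure ν]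
    [IsProbabilityMeasure ν'] {C N : ℝ} (hC : 1 < C) (hνν' : ν ≤ ENNReal.ofReal C • ν')
    {f : Lp ℂ ∞ μ} (h : ‖gam (S.avg ν') f‖ ≤ N ^ 2) :
    ‖gam (S.avg ν) f‖ ≤ C * N ^ 2 := by
  refine ((S.posContraction_avg ν).isNonneg_gam f).norm_le (by positivity) ?_
  filter_upwards [S.gam_avg_of_measure_le hC hνν' f, reLe_constL h,
    coeFn_constL (μ := μ) ((N ^ 2 : ℝ) : ℂ), coeFn_constL (μ := μ) ((C * N ^ 2 : ℝ) : ℂ)]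
    with x h1 h2 h3 h4
  rw [h3, Complex.ofReal_re] at h2
  rw [h4, Complex.ofReal_re]
  have hC1 : 0 < C - 1 := sub_pos.2 hC
  have h5 : (C - 1) * (gam (S.avg ν) f x).re ≤ (C - 1) * (C * (gam (S.avg ν') f x).re) := by
    have : 0 ≤ C * ‖(S.avg ν f - S.avg ν' f : Lp ℂ ∞ μ) x‖ ^ 2 := by positivity
    linarith
  have h6 := le_of_mul_le_mul_left h5 hC1
  have h7 : C * (gam (S.avg ν') f x).re ≤ C * N ^ 2 := by gcongr
  linarith

theorem norm_avg_sub_le_of_measure_le {ν ν' : Measure ℝ} [IsProbabilityMeasure ν]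
    [IsProbabilityMeasure ν'] {N : ℝ} (hN : 0 ≤ N) (hνν' : ν ≤ ENNReal.ofReal 2 • ν')
    {f : Lp ℂ ∞ μ} (h : ‖gam (S.avg ν') f‖ ≤ N ^ 2) : ‖S.avg ν f - S.avg ν' f‖ ≤ N := by
  refine norm_le_of_ae hN ?_
  filter_upwards [S.gam_avg_of_measure_le one_lt_two hνν' f, reLe_constL h,
    coeFn_constL (μ := μ) ((N ^ 2 : ℝ) : ℂ), (S.posContraction_avg ν).isNonneg_gam f]
    with x h1 h2 h3 h4
  rw [h3, Complex.ofReal_re] at h2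
  refine (pow_le_pow_iff_left₀ (norm_nonneg _) hN two_ne_zero).1 ?_
  linarith [h4.1]

/-! ### `BMO` is dominated by `bmo` for subordinated semigroups -/

/-- If `‖f‖_{bmo(L^β)} ≤ N`, then `T_{t,β} f` and `T_{2t,β} f` differ by at most a
multiple of `N`. -/
theorem norm_subord_op_sub_le {β N : ℝ} (h0 : 0 < β) (h1 : β < 1) (hN : 0 ≤ N) {f : Lp ℂ ∞ μ}
    (hf : ∀ t, 0 < t → ‖gam ((S.subord h0 h1.le).op t) f‖ ≤ N ^ 2) {t : ℝ} (ht : 0 < t) :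
    ‖(S.subord h0 h1.le).op t f - (S.subord h0 h1.le).op (2 * t) f‖ ≤
      (1 / (1 - β) + 1) * N := by
  have hβ : 0 < 1 - β := sub_pos.2 h1
  have hop : ∀ s, 0 < s → (S.subord h0 h1.le).op s =
      haveI := isProbabilityMeasure_stableMeasure s h0 h1.le; S.avg (stableMeasure s β) := by
    intro s hs
    exact (S.subord h0 h1.le).op_of_nonneg hs.le
  set S' := S.subord h0 h1.le with hS'
  set k := ⌈1 / (1 - β)⌉₊ with hk
  have hk1 : 1 / (1 - β) ≤ k := Nat.le_ceil _
  have hk0 : 0 < (k : ℝ) := lt_of_lt_of_le (by positivity) hk1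
  -- a dilation by `r = 2^{1/k}` at most doubles the density, and `k` such steps reach `2 t`
  set r : ℝ := 2 ^ (1 / (k : ℝ)) with hr
  have hr1 : 1 ≤ r := Real.one_le_rpow one_le_two (by positivity)
  have hrk : r ^ k = 2 := by
    rw [hr, ← Real.rpow_natCast, ← Real.rpow_mul zero_le_two, one_div_mul_cancel hk0.ne',
      Real.rpow_one]
  have hr2 : r ^ (1 / (1 - β)) ≤ 2 := by
    calc r ^ (1 / (1 - β)) ≤ r ^ (k : ℝ) := Real.rpow_le_rpow_of_exponent_le hr1 hk1
      _ = 2 := by rw [Real.rpow_natCast, hrk]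
  have hstep : ∀ s, 0 < s → ‖S'.op (r * s) f - S'.op s f‖ ≤ N := by
    intro s hs
    have hrs : 0 < r * s := mul_pos (by linarith) hs
    have := isProbabilityMeasure_stableMeasure s h0 h1.le
    have := isProbabilityMeasure_stableMeasure (r * s) h0 h1.le
    have h2 := hf s hs
    rw [hop s hs] at h2 ⊢
    rw [hop _ hrs]
    refine S.norm_avg_sub_le_of_measure_le hN ?_ h2
    refine (stableMeasure_mul_le hs hr1 h0 h1).trans fun A => ?_
    simp only [Measure.smul_apply, smul_eq_mul]
    gcongr
  have hind : ∀ j : ℕ, ‖S'.op (r ^ j * t) f - S'.op t f‖ ≤ j * N := by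
    intro j
    induction j with
    | zero => simp
    | succ j ih =>
      have h2 := hstep (r ^ j * t) (by positivity)
      rw [← mul_assoc, ← pow_succ'] at h2
      have h3 := norm_add_le (S'.op (r ^ (j + 1) * t) f - S'.op (r ^ j * t) f)
        (S'.op (r ^ j * t) f - S'.op t f)
      rw [sub_add_sub_cancel] at h3
      push_cast
      linarith
  have h3 := hind k
  rw [hrk] at h3
  rw [norm_sub_rev]
  refine h3.trans (mul_le_mul_of_nonneg_right ?_ hN)
  exact (Nat.ceil_lt_add_one (by positivity)).le

theorem BMO_le_bmo {β : ℝ} (h0 : 0 < β) (h1 : β < 1) (f : Lp ℂ ∞ μ) :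
    S.BMO β f ≤ ENNReal.ofReal (4 / (1 - β)) * S.bmo β f := by
  have hβ : 0 < 1 - β := sub_pos.2 h1
  rw [← one_mul β, ← S.BMO_subord h0 h1.le one_pos le_rfl,
    ← S.bmo_subord h0 h1.le one_pos le_rfl, BMO_one_eq, bmo_one_eq, one_mul]
  refine iSup_sqrt_le (by positivity) (fun t _ => norm_nonneg _)
    (fun t _ => ((S.subord h0 h1.le).posContraction_op t).norm_gam_le f) fun N hN hf t ht => ?_
  have h2 := S.norm_subord_op_sub_le h0 h1 hN hf ht
  set S' := S.subord h0 h1.le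
  refine ((S'.posOp_op t) _ (isNonneg_absSq _)).norm_le (sq_nonneg _)
    (reLe_of_rePairing fun g hg => ?_)
  have hm0 : 0 ≤ rePairing g (constL μ 1) := rePairing_one_nonneg hg
  have h3 := (S'.posContraction_op t).rePairing_gam_le hg f (S'.op t f) one_pos
  have h4 := S'.gam_op_op_le hg ht.le f
  have h5 := rePairing_mono hg (reLe_constL (hf t ht))
  have h6 := rePairing_mono hg (reLe_constL (hf (2 * t) (by linarith)))
  have h7 := rePairing_mono hg (absSq_reLe h2)
  rw [rePairing_constL] at h5 h6 h7
  rw [S'.absSq_sub_op_eq ht.le, map_add, rePairing_constL]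
  have hK : 1 ≤ 1 / (1 - β) := (one_le_div hβ).2 (by linarith)
  rw [show 4 / (1 - β) = 4 * (1 / (1 - β)) by ring]
  set K := 1 / (1 - β)
  have h8 : 4 * N ^ 2 + ((K + 1) * N) ^ 2 ≤ (4 * K * N) ^ 2 := by
    have : 4 + (K + 1) ^ 2 ≤ (4 * K) ^ 2 := by nlinarith
    calc 4 * N ^ 2 + ((K + 1) * N) ^ 2 = (4 + (K + 1) ^ 2) * N ^ 2 := by ring
      _ ≤ (4 * K) ^ 2 * N ^ 2 := by gcongr
      _ = _ := by ring
  have h9 := mul_le_mul_of_nonneg_right h8 hm0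
  norm_num at h3
  linarith

/-! ### Consequences of `Γ² ≥ 0` -/

/-- The inequality `Γ² ≥ 0`, for a fixed second operator `R`, is inherited by averages: apply
Jensen's inequality to the gradient form of `R`. -/
theorem gammaTwo_avg {R : Lp ℂ ∞ μ →ₗ[ℂ] Lp ℂ ∞ μ} (hR : PosContraction R) (ν : Measure ℝ)
    [IsProbabilityMeasure ν] (hν : ∀ᵐ v ∂ν, 0 ≤ v) (f : Lp ℂ ∞ μ)
    (h : ∀ v, 0 ≤ v → ReLe (S.op v (absSq (R f)) + gam R (S.op v f)) (R (S.op v (absSq f)))) :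
    ReLe (S.avg ν (absSq (R f)) + gam R (S.avg ν f)) (R (S.avg ν (absSq f))) := by
  refine reLe_of_rePairing fun g hg => ?_
  obtain ⟨g', hg'⟩ := hR.pre g
  have hg'' : ∀ a, rePairing g (R a) = rePairing g' a := fun a => congrArg Complex.re (hg' a)
  have hi1 := S.integrable_rePairing_op ν (absSq f) g'
  have hi2 := S.integrable_rePairing_op ν (absSq (R f)) g
  have h1 := (hR.normalForm_gam hg).jensen (ν := ν) (h := fun v => S.op v f) (H := S.avg ν f)
    (fun G => S.integrable_rePairing_op ν f G) (fun G => S.rePairing_avg ν f G)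
    (b := fun v => rePairing g' (S.op v (absSq f)) - rePairing g (S.op v (absSq (R f))))
    (hi1.sub hi2) (by
      filter_upwards [hν] with v hv
      have h2 := rePairing_mono hg (h v hv)
      rw [← absSq_eq_mulConj, ← absSq_eq_mulConj, ← gam, ← hg'']
      rw [map_add] at h2
      linarith)
  rw [← absSq_eq_mulConj, ← absSq_eq_mulConj, ← gam, integral_sub hi1 hi2] at h1
  rw [map_add, hg'', S.rePairing_avg, S.rePairing_avg]
  linarith

theorem op_avg_comm {u : ℝ} (hu : 0 ≤ u) (ν : Measure ℝ) [IsProbabilityMeasure ν]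
    (hν : ∀ᵐ v ∂ν, 0 ≤ v) (f : Lp ℂ ∞ μ) : S.op u (S.avg ν f) = S.avg ν (S.op u f) := by
  refine ext_pairing fun g => ?_
  rw [S.op_avg hu ν hν, S.pairing_avg]
  refine integral_congr_ae ?_
  filter_upwards [hν] with v hv
  rw [add_comm, S.op_add hv hu]

/-- The criterion `Γ² ≥ 0` passes to the subordinated semigroups. -/
theorem gammaTwoNonneg_subord (hS : S.GammaTwoNonneg) {α : ℝ} (h0 : 0 < α) (h1 : α ≤ 1) :
    (S.subord h0 h1).GammaTwoNonneg := by
  intro t u ht hu f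
  have := isProbabilityMeasure_stableMeasure t h0 h1
  have := isProbabilityMeasure_stableMeasure u h0 h1
  have hν := ae_nonneg_stableMeasure t α
  have hν' := ae_nonneg_stableMeasure u α
  change IsNonneg (S.avg (stableMeasure u α) (gam (S.avg (stableMeasure t α)) f) -
    gam (S.avg (stableMeasure t α)) (S.avg (stableMeasure u α) f))
  have hcomm : ∀ f, S.avg (stableMeasure u α) (S.avg (stableMeasure t α) f) =
      S.avg (stableMeasure t α) (S.avg (stableMeasure u α) f) := by
    intro f
    refine ext_pairing fun g => ?_
    obtain ⟨g', hg'⟩ := (S.posContraction_avg (stableMeasure u α)).pre g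
    rw [hg', S.pairing_avg, S.pairing_avg]
    refine integral_congr_ae ?_
    filter_upwards [hν] with v hv
    rw [← hg', S.op_avg_comm hv _ hν']
  have hstep : ∀ v, 0 ≤ v → ReLe (S.avg (stableMeasure t α) (absSq (S.op v f)) +
      gam (S.op v) (S.avg (stableMeasure t α) f)) (S.op v (S.avg (stableMeasure t α) (absSq f))) :=
    fun v hv => S.gammaTwo_avg (S.posContraction_op v) _ hν f fun w hw => hS.reLe_op hw hv f
  -- the criterion is symmetric in the two operators, so that each is averaged in turn
  have hfin := S.gammaTwo_avg (S.posContraction_avg (stableMeasure t α)) (stableMeasure u α) hν' f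
    fun v hv => by
      have h2 := hstep v hv
      simp only [gam, S.op_avg_comm hv _ hν] at h2 ⊢
      filter_upwards [h2,
        Lp.coeFn_add (S.avg (stableMeasure t α) (absSq (S.op v f))) (S.op v (absSq
          (S.avg (stableMeasure t α) f)) - absSq (S.avg (stableMeasure t α) (S.op v f))),
        Lp.coeFn_sub (S.op v (absSq (S.avg (stableMeasure t α) f)))
          (absSq (S.avg (stableMeasure t α) (S.op v f))),
        Lp.coeFn_add (S.op v (absSq (S.avg (stableMeasure t α) f)))
          (S.avg (stableMeasure t α) (absSq (S.op v f)) -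
            absSq (S.avg (stableMeasure t α) (S.op v f))),
        Lp.coeFn_sub (S.avg (stableMeasure t α) (absSq (S.op v f)))
          (absSq (S.avg (stableMeasure t α) (S.op v f)))] with x a1 a2 a3 a4 a5
      rw [a2, Pi.add_apply, a3, Pi.sub_apply, Complex.add_re, Complex.sub_re] at a1
      rw [a4, Pi.add_apply, a5, Pi.sub_apply, Complex.add_re, Complex.sub_re]
      linarith
  have him1 := (S.posOp_avg (stableMeasure u α)) _
    ((S.posContraction_avg (stableMeasure t α)).isNonneg_gam f)
  have him2 := (S.posContraction_avg (stableMeasure t α)).isNonneg_gam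
    (S.avg (stableMeasure u α) f)
  simp only [gam, map_sub, hcomm] at hfin him1 him2 ⊢
  set P := S.avg (stableMeasure t α)
  set R := S.avg (stableMeasure u α)
  filter_upwards [hfin, him1, him2,
    Lp.coeFn_add (R (absSq (P f))) (P (absSq (R f)) - absSq (P (R f))),
    Lp.coeFn_sub (P (absSq (R f))) (absSq (P (R f))),
    Lp.coeFn_sub (P (R (absSq f))) (R (absSq (P f))),
    Lp.coeFn_sub (P (R (absSq f)) - R (absSq (P f))) (P (absSq (R f)) - absSq (P (R f)))]
    with x a1 a2 a3 a4 a5 a6 a7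
  rw [a4, Pi.add_apply, a5, Pi.sub_apply, Complex.add_re, Complex.sub_re] at a1
  rw [a7, Pi.sub_apply, Complex.sub_re, Complex.sub_im, a2.2, a3.2, a6, a5, Pi.sub_apply,
    Pi.sub_apply, Complex.sub_re, Complex.sub_re]
  exact ⟨by linarith, sub_zero _⟩

/-- Under `Γ² ≥ 0`, split `f = (f - T_t f) + T_t f`: the second part contributes at most half of
the gradient form at time `2 t`, and is absorbed. -/
theorem bmo_one_le_BMO_one (hS : S.GammaTwoNonneg) (f : Lp ℂ ∞ μ) :
    S.bmo 1 f ≤ ENNReal.ofReal 4 * S.BMO 1 f := by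
  rw [S.BMO_one_eq, S.bmo_one_eq]
  refine iSup_sqrt_le (by norm_num) (fun t _ => norm_nonneg _)
    (fun t _ => S.norm_op_absSq_sub_le f t) fun N hN hf => ?_
  have hbdd : BddAbove (range fun t : Ioi (0 : ℝ) => ‖gam (S.op t) f‖) :=
    ⟨‖f‖ ^ 2, by rintro _ ⟨t, rfl⟩; exact (S.posContraction_op t).norm_gam_le f⟩
  set K := ⨆ t : Ioi (0 : ℝ), ‖gam (S.op t) f‖ with hK
  have hle : ∀ t, 0 < t → ‖gam (S.op t) f‖ ≤ K := fun t ht => le_ciSup hbdd ⟨t, ht⟩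
  have hK0 : 0 ≤ K := (norm_nonneg _).trans (hle 1 one_pos)
  have hstep : ∀ t, 0 < t → ‖gam (S.op t) f‖ ≤ 4 * N ^ 2 + 2 / 3 * K := by
    intro t ht
    refine ((S.posContraction_op t).isNonneg_gam f).norm_le (by positivity)
      (reLe_of_rePairing fun g hg => ?_)
    have hm0 : 0 ≤ rePairing g (constL μ 1) := rePairing_one_nonneg hg
    -- any `c > 1` makes the coefficient `(1 + c⁻¹) / 2` of `K` smaller than `1`
    have h1 := (S.posContraction_op t).rePairing_gam_le hg (f - S.op t f) (-S.op t f)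
      (c := 3) (by norm_num)
    have h2 : gam (S.op t) (-S.op t f) = gam (S.op t) (S.op t f) := by
      have := gam_smul (S.op t) (-1) (S.op t f)
      simpa using this
    rw [sub_neg_eq_add, sub_add_cancel, h2] at h1
    have h3 := hS.two_mul_gam_le hg ht f
    have h4 := rePairing_mono hg (reLe_constL (hle (2 * t) (by linarith)))
    have h5 := rePairing_mono hg (reLe_constL (hf t ht))
    have h6 := S.absSq_sub_op_eq ht.le f
    have h7 := rePairing_mono hg (isNonneg_absSq (S.op t f - S.op (2 * t) f)).reLe_zero
    rw [h6, map_add] at h5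
    rw [map_zero] at h7
    rw [rePairing_constL] at h4 h5 ⊢
    norm_num at h1
    linarith
  have hKle : K ≤ 4 * N ^ 2 + 2 / 3 * K := by
    have : Nonempty (Ioi (0 : ℝ)) := ⟨⟨1, mem_Ioi.2 one_pos⟩⟩
    exact ciSup_le fun t => hstep t t.2
  intro t ht
  have := hle t ht
  nlinarith [sq_nonneg N]

theorem bmo_le_BMO (hS : S.GammaTwoNonneg) {α : ℝ} (h0 : 0 < α) (h1 : α ≤ 1) (f : Lp ℂ ∞ μ) :
    S.bmo α f ≤ ENNReal.ofReal 4 * S.BMO α f := by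
  rw [← one_mul α, ← S.BMO_subord h0 h1 one_pos le_rfl, ← S.bmo_subord h0 h1 one_pos le_rfl]
  exact bmo_one_le_BMO_one _ (S.gammaTwoNonneg_subord hS h0 h1) f

/-- The `bmo` norm of a larger exponent `α < 1` is dominated by that of `γ α`, since each stable
measure of index `α` is dominated by one of index `γ α`. -/
theorem bmo_le_bmo {α γ : ℝ} (h0 : 0 < α) (h1 : α < 1) (hγ0 : 0 < γ) (hγ1 : γ ≤ 1)
    (f : Lp ℂ ∞ μ) :
    S.bmo α f ≤ ENNReal.ofReal (Real.sqrt (60 / (γ * (1 - α)))) * S.bmo (γ * α) f := by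
  have hα : 0 < 1 - α := sub_pos.2 h1
  have hγα : γ * α < 1 := (mul_le_of_le_one_left h0.le hγ1).trans_lt h1
  have hγα0 : 0 < γ * α := mul_pos hγ0 h0
  have hC : 1 < 60 / (γ * (1 - α)) := by
    rw [one_lt_div (mul_pos hγ0 hα)]
    nlinarith
  have heq : ∀ {a : ℝ} (ha0 : 0 < a) (ha1 : a ≤ 1), S.bmo a f = ⨆ (t : ℝ) (_ : 0 < t),
      ENNReal.ofReal (Real.sqrt ‖gam ((S.subord ha0 ha1).op t) f‖) := by
    intro a ha0 ha1
    rw [← bmo_one_eq, S.bmo_subord ha0 ha1 one_pos le_rfl, one_mul]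
  rw [heq h0 h1.le, heq hγα0 hγα.le]
  refine iSup_sqrt_le (Real.sqrt_nonneg _) (fun t _ => norm_nonneg _)
    (fun t _ => ((S.subord hγα0 hγα.le).posContraction_op t).norm_gam_le f) fun N hN hf b hb => ?_
  obtain ⟨t, ht, hle⟩ := exists_stableMeasure_le hγ0 hγ1 h0 h1 hb
  have := isProbabilityMeasure_stableMeasure b h0 h1.le
  have := isProbabilityMeasure_stableMeasure t hγα0 hγα.le
  have h2 := hf t ht
  rw [op_of_nonneg _ ht.le] at h2
  rw [op_of_nonneg _ hb.le, mul_pow, Real.sq_sqrt (by positivity)]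
  exact S.norm_gam_avg_le_of_measure_le hC hle h2

end PositiveContractionSemigroup

/-! ### Equivalence of the norms -/

theorem le_ofReal_mul_trans {x y z : ℝ≥0∞} {a b c : ℝ} (ha : 0 ≤ a) (h1 : x ≤ ENNReal.ofReal a * y)
    (h2 : y ≤ ENNReal.ofReal b * z) (h : a * b ≤ c) : x ≤ ENNReal.ofReal c * z := by
  calc x ≤ ENNReal.ofReal a * y := h1
    _ ≤ ENNReal.ofReal a * (ENNReal.ofReal b * z) := by gcongr
    _ = ENNReal.ofReal (a * b) * z := by rw [ENNReal.ofReal_mul ha, mul_assoc]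
    _ ≤ ENNReal.ofReal c * z := by gcongr

theorem le_ofReal_mul_mono {x z : ℝ≥0∞} {a c : ℝ} (h1 : x ≤ ENNReal.ofReal a * z) (h : a ≤ c) :
    x ≤ ENNReal.ofReal c * z :=
  h1.trans (by gcongr)

namespace PositiveContractionSemigroup

/-- The comparison of two `bmo` norms under `Γ² ≥ 0`: domination of stable measures if `β ≤ α`,
and a detour through the `BMO` norms if `α < β`. -/
theorem exists_bmo_le_bmo {α β : ℝ} (hα0 : 0 < α) (hα1 : α < 1) (hβ0 : 0 < β) (hβ1 : β < 1) :
    ∃ C : ℝ, 0 < C ∧ ∀ (M : Type u) [MeasurableSpace M] (μ : Measure M) [SigmaFinite μ]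
      (S : PositiveContractionSemigroup μ), S.GammaTwoNonneg →
      ∀ f : Lp ℂ ∞ μ, S.bmo α f ≤ ENNReal.ofReal C * S.bmo β f := by
  rcases le_or_gt β α with h | h
  · have hα : 0 < 1 - α := sub_pos.2 hα1
    refine ⟨Real.sqrt (60 / (β / α * (1 - α))), by positivity, fun M _ μ _ S _ f => ?_⟩
    have h1 := S.bmo_le_bmo hα0 hα1 (div_pos hβ0 hα0) ((div_le_one hα0).2 h) f
    rwa [div_mul_cancel₀ _ hα0.ne'] at h1
  · have hβ : 0 < 1 - β := sub_pos.2 hβ1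
    refine ⟨4 * (68 * β / α * (4 / (1 - β))), by positivity, fun M _ μ _ S hS f => ?_⟩
    exact le_ofReal_mul_trans (by norm_num) (S.bmo_le_BMO hS hα0 hα1.le f)
      (le_ofReal_mul_trans (by positivity) (S.BMO_le_BMO hα0 h hβ1.le f)
        (S.BMO_le_bmo hβ0 hβ1 f) le_rfl) le_rfl

/-- The domination constant of `bmo_le_bmo` stays of order `1 / (1 - α)` as `α → 1`, because
`γ = 1 / (2 α) ≥ 1 / 2`. -/
theorem BMO_le_BMO_half [SigmaFinite μ] (S : PositiveContractionSemigroup μ)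
    (hS : S.GammaTwoNonneg) {α : ℝ} (h0 : 1 / 2 < α) (h1 : α < 1) (f : Lp ℂ ∞ μ) :
    S.BMO α f ≤ ENNReal.ofReal (176 / (1 - α) ^ 2) * S.BMO (1 / 2) f := by
  have hα0 : 0 < α := by linarith
  have hα : 0 < 1 - α := sub_pos.2 h1
  have hγ : 1 / 2 ≤ 1 / 2 / α := by rw [le_div_iff₀ hα0]; linarith
  have e1 := S.bmo_le_bmo hα0 h1 (γ := 1 / 2 / α) (by positivity) ((div_le_one hα0).2 h0.le) f
  rw [div_mul_cancel₀ _ hα0.ne'] at e1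
  have e2 : Real.sqrt (60 / (1 / 2 / α * (1 - α))) ≤ 11 / (1 - α) := by
    refine Real.sqrt_le_iff.2 ⟨by positivity, ?_⟩
    rw [div_pow, div_le_div_iff₀ (by positivity) (by positivity)]
    have : 1 / 2 * (1 - α) ≤ 1 / 2 / α * (1 - α) := by gcongr
    nlinarith
  refine le_ofReal_mul_trans (by positivity) (S.BMO_le_bmo hα0 h1 f) (le_ofReal_mul_trans
    (by positivity) (le_ofReal_mul_mono e1 e2) (S.bmo_le_BMO hS (by norm_num) (by norm_num) f)
    le_rfl) (le_of_eq ?_)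
  field_simp
  norm_num

end PositiveContractionSemigroup

end SemigroupBMO

end

theorem lemma2 :
    -- comparison of the `BMO` norms for different exponents, with an absolute constant
    (∃ c : ℝ, 0 < c ∧ ∀ (M : Type u) [MeasurableSpace M] (μ : Measure M) [SigmaFinite μ]
      (S : SemigroupBMO.PositiveContractionSemigroup μ) (α β : ℝ), 0 < β → β < α → α ≤ 1 →
      ∀ f : Lp ℂ ∞ μ, S.BMO β f ≤ ENNReal.ofReal (c * α / β) * S.BMO α f) ∧
    -- `BMO` is dominated by `bmo`
    (∀ (M : Type u) [MeasurableSpace M] (μ : Measure M) [SigmaFinite μ]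
      (S : SemigroupBMO.PositiveContractionSemigroup μ) (β : ℝ), 0 < β → β < 1 →
      ∀ f : Lp ℂ ∞ μ, S.BMO β f ≤ ENNReal.ofReal (4 / (1 - β)) * S.bmo β f) ∧
    -- under `Γ² ≥ 0`, equivalence of all the norms, with constants depending only on `α, β`
    (∀ α β : ℝ, 0 < α → α < 1 → 0 < β → β < 1 → ∃ C : ℝ, 0 < C ∧
      ∀ (M : Type u) [MeasurableSpace M] (μ : Measure M) [SigmaFinite μ]
      (S : SemigroupBMO.PositiveContractionSemigroup μ), S.GammaTwoNonneg →
      ∀ f : Lp ℂ ∞ μ,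
        (S.BMO α f ≤ ENNReal.ofReal C * S.bmo α f ∧
          S.bmo α f ≤ ENNReal.ofReal C * S.BMO α f) ∧
        (S.bmo α f ≤ ENNReal.ofReal C * S.bmo β f ∧
          S.bmo β f ≤ ENNReal.ofReal C * S.bmo α f) ∧
        (S.BMO α f ≤ ENNReal.ofReal C * S.BMO β f ∧
          S.BMO β f ≤ ENNReal.ofReal C * S.BMO α f)) ∧
    -- under `Γ² ≥ 0`, comparison with `BMO(√L)`, with absolute constants
    (∃ c₁ c₂ : ℝ, 0 < c₁ ∧ 0 < c₂ ∧
      ∀ (M : Type u) [MeasurableSpace M] (μ : Measure M) [SigmaFinite μ]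
      (S : SemigroupBMO.PositiveContractionSemigroup μ), S.GammaTwoNonneg →
      ∀ α : ℝ, 1 / 2 < α → α < 1 → ∀ f : Lp ℂ ∞ μ,
        ENNReal.ofReal (c₁ * (1 - α) ^ 2) * S.BMO α f ≤ S.BMO (1 / 2) f ∧
          S.BMO (1 / 2) f ≤ ENNReal.ofReal c₂ * S.BMO α f) := by
  refine ⟨⟨68, by norm_num, fun M _ μ _ S α β h0 h1 h2 f => S.BMO_le_BMO h0 h1 h2 f⟩,
    fun M _ μ _ S β h0 h1 f => S.BMO_le_bmo h0 h1 f, fun α β hα0 hα1 hβ0 hβ1 => ?_,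
    1 / 176, 136, by norm_num, by norm_num, fun M _ μ _ S hS α h0 h1 f => ⟨?_, ?_⟩⟩
  · obtain ⟨C₁, hC₁, H₁⟩ :=
      SemigroupBMO.PositiveContractionSemigroup.exists_bmo_le_bmo.{u} hα0 hα1 hβ0 hβ1
    obtain ⟨C₂, hC₂, H₂⟩ :=
      SemigroupBMO.PositiveContractionSemigroup.exists_bmo_le_bmo.{u} hβ0 hβ1 hα0 hα1
    have hα : 0 < 4 / (1 - α) := div_pos four_pos (sub_pos.2 hα1)
    have hβ : 0 < 4 / (1 - β) := div_pos four_pos (sub_pos.2 hβ1)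
    have p1 : 0 < 4 / (1 - α) * (C₁ * 4) := by positivity
    have p2 : 0 < 4 / (1 - β) * (C₂ * 4) := by positivity
    refine ⟨4 / (1 - α) + 4 + C₁ + C₂ + 4 / (1 - α) * (C₁ * 4) + 4 / (1 - β) * (C₂ * 4),
      by positivity, fun M _ μ _ S hS f => ⟨⟨?_, ?_⟩, ⟨?_, ?_⟩, ?_, ?_⟩⟩
    · exact SemigroupBMO.le_ofReal_mul_mono (S.BMO_le_bmo hα0 hα1 f) (by linarith)
    · exact SemigroupBMO.le_ofReal_mul_mono (S.bmo_le_BMO hS hα0 hα1.le f) (by linarith)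
    · exact SemigroupBMO.le_ofReal_mul_mono (H₁ M μ S hS f) (by linarith)
    · exact SemigroupBMO.le_ofReal_mul_mono (H₂ M μ S hS f) (by linarith)
    · exact SemigroupBMO.le_ofReal_mul_trans hα.le (S.BMO_le_bmo hα0 hα1 f)
        (SemigroupBMO.le_ofReal_mul_trans hC₁.le (H₁ M μ S hS f) (S.bmo_le_BMO hS hβ0 hβ1.le f)
          le_rfl) (by linarith)
    · exact SemigroupBMO.le_ofReal_mul_trans hβ.le (S.BMO_le_bmo hβ0 hβ1 f)
        (SemigroupBMO.le_ofReal_mul_trans hC₂.le (H₂ M μ S hS f) (S.bmo_le_BMO hS hα0 hα1.le f)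
          le_rfl) (by linarith)
  · have hα : 0 < 1 - α := sub_pos.2 h1
    calc ENNReal.ofReal (1 / 176 * (1 - α) ^ 2) * S.BMO α f
        ≤ ENNReal.ofReal (1 / 176 * (1 - α) ^ 2) *
          (ENNReal.ofReal (176 / (1 - α) ^ 2) * S.BMO (1 / 2) f) := by
          gcongr
          exact S.BMO_le_BMO_half hS h0 h1 f
      _ = S.BMO (1 / 2) f := by
          rw [← mul_assoc, ← ENNReal.ofReal_mul (by positivity)]
          have : 1 / 176 * (1 - α) ^ 2 * (176 / (1 - α) ^ 2) = 1 := by field_simp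
          rw [this, ENNReal.ofReal_one, one_mul]
  · exact SemigroupBMO.le_ofReal_mul_mono (S.BMO_le_BMO (by norm_num) h0 h1.le f) (by linarith)
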